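/- **Networks.** Let $F$ be a countable set of functions $\mathbb R\to\mathbb R$ (activation functions), with a fixed injective numbering $F\hookrightarrow\mathbb N$. An $F$-network $N$ with $n$ inputs and $m$ outputs is a layered feedforward network: an input layer of $n$ nodes, any number of hidden layers, and an output layer of $m$ nodes, where the $i$-th node of a non-input layer computes $\sigma_i(\sum_j c_{ji}y_j+b_i)$ from the values $y_j$ of those nodes of the previous layer to which it is connected, with $\sigma_i\in F$ and $c_{ji},b_i\in\mathbb Q$. It computes a function $N:\mathbb R^n\to\mathbb R^m$. Put $\mathrm{ReLU}(x)=\max\{0,x\}$. **Problems.** Let $d$ be a family of metrics, one on each $\mathbb R^n$; $d_\infty$ is the maximum metric. - $\mathrm{VIP}(F)$: given an $F$-network $N$ and two finite systems $A$, $B$ of non-strict linear inequalities with rational coefficients, in the input variables and in the output variables of $N$, respectively, does $N(x)$ satisfy $B$ for all $x\in\mathbb R^n$ that satisfy $A$? - $\mathrm{CR}_d(F)$: given an $F$-network $N$, $\varepsilon\in\mathbb Q_{\ge0}\cup\{\infty\}$, $\bar x\in\mathbb Q^n$ and $j\in\{1,\dots,m\}$, is $N(x)_j=\max_i N(x)_i$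 for all $x\in\mathbb R^n$ with $d(x,\bar x)\le\varepsilon$? - $\mathrm{SR}_d(F)$: given an $F$-network $N$, $\varepsilon,\delta\in\mathbb Q_{\ge0}\cup\{\infty\}$ and $\bar x\in\mathbb Q^n$, is $d(N(\bar x),N(x))\le\delta$ for all $x\in\mathbb R^n$ with $d(x,\bar x)\le\varepsilon$? Write $\mathrm{SR}_\infty$, $\mathrm{CR}_\infty$ for $d=d_\infty$. **Size and linear time.** An instance is written as a list of natural numbers in binary: the numbers of nodes of the layers, and for each node its activation (by its number in the numbering of $F$), its bias and the list of its connections (index of the source node, weight); linear inequalities are given by the lists of their terms (index of the variable, coefficient) and their right-hand sides; a rational number is given by sign, numerator and denominator. The size of an instance is $T\cdot L$, where $T$ is the number of entries of the list and $L$ is one plus the maximal number of binary digits of an entry. A problem $P$ is linear-time reducible to $Q$ if there is a function $f$ from the instances of $P$ to those of $Q$ such that $I$ is a yes-instance of $P$ if and only if $f(I)$ is a yes-instance of $Q$, and, for some constant $C$, $f$ is computed by a deterministic multi-stack (equivalently, multi-tape) Turing machine in at most $C\cdot\mathrm{size}(I)$ steps and $\mathrm{size}(f(I))\le C\cdot\mathrm{size}(I)$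 for all $I$. **Theorem.** 1. $\mathrm{SR}_\infty(F)$ is linear-time reducible to $\mathrm{VIP}(F)$. 2. $\mathrm{CR}_\infty(F)$ is linear-time reducible to $\mathrm{VIP}(F)$. 3. If $\mathrm{id}\in F$, then $\mathrm{SR}_\infty(F)$ is linear-time reducible to $\mathrm{CR}_\infty(F)$. 4. If $\mathrm{ReLU}\in F$, then $\mathrm{CR}_d(F)$ is linear-time reducible to $\mathrm{SR}_d(F)$ for every family $d$ of metrics, one on each $\mathbb R^n$, without isolated points (for all $n\ge1$, $x\in\mathbb R^n$ and $r>0$ there is $y\ne x$ with $d(y,x)\le r$). -/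

import Mathlib

namespace NNVerif

/-! ## Descriptions as lists of natural numbers, their size, and linear-time reductions -/

/-- The word over the three-letter alphabet `{0, 1, separator}` that writes down a list of natural
numbers: each number in binary (least significant digit first), followed by the separator `none`. -/
def encode (ws : List ℕ) : List (Option Bool) :=
  ws.flatMap fun w => w.bits.map some ++ [none]

/-- The largest number of binary digits of a number in the list. -/
def maxBits (ws : List ℕ) : ℕ := (ws.map Nat.size).foldr max 0

/-- Size of a description: the number of its entries times the maximal length of an entry
(binary digits and one separator). -/
def size (ws : List ℕ) : ℕ := ws.length * (maxBits ws + 1)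

/-- A decision problem: instances, the yes-instances, and a description of each instance by a list
of natural numbers, from which the instance can be recovered. -/
structure Problem where
  Inst : Type
  Yes : Inst → Prop
  data : Inst → List ℕ
  data_injective : Function.Injective data

/-- `f` is computed by a Turing machine (a deterministic machine with finitely many stacks, finite
alphabets and finitely many states) whose number of steps is linear in the size of the input. The
size of the output is linear in the size of the input, too. -/
def LinearTimeComputable (P Q : Problem) (f : P.Inst → Q.Inst) : Prop :=
  ∃ (M : Turing.TM2ComputableAux (Option Bool) (Option Bool)) (C : ℕ), ∀ I : P.Inst,
    Nonempty (Turing.TM2OutputsInTime M.tm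
      ((encode (P.data I)).map M.inputAlphabet.symm)
      (some ((encode (Q.data (f I))).map M.outputAlphabet.symm))
      (C * size (P.data I))) ∧
    size (Q.data (f I)) ≤ C * size (P.data I)

/-- Linear-time many-one reducibility. -/
def LinearTimeReducible (P Q : Problem) : Prop :=
  ∃ f : P.Inst → Q.Inst, LinearTimeComputable P Q f ∧ ∀ I, P.Yes I ↔ Q.Yes (f I)

/-! ## Sparse linear forms, linear programs, networks -/

/-- A rational linear form in `n` variables, given by its list of terms (variable, coefficient),
each variable occurring at most once. -/
@[ext] structure LinForm (n : ℕ) where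
  terms : List (Fin n × ℚ)
  nodup : (terms.map Prod.fst).Nodup

/-- The value `∑ⱼ cⱼ xⱼ`. -/
noncomputable def LinForm.eval {n : ℕ} (a : LinForm n) (x : Fin n → ℝ) : ℝ :=
  (a.terms.map fun t => (t.2 : ℝ) * x t.1).sum

/-- One linear inequality `∑ⱼ aⱼ xⱼ ≤ b`. -/
@[ext] structure LinIneq (n : ℕ) where
  lhs : LinForm n
  rhs : ℚ

/-- A system of linear inequalities in `n` variables. -/
abbrev LP (n : ℕ) := List (LinIneq n)

/-- `x` satisfies all inequalities of the system. -/
def LP.Sat {n : ℕ} (A : LP n) (x : Fin n → ℝ) : Prop :=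
  ∀ c ∈ A, c.lhs.eval x ≤ (c.rhs : ℝ)

/-- A computation node with activation function in `F` above a layer of `n` nodes: its activation,
its bias, and its incoming connections (node of the previous layer, weight). -/
@[ext] structure Node (F : Set (ℝ → ℝ)) (n : ℕ) where
  act : F
  bias : ℚ
  conns : LinForm n

/-- The output `σ(∑ⱼ cⱼ yⱼ + b)` of a node on the outputs `y` of the previous layer. -/
noncomputable def Node.eval {F : Set (ℝ → ℝ)} {n : ℕ} (v : Node F n) (y : Fin n → ℝ) : ℝ :=
  (v.act : ℝ → ℝ) (v.conns.eval y + (v.bias : ℝ))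

/-- `Net F m n`: the feedforward networks with activation functions in `F`, with `n` input nodes
and `m` output nodes. Above the input layer there is either the output layer, or a hidden layer
with `k` nodes followed by a network with these `k` nodes as input nodes. -/
inductive Net (F : Set (ℝ → ℝ)) (m : ℕ) : ℕ → Type
  | output {n : ℕ} (layer : Fin m → Node F n) : Net F m n
  | hidden {n k : ℕ} (layer : Fin k → Node F n) (rest : Net F m k) : Net F m n

/-- The function `ℝⁿ → ℝᵐ` computed by a network. -/
noncomputable def Net.eval {F : Set (ℝ → ℝ)} {m : ℕ} :
    {n : ℕ} → Net F m n → (Fin n → ℝ) → (Fin m → ℝ)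
  | _, .output layer, x => fun i => (layer i).eval x
  | _, .hidden layer rest, x => rest.eval fun i => (layer i).eval x

/-! ## Descriptions of these objects -/

/-- A list is written with a `1` in front of each element and a `0` at the end. -/
def listData {α : Type} (w : α → List ℕ) : List α → List ℕ
  | [] => [0]
  | a :: l => 1 :: (w a ++ listData w l)

/-- A rational number: sign, absolute value of the numerator, denominator. -/
def ratData (q : ℚ) : List ℕ := [if q < 0 then 1 else 0, q.num.natAbs, q.den]

/-- An element of `ℚ≥0 ∪ {∞}`: `0` for `∞`, otherwise `1`, numerator, denominator. -/
def boundData : WithTop NNRat → List ℕ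
  | none => [0]
  | some q => [1, q.num, q.den]

def termData {n : ℕ} (t : Fin n × ℚ) : List ℕ := (t.1 : ℕ) :: ratData t.2

def LinForm.data {n : ℕ} (a : LinForm n) : List ℕ := listData termData a.terms

def LinIneq.data {n : ℕ} (c : LinIneq n) : List ℕ := c.lhs.data ++ ratData c.rhs

def LP.data {n : ℕ} (A : LP n) : List ℕ := listData LinIneq.data A

/-- The activation functions are written as numbers, by means of the numbering `code` of `F`. -/
def Node.data {F : Set (ℝ → ℝ)} (code : F ↪ ℕ) {n : ℕ} (v : Node F n) : List ℕ :=
  code v.act :: (ratData v.bias ++ v.conns.data)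

/-- A layer: the number of nodes, and the list of nodes. -/
def layerData {F : Set (ℝ → ℝ)} (code : F ↪ ℕ) {n k : ℕ} (layer : Fin k → Node F n) : List ℕ :=
  k :: listData (Node.data code) (List.ofFn layer)

/-- The layers of a network in order, a hidden layer marked by `1`, the output layer by `0`. -/
def Net.layersData {F : Set (ℝ → ℝ)} (code : F ↪ ℕ) {m : ℕ} : {n : ℕ} → Net F m n → List ℕ
  | _, .output layer => 0 :: layerData code layer
  | _, .hidden layer rest => 1 :: (layerData code layer ++ rest.layersData code)

/-- A network: the number of input nodes, and the layers. -/
def Net.data {F : Set (ℝ → ℝ)} (code : F ↪ ℕ) {m n : ℕ} (N : Net F m n) : List ℕ :=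
  n :: N.layersData code

/-- A rational point. -/
def pointData {n : ℕ} (x : Fin n → ℚ) : List ℕ := listData ratData (List.ofFn x)

/-! ## Instances and conditions -/

/-- The rational point `x` as a real point. -/
def toReal {n : ℕ} (x : Fin n → ℚ) : Fin n → ℝ := fun i => (x i : ℝ)

/-- `t ≤ r` for a real `t` and `r ∈ ℚ≥0 ∪ {∞}`. -/
def Within (t : ℝ) : WithTop NNRat → Prop
  | none => True
  | some q => t ≤ (q : ℝ)

/-- Instances `(N, A, B)`: a network, input specifications, output specifications. -/
structure VIPInst (F : Set (ℝ → ℝ)) where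
  n : ℕ
  m : ℕ
  net : Net F m n
  inSpec : LP n
  outSpec : LP m

/-- Every input that satisfies the input specifications is mapped to an output that satisfies the
output specifications. -/
def VIPInst.Holds {F : Set (ℝ → ℝ)} (I : VIPInst F) : Prop :=
  ∀ x : Fin I.n → ℝ, I.inSpec.Sat x → I.outSpec.Sat (I.net.eval x)

def VIPInst.data {F : Set (ℝ → ℝ)} (code : F ↪ ℕ) (I : VIPInst F) : List ℕ :=
  I.net.data code ++ (I.inSpec.data ++ I.outSpec.data)

/-- Instances `(N, ε, x̄, j)`. -/
structure CRInst (F : Set (ℝ → ℝ)) where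
  n : ℕ
  m : ℕ
  net : Net F m n
  ε : WithTop NNRat
  center : Fin n → ℚ
  j : Fin m

/-- Classification robustness: on the closed `ε`-ball about `x̄`, the output with index `j` is a
maximal one. -/
def CRInst.Holds {F : Set (ℝ → ℝ)} (d : ∀ n : ℕ, MetricSpace (Fin n → ℝ)) (I : CRInst F) : Prop :=
  ∀ x : Fin I.n → ℝ, Within ((d I.n).dist x (toReal I.center)) I.ε →
    ∀ i : Fin I.m, I.net.eval x i ≤ I.net.eval x I.j

def CRInst.data {F : Set (ℝ → ℝ)} (code : F ↪ ℕ) (I : CRInst F) : List ℕ :=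
  I.net.data code ++ (boundData I.ε ++ (pointData I.center ++ [(I.j : ℕ)]))

/-- Instances `(N, ε, δ, x̄)`. -/
structure SRInst (F : Set (ℝ → ℝ)) where
  n : ℕ
  m : ℕ
  net : Net F m n
  ε : WithTop NNRat
  δ : WithTop NNRat
  center : Fin n → ℚ

/-- Standard robustness: the closed `ε`-ball about `x̄` is mapped into the closed `δ`-ball
about `N(x̄)`. -/
def SRInst.Holds {F : Set (ℝ → ℝ)} (d : ∀ n : ℕ, MetricSpace (Fin n → ℝ)) (I : SRInst F) : Prop :=
  ∀ x : Fin I.n → ℝ, Within ((d I.n).dist x (toReal I.center)) I.ε →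
    Within ((d I.m).dist (I.net.eval (toReal I.center)) (I.net.eval x)) I.δ

def SRInst.data {F : Set (ℝ → ℝ)} (code : F ↪ ℕ) (I : SRInst F) : List ℕ :=
  I.net.data code ++ (boundData I.ε ++ (boundData I.δ ++ pointData I.center))

/-! ## The descriptions determine the objects -/

/-- Prefix-free injectivity of a description. -/
def Decodable {α : Type} (w : α → List ℕ) : Prop :=
  ∀ a b s t, w a ++ s = w b ++ t → a = b ∧ s = t

theorem encode_injective : Function.Injective encode := by
  have key : ∀ (u v : List Bool) (s t : List (Option Bool)),
      u.map some ++ none :: s = v.map some ++ none :: t → u = v ∧ s = t := by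
    intro u
    induction u with
    | nil => intro v s t h; cases v <;> simp_all
    | cons a u ih =>
      intro v s t h
      cases v with
      | nil => simp at h
      | cons b v =>
        simp only [List.map_cons, List.cons_append, List.cons.injEq, Option.some.injEq] at h
        obtain ⟨h1, h2⟩ := ih v s t h.2
        exact ⟨by rw [h.1, h1], h2⟩
  have bits_inj : ∀ a b : ℕ, a.bits = b.bits → a = b := by
    have dec : ∀ n : ℕ, n.bits.foldr Nat.bit 0 = n := by
      intro n
      induction n using Nat.binaryRec' with
      | zero => simp
      | bit b n hn ih => rw [Nat.bits_append_bit n b hn, List.foldr_cons, ih]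
    intro a b h
    rw [← dec a, ← dec b, h]
  intro a
  induction a with
  | nil => intro b h; cases b <;> simp_all [encode]
  | cons x a ih =>
    intro b h
    cases b with
    | nil => simp [encode] at h
    | cons y b =>
      simp only [encode, List.flatMap_cons, List.append_assoc, List.singleton_append] at h
      obtain ⟨h1, h2⟩ := key _ _ _ _ h
      rw [bits_inj x y h1, ih h2]

theorem listData_decodable {α : Type} {w : α → List ℕ} (hw : Decodable w) :
    Decodable (listData w) := by
  intro a
  induction a with
  | nil => intro b s t h; cases b <;> simp_all [listData]
  | cons x a ih =>
    intro b s t h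
    cases b with
    | nil => simp [listData] at h
    | cons y b =>
      simp only [listData, List.cons_append, List.append_assoc, List.cons.injEq, true_and] at h
      obtain ⟨h1, h2⟩ := hw _ _ _ _ h
      obtain ⟨h3, h4⟩ := ih _ _ _ h2
      exact ⟨by rw [h1, h3], h4⟩

theorem ratData_decodable : Decodable ratData := by
  intro a b s t h
  simp only [ratData, List.cons_append, List.nil_append, List.cons.injEq] at h
  obtain ⟨h1, h2, h3, h4⟩ := h
  refine ⟨Rat.ext ?_ h3, h4⟩
  simp only [← Rat.num_neg (a := a), ← Rat.num_neg (a := b)] at h1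
  split_ifs at h1 <;> omega

theorem boundData_decodable : Decodable boundData := by
  intro a b s t h
  rcases a with _ | a <;> rcases b with _ | b <;>
    simp only [boundData, List.cons_append, List.nil_append, List.cons.injEq] at h
  · exact ⟨rfl, h.2⟩
  · simp at h
  · simp at h
  · exact ⟨by rw [NNRat.ext_num_den h.2.1 h.2.2.1], h.2.2.2⟩

theorem linForm_decodable (n : ℕ) : Decodable (LinForm.data (n := n)) := by
  have ht : Decodable (termData (n := n)) := by
    intro a b s t h
    simp only [termData, List.cons_append, List.cons.injEq] at h
    obtain ⟨h1, h2⟩ := ratData_decodable _ _ _ _ h.2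
    exact ⟨Prod.ext (Fin.ext h.1) h1, h2⟩
  intro a b s t h
  obtain ⟨h1, h2⟩ := listData_decodable ht _ _ _ _ h
  exact ⟨LinForm.ext h1, h2⟩

theorem lp_decodable (n : ℕ) : Decodable (LP.data (n := n)) := by
  apply listData_decodable
  intro a b s t h
  simp only [LinIneq.data, List.append_assoc] at h
  obtain ⟨h1, h2⟩ := linForm_decodable n _ _ _ _ h
  obtain ⟨h3, h4⟩ := ratData_decodable _ _ _ _ h2
  exact ⟨LinIneq.ext h1 h3, h4⟩

theorem node_decodable {F : Set (ℝ → ℝ)} (code : F ↪ ℕ) (n : ℕ) :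
    Decodable (Node.data code (n := n)) := by
  intro a b s t h
  simp only [Node.data, List.cons_append, List.append_assoc, List.cons.injEq] at h
  obtain ⟨h1, h2⟩ := ratData_decodable _ _ _ _ h.2
  obtain ⟨h3, h4⟩ := linForm_decodable n _ _ _ _ h2
  exact ⟨Node.ext (code.injective h.1) h1 h3, h4⟩

theorem point_decodable (n : ℕ) : Decodable (pointData (n := n)) := by
  intro a b s t h
  obtain ⟨h1, h2⟩ := listData_decodable ratData_decodable _ _ _ _ h
  exact ⟨List.ofFn_injective h1, h2⟩

theorem layerData_inj {F : Set (ℝ → ℝ)} (code : F ↪ ℕ) {n k k' : ℕ} (a : Fin k → Node F n)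
    (b : Fin k' → Node F n) (s t : List ℕ) (h : layerData code a ++ s = layerData code b ++ t) :
    k = k' ∧ HEq a b ∧ s = t := by
  simp only [layerData, List.cons_append, List.cons.injEq] at h
  obtain ⟨rfl, h⟩ := h
  obtain ⟨h1, h2⟩ := listData_decodable (node_decodable code n) _ _ _ _ h
  exact ⟨rfl, heq_of_eq (List.ofFn_injective h1), h2⟩

theorem layersData_inj {F : Set (ℝ → ℝ)} (code : F ↪ ℕ) {m m' n : ℕ} (a : Net F m n)
    (b : Net F m' n) (s t : List ℕ) (h : a.layersData code ++ s = b.layersData code ++ t) :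
    m = m' ∧ HEq a b ∧ s = t := by
  induction a with
  | output layer =>
    cases b with
    | output layer' =>
      simp only [Net.layersData, List.cons_append, List.cons.injEq, true_and] at h
      obtain ⟨rfl, h1, h2⟩ := layerData_inj code _ _ _ _ h
      obtain rfl := eq_of_heq h1
      exact ⟨rfl, HEq.rfl, h2⟩
    | hidden layer' rest' => simp [Net.layersData] at h
  | hidden layer rest ih =>
    cases b with
    | output layer' => simp [Net.layersData] at h
    | hidden layer' rest' =>
      simp only [Net.layersData, List.cons_append, List.append_assoc, List.cons.injEq,
        true_and] at h
      obtain ⟨rfl, h1, h2⟩ := layerData_inj code _ _ _ _ h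
      obtain rfl := eq_of_heq h1
      obtain ⟨rfl, h3, h4⟩ := ih rest' h2
      obtain rfl := eq_of_heq h3
      exact ⟨rfl, HEq.rfl, h4⟩

theorem netData_inj {F : Set (ℝ → ℝ)} (code : F ↪ ℕ) {m m' n n' : ℕ} (a : Net F m n)
    (b : Net F m' n') (s t : List ℕ) (h : a.data code ++ s = b.data code ++ t) :
    n = n' ∧ m = m' ∧ HEq a b ∧ s = t := by
  simp only [Net.data, List.cons_append, List.cons.injEq] at h
  obtain ⟨rfl, h⟩ := h
  exact ⟨rfl, layersData_inj code _ _ _ _ h⟩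

theorem vipData_injective {F : Set (ℝ → ℝ)} (code : F ↪ ℕ) :
    Function.Injective (VIPInst.data code) := by
  rintro ⟨n, m, N, A, B⟩ ⟨n', m', N', A', B'⟩ h
  obtain ⟨rfl, rfl, h1, h2⟩ := netData_inj code _ _ _ _ h
  obtain rfl := eq_of_heq h1
  obtain ⟨h3, h4⟩ := lp_decodable _ _ _ _ _ h2
  obtain ⟨h5, -⟩ := lp_decodable _ _ _ [] [] (by simpa using h4)
  subst h3 h5
  rfl

theorem crData_injective {F : Set (ℝ → ℝ)} (code : F ↪ ℕ) :
    Function.Injective (CRInst.data code) := by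
  rintro ⟨n, m, N, e, x, j⟩ ⟨n', m', N', e', x', j'⟩ h
  obtain ⟨rfl, rfl, h1, h2⟩ := netData_inj code _ _ _ _ h
  obtain rfl := eq_of_heq h1
  obtain ⟨h3, h4⟩ := boundData_decodable _ _ _ _ h2
  obtain ⟨h5, h6⟩ := point_decodable _ _ _ _ _ h4
  have h7 : j = j' := Fin.ext (by simpa using h6)
  subst h3 h5 h7
  rfl

theorem srData_injective {F : Set (ℝ → ℝ)} (code : F ↪ ℕ) :
    Function.Injective (SRInst.data code) := by
  rintro ⟨n, m, N, e, δ, x⟩ ⟨n', m', N', e', δ', x'⟩ h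
  obtain ⟨rfl, rfl, h1, h2⟩ := netData_inj code _ _ _ _ h
  obtain rfl := eq_of_heq h1
  obtain ⟨h3, h4⟩ := boundData_decodable _ _ _ _ h2
  obtain ⟨h5, h6⟩ := boundData_decodable _ _ _ _ h4
  obtain ⟨h7, -⟩ := point_decodable _ _ _ [] [] (by simpa using h6)
  subst h3 h5 h7
  rfl

/-! ## The decision problems -/

/-- Verification of interval property for networks with activations in `F`. -/
def VIP (F : Set (ℝ → ℝ)) (code : F ↪ ℕ) : Problem where
  Inst := VIPInst F
  Yes := VIPInst.Holds
  data := VIPInst.data code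
  data_injective := vipData_injective code

/-- Classification robustness with respect to `d` for networks with activations in `F`. -/
def CR (F : Set (ℝ → ℝ)) (code : F ↪ ℕ) (d : ∀ n : ℕ, MetricSpace (Fin n → ℝ)) : Problem where
  Inst := CRInst F
  Yes := CRInst.Holds d
  data := CRInst.data code
  data_injective := crData_injective code

/-- Standard robustness with respect to `d` for networks with activations in `F`. -/
def SR (F : Set (ℝ → ℝ)) (code : F ↪ ℕ) (d : ∀ n : ℕ, MetricSpace (Fin n → ℝ)) : Problem where
  Inst := SRInst F
  Yes := SRInst.Holds d
  data := SRInst.data code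
  data_injective := srData_injective code

/-- The maximum metric `d_∞` (Mathlib's metric on `Fin n → ℝ`). -/
abbrev dInf (n : ℕ) : MetricSpace (Fin n → ℝ) := inferInstance

/-- No point of `(ℝⁿ, d)`, `n ≥ 1`, is isolated: every closed ball of positive radius contains a
point other than its centre. -/
def NoIsolatedPoints (d : ∀ n : ℕ, MetricSpace (Fin n → ℝ)) : Prop :=
  ∀ n : ℕ, 0 < n → ∀ (x : Fin n → ℝ) (r : ℝ), 0 < r → ∃ y, y ≠ x ∧ (d n).dist y x ≤ r

/-- The activation function `ReLU(x) = max {0, x}`. -/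
noncomputable def ReLU (x : ℝ) : ℝ := max 0 x

end NNVerif

/-! All four reductions run two copies of a network side by side, one at the even and one at the odd
positions of each layer.

SR to VIP: the input layer is doubled as well. The input specification pins the odd inputs to the
centre and bounds the differences of neighbouring inputs by ε; the output specification bounds the
differences of neighbouring outputs by δ (`SRInst.toVIP_holds`). CR to VIP: the same input
specification, but both copies read the even inputs. Two copies of the outputs are convenient
because `y_i ≤ y_j` then involves two different variables even for `i = j` (`CRInst.toVIP_holds`).
SR to CR: a layer of identity nodes supplies `x` and the constants `x̄`, the doubled network
computes `N(x)` and `N(x̄)`, and a last layer outputs δ and the differences of corresponding outputs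
with both signs. The output δ is maximal if and only if all these differences are at most δ
(`SRInst.toCR_holds`).

CR to SR: with δ = 0 the question is whether a network is constant on the ball, whatever the metric
on the outputs. Let `w = ∑ |x_i - x̄_i|`, `y = N(x)`, and let the outputs be `ReLU(y_i - y_j)` and
`ReLU(y_i - y_j - w)`. If `j` is always maximal, all of them vanish. Conversely, suppose that they
are constant. At the centre `w = 0`, so the two outputs for `i` have the same value `v`. At another
point of the ball `w > 0`, and there `ReLU(t) = ReLU(t - w)` only if `t ≤ 0`; hence `v = 0`, and
`y_i ≤ y_j` on the whole ball (`Net.compare_const_iff`). The other point exists because no point is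
isolated, except if ε = 0 or `n = 0`. In these cases `N` is evaluated at the centre only, the radius
becomes 1, and for `n = 0` there is one dummy input (`CRInst.toSR_holds`). ReLU is the only
activation added: the inputs are passed on as `ReLU(x_i)` and `ReLU(-x_i)`, whose difference is
formed by the weights of the first layer of `N`; `w` is a sum of values of ReLU, and being
nonnegative it is carried unchanged through the layers by ReLU nodes.

Linear time: no arithmetic on the rational data is ever needed. The programs copy numbers, change
signs, append binary digits to indices, and count. All indices are bounded in terms of layer widths,
which are entries of the description, so the new numbers have a bounded number of additional digits.
Hence a number of stack operations linear in the number of entries is enough, each of them linear in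
the number of digits (`LinearTimeComputable.of_exec`). Structured programs `Cmd` are translated to
stack machines (`Cmd.Run.steps_eq`), `Op` acts on stacks of numbers, and `Exec` counts the
operations. Finally, the output of each program is identified with the description of the new
instance, after the layer widths have been removed from the types of networks (`Net.raw`). -/

namespace NNVerif

/-! ## A structured language for stack machines -/

/-- Programs on finitely many stacks `k : K` over the alphabet `Option Bool`. Tests look at the top
of a stack. -/
inductive Cmd (K : Type) : Type
  | push (k : K) (c : Option Bool)
  | pop (k : K)
  | mov (a b : K)
  | dup (a b c : K)
  | seq (p q : Cmd K)
  | ite (k : K) (t : Option (Option Bool) → Bool) (p q : Cmd K)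
  | loop (k : K) (t : Option (Option Bool) → Bool) (p : Cmd K)

namespace Cmd

variable {K : Type}

/-- The contents of the stacks. -/
abbrev Stacks (K : Type) := K → List (Option Bool)

/-- `p.Run S S' n`: the program `p` turns `S` into `S'` in `n` steps. -/
inductive Run [DecidableEq K] : Cmd K → Stacks K → Stacks K → ℕ → Prop
  | push (k : K) (c : Option Bool) (S : Stacks K) : Run (push k c) S (Function.update S k (c :: S k)) 1
  | pop (k : K) (S : Stacks K) (x l) : S k = x :: l → Run (pop k) S (Function.update S k l) 1
  | mov (a b : K) (S S' : Stacks K) (x l) : S a = x :: l → S' = Function.update S a l →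
      Run (mov a b) S (Function.update S' b (x :: S' b)) 1
  | dup (a b c : K) (S S' S'' : Stacks K) (x l) : S a = x :: l → S' = Function.update S a l →
      S'' = Function.update S' b (x :: S' b) →
      Run (dup a b c) S (Function.update S'' c (x :: S'' c)) 1
  | seq {p q S S' S'' m n} : Run p S S' m → Run q S' S'' n → Run (seq p q) S S'' (m + n)
  | ite_true {k t p q S S' n} : t (S k).head? = true → Run p S S' n →
      Run (ite k t p q) S S' (n + 1)
  | ite_false {k t p q S S' n} : t (S k).head? = false → Run q S S' n →
      Run (ite k t p q) S S' (n + 1)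
  | loop_done {k t p S} : t (S k).head? = false → Run (loop k t p) S S 1
  | loop_step {k t p S S' S'' m n} : t (S k).head? = true → Run p S S' m →
      Run (loop k t p) S' S'' n → Run (loop k t p) S S'' (m + n + 1)

/-- The control points of a program. -/
def Label : Cmd K → Type
  | push _ _ | pop _ | mov _ _ | dup _ _ _ => Unit
  | seq p q => p.Label ⊕ q.Label
  | ite _ _ p q => Option (p.Label ⊕ q.Label)
  | loop _ _ p => Option p.Label

instance instFintypeLabel : (p : Cmd K) → Fintype p.Label
  | push _ _ | pop _ | mov _ _ | dup _ _ _ => inferInstanceAs (Fintype Unit)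
  | seq p q =>
    letI := instFintypeLabel p
    letI := instFintypeLabel q
    inferInstanceAs (Fintype (p.Label ⊕ q.Label))
  | ite _ _ p q =>
    letI := instFintypeLabel p
    letI := instFintypeLabel q
    inferInstanceAs (Fintype (Option (p.Label ⊕ q.Label)))
  | loop _ _ p =>
    letI := instFintypeLabel p
    inferInstanceAs (Fintype (Option p.Label))

/-- The first control point. -/
def start : (p : Cmd K) → p.Label
  | push _ _ | pop _ | mov _ _ | dup _ _ _ => ()
  | seq p _ => Sum.inl p.start
  | ite _ _ _ _ | loop _ _ _ => none

/-- The statements of the machine. -/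
abbrev MStmt (K Λ : Type) :=
  Turing.TM2.Stmt (fun _ : K => Option Bool) Λ (Option (Option Bool))

/-- Leave a program: forget the last symbol read, and go to `next` or halt. -/
def exit {Λ : Type} (next : Option Λ) : MStmt K Λ :=
  .load (fun _ => none) (next.elim .halt fun l => .goto fun _ => l)

/-- The statement at a control point, in a machine whose labels contain those of the program by
means of `emb`, and which proceeds with `next`. -/
def compile {Λ : Type} : (p : Cmd K) → (p.Label → Λ) → Option Λ → p.Label → MStmt K Λ
  | push k c, _, next, _ => .push k (fun _ => c) (exit next)
  | pop k, _, next, _ => .pop k (fun _ _ => none) (exit next)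
  | mov a b, _, next, _ => .pop a (fun _ h => h) (.push b (fun v => v.getD none) (exit next))
  | dup a b c, _, next, _ =>
    .pop a (fun _ h => h) (.push b (fun v => v.getD none) (.push c (fun v => v.getD none)
      (exit next)))
  | seq p q, emb, _, .inl l => p.compile (fun l => emb (.inl l)) (some (emb (.inr q.start))) l
  | seq _ q, emb, next, .inr l => q.compile (fun l => emb (.inr l)) next l
  | ite k t p q, emb, _, none =>
    .peek k (fun _ h => h) (.branch t (exit (some (emb (some (.inl p.start)))))
      (exit (some (emb (some (.inr q.start))))))
  | ite _ _ p _, emb, next, some (.inl l) => p.compile (fun l => emb (some (.inl l))) next l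
  | ite _ _ _ q, emb, next, some (.inr l) => q.compile (fun l => emb (some (.inr l))) next l
  | loop k t p, emb, next, none =>
    .peek k (fun _ h => h) (.branch t (exit (some (emb (some p.start)))) (exit next))
  | loop _ _ p, emb, _, some l => p.compile (fun l => emb (some l)) (some (emb none)) l

variable [DecidableEq K]

theorem stepAux_exit {Λ : Type} (next : Option Λ) (v : Option (Option Bool)) (S : Stacks K) :
    Turing.TM2.stepAux (exit next) v S = ⟨next, none, S⟩ := by
  cases next <;> rfl

/-- `n` steps of a machine. -/
def steps {Λ : Type} (M : Λ → MStmt K Λ) (n : ℕ)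
    (c : Option (Turing.TM2.Cfg (fun _ : K => Option Bool) Λ (Option (Option Bool)))) :=
  (flip bind (Turing.TM2.step M))^[n] c

theorem steps_add {Λ : Type} (M : Λ → MStmt K Λ) (m n : ℕ)
    (c : Option (Turing.TM2.Cfg (fun _ : K => Option Bool) Λ (Option (Option Bool)))) :
    steps M (m + n) c = steps M n (steps M m c) := by
  rw [steps, steps, steps, ← Function.iterate_add_apply, Nat.add_comm]

theorem steps_one {Λ : Type} (M : Λ → MStmt K Λ) (l : Λ) (v : Option (Option Bool))
    (S : Stacks K) : steps M 1 (some ⟨some l, v, S⟩) = some (Turing.TM2.stepAux (M l) v S) := rfl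

/-- Induction on the run. The machine `M` is arbitrary except at the labels coming from `p`, so the
induction hypothesis applies to a subprogram inside the label set of a larger program. Every
statement ends with `exit`, which resets the internal state to `none`; hence the final configuration
of one part is the initial one of the next. -/
theorem Run.steps_eq {p : Cmd K} {S S' : Stacks K} {n : ℕ} (h : p.Run S S' n) :
    ∀ {Λ : Type} (M : Λ → MStmt K Λ) (emb : p.Label → Λ) (next : Option Λ),
      (∀ l, M (emb l) = p.compile emb next l) →
      steps M n (some ⟨some (emb p.start), none, S⟩) = some ⟨next, none, S'⟩ := by
  induction h with
  | push k c S =>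
    intro Λ M emb next hM
    rw [steps_one, hM]
    simp [compile, stepAux_exit]
  | pop k S x l h =>
    intro Λ M emb next hM
    rw [steps_one, hM]
    simp [compile, stepAux_exit, h]
  | mov a b S S' x l h h' =>
    intro Λ M emb next hM
    subst h'
    rw [steps_one, hM]
    simp [compile, stepAux_exit, h]
  | dup a b c S S' S'' x l h h' h'' =>
    intro Λ M emb next hM
    subst h'' h'
    rw [steps_one, hM]
    simp [compile, stepAux_exit, h]
  | @seq p q S S' S'' m n _ _ ih₁ ih₂ =>
    intro Λ M emb next hM
    rw [steps_add]
    erw [ih₁ M (fun l => emb (.inl l)) (some (emb (.inr q.start))) fun l => hM (.inl l)]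
    exact ih₂ M (fun l => emb (.inr l)) next fun l => hM (.inr l)
  | @ite_true k t p q S S' n ht _ ih =>
    intro Λ M emb next hM
    rw [Nat.add_comm, steps_add, steps_one, hM]
    simp only [compile, start, Turing.TM2.stepAux, ht, cond_true, stepAux_exit]
    exact ih M (fun l => emb (some (.inl l))) next fun l => hM (some (.inl l))
  | @ite_false k t p q S S' n ht _ ih =>
    intro Λ M emb next hM
    rw [Nat.add_comm, steps_add, steps_one, hM]
    simp only [compile, start, Turing.TM2.stepAux, ht, cond_false, stepAux_exit]
    exact ih M (fun l => emb (some (.inr l))) next fun l => hM (some (.inr l))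
  | loop_done ht =>
    intro Λ M emb next hM
    rw [steps_one, hM]
    simp only [compile, start, Turing.TM2.stepAux, ht, cond_false, stepAux_exit]
  | @loop_step k t p S S' S'' m n ht _ _ ih₁ ih₂ =>
    intro Λ M emb next hM
    rw [Nat.add_comm, steps_add, steps_one, hM]
    simp only [compile, start, Turing.TM2.stepAux, ht, cond_true, stepAux_exit]
    rw [steps_add]
    erw [ih₁ M (fun l => emb (some l)) (some (emb none)) fun l => hM (some l)]
    exact ih₂ M emb next hM

/-- The machine of a program, with input and output on the stack `k`. -/
def machine [Fintype K] (k : K) (p : Cmd K) :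
    Turing.TM2ComputableAux (Option Bool) (Option Bool) where
  tm :=
    { K := K
      k₀ := k
      k₁ := k
      Γ := fun _ => Option Bool
      Λ := p.Label
      main := p.start
      σ := Option (Option Bool)
      initialState := none
      m := p.compile id none }
  inputAlphabet := Equiv.refl _
  outputAlphabet := Equiv.refl _

/-- A machine has to halt with all stacks empty except for the output stack. This is why every
program below clears its auxiliary stacks. -/
theorem Run.outputs [Fintype K] {k : K} {p : Cmd K} {u v : List (Option Bool)} {n m : ℕ}
    (h : p.Run (Function.update (fun _ => []) k u) (Function.update (fun _ => []) k v) n)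
    (hn : n ≤ m) :
    Nonempty (Turing.TM2OutputsInTime (machine k p).tm
      (u.map (machine k p).inputAlphabet.symm)
      (some (v.map (machine k p).outputAlphabet.symm)) m) := by
  have key := h.steps_eq (Λ := p.Label) (p.compile id none) id none fun _ => rfl
  have e₁ : Turing.initList (machine k p).tm (u.map (machine k p).inputAlphabet.symm) =
      ⟨some p.start, none, Function.update (fun _ => []) k u⟩ := by
    simp only [Turing.initList, machine, Equiv.refl_symm]
    congr 1
    funext k'
    by_cases hk : k' = k
    · subst hk
      refine (dif_pos rfl).trans ?_
      exact (List.map_id u).trans (Function.update_self (β := fun _ => List (Option Bool)) k' u _).symm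
    · refine (dif_neg hk).trans ?_
      exact (Function.update_of_ne (β := fun _ => List (Option Bool)) hk u fun _ => []).symm
  have e₂ : Turing.haltList (machine k p).tm (v.map (machine k p).outputAlphabet.symm) =
      ⟨none, none, Function.update (fun _ => []) k v⟩ := by
    simp only [Turing.haltList, machine, Equiv.refl_symm]
    congr 1
    funext k'
    by_cases hk : k' = k
    · subst hk
      refine (dif_pos rfl).trans ?_
      exact (List.map_id v).trans (Function.update_self (β := fun _ => List (Option Bool)) k' v _).symm
    · refine (dif_neg hk).trans ?_
      exact (Function.update_of_ne (β := fun _ => List (Option Bool)) hk v fun _ => []).symm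
  refine ⟨⟨⟨n, ?_⟩, hn⟩⟩
  rw [e₁, Option.map_some, e₂]
  exact key

end Cmd

/-! ## Operations on stacks of numbers -/

namespace Cmd

variable {K : Type} [DecidableEq K]

theorem Run.cast {p : Cmd K} {S S' T : Stacks K} {n m : ℕ} (h : p.Run S S' n) (e : S' = T)
    (hn : n = m) : p.Run S T m := e ▸ hn ▸ h

/-- The test holds on all of `u` and fails on `r`, so exactly `u` is transferred, in reverse order.
Each symbol costs a test and a move; the last step is the failing test. -/
theorem Run.loop_mov {a b : K} (hab : a ≠ b) {t : Option (Option Bool) → Bool}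
    (u r : List (Option Bool)) (S : Stacks K) (hu : ∀ x ∈ u, t (some x) = true)
    (hr : t r.head? = false) (hS : S a = u ++ r) :
    Run (.loop a t (.mov a b)) S
      (Function.update (Function.update S a r) b (u.reverse ++ S b)) (2 * u.length + 1) := by
  induction u generalizing S with
  | nil =>
    have e : Function.update (Function.update S a r) b ([].reverse ++ S b) = S := by
      funext k
      by_cases h₁ : k = b <;> by_cases h₂ : k = a <;> simp_all [Function.update_apply]
    rw [e]
    exact .loop_done (by rw [hS]; exact hr)
  | cons x u ih =>
    have h₁ := Run.mov a b S _ x (u ++ r) hS rfl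
    have h₂ := ih (Function.update (Function.update S a (u ++ r)) b
        (x :: (Function.update S a (u ++ r)) b)) (fun y hy => hu y (List.mem_cons_of_mem _ hy))
      (by simp [hab])
    have h₃ := Run.loop_step (k := a) (t := t) (by rw [hS]; exact hu x (by simp)) h₁ h₂
    refine h₃.cast ?_ ?_
    · funext k
      by_cases h₁ : k = b <;> by_cases h₂ : k = a <;>
        simp_all [Ne.symm]
    · simp only [List.length_cons]; ring

theorem Run.loop_dup {a b c : K} (hab : a ≠ b) (hac : a ≠ c) (hbc : b ≠ c)
    {t : Option (Option Bool) → Bool} (u r : List (Option Bool)) (S : Stacks K)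
    (hu : ∀ x ∈ u, t (some x) = true) (hr : t r.head? = false) (hS : S a = u ++ r) :
    Run (.loop a t (.dup a b c)) S
      (Function.update (Function.update (Function.update S a r) b (u.reverse ++ S b)) c
        (u.reverse ++ S c)) (2 * u.length + 1) := by
  induction u generalizing S with
  | nil =>
    have e : Function.update (Function.update (Function.update S a r) b ([].reverse ++ S b)) c
        ([].reverse ++ S c) = S := by
      funext k
      by_cases h₁ : k = b <;> by_cases h₂ : k = a <;> by_cases h₃ : k = c <;>
        simp_all [Function.update_apply]
    rw [e]
    exact .loop_done (by rw [hS]; exact hr)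
  | cons x u ih =>
    have h₁ := Run.dup a b c S _ _ x (u ++ r) hS rfl rfl
    have h₂ := ih (Function.update (Function.update (Function.update S a (u ++ r)) b
      (x :: (Function.update S a (u ++ r)) b)) c (x :: (Function.update (Function.update S a
      (u ++ r)) b (x :: (Function.update S a (u ++ r)) b)) c)) (fun y hy => hu y (List.mem_cons_of_mem _ hy))
      (by simp [hab, hac])
    have h₃ := Run.loop_step (k := a) (t := t) (by rw [hS]; exact hu x (by simp)) h₁ h₂
    refine h₃.cast ?_ ?_
    · funext k
      by_cases h₁ : k = b <;> by_cases h₂ : k = a <;> by_cases h₃ : k = c <;>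
        simp_all [Ne.symm]
    · simp only [List.length_cons]; ring

theorem Run.loop_pop {a : K} {t : Option (Option Bool) → Bool} (u r : List (Option Bool))
    (S : Stacks K) (hu : ∀ x ∈ u, t (some x) = true) (hr : t r.head? = false)
    (hS : S a = u ++ r) :
    Run (.loop a t (.pop a)) S (Function.update S a r) (2 * u.length + 1) := by
  induction u generalizing S with
  | nil =>
    have e : Function.update S a r = S := by
      rw [Function.update_eq_self_iff, hS]; rfl
    rw [e]
    exact .loop_done (by rw [hS]; exact hr)
  | cons x u ih =>
    have h₁ := Run.pop a S x (u ++ r) hS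
    have h₂ := ih (Function.update S a (u ++ r)) (fun y hy => hu y (List.mem_cons_of_mem _ hy)) (by simp)
    have h₃ := Run.loop_step (k := a) (t := t) (by rw [hS]; exact hu x (by simp)) h₁ h₂
    refine h₃.cast ?_ ?_
    · simp
    · simp only [List.length_cons]; ring

/-- A constant block equals its reversal, so no order has to be restored. A symbol costs a test, a
pop and a push. -/
theorem Run.loop_flip {a b : K} (hab : a ≠ b) {t : Option (Option Bool) → Bool}
    (c c' : Option Bool) (n : ℕ) (r : List (Option Bool)) (S : Stacks K)
    (hc : t (some c) = true) (hr : t r.head? = false) (hS : S a = List.replicate n c ++ r) :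
    Run (.loop a t (.seq (.pop a) (.push b c'))) S
      (Function.update (Function.update S a r) b (List.replicate n c' ++ S b)) (3 * n + 1) := by
  induction n generalizing S with
  | zero =>
    have e : Function.update (Function.update S a r) b (List.replicate 0 c' ++ S b) = S := by
      funext k
      by_cases h₁ : k = b <;> by_cases h₂ : k = a <;> simp_all [Function.update_apply]
    rw [e]
    exact .loop_done (by rw [hS]; exact hr)
  | succ n ih =>
    have h₁ := Run.pop a S c (List.replicate n c ++ r) hS
    have h₂ := h₁.seq (Run.push b c' _)
    have h₃ := ih (Function.update (Function.update S a (List.replicate n c ++ r)) b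
      (c' :: (Function.update S a (List.replicate n c ++ r)) b)) (by simp [hab])
    have h₄ := Run.loop_step (k := a) (t := t) (by rw [hS]; exact hc) h₂ h₃
    refine h₄.cast ?_ ?_
    · funext k
      by_cases h₁ : k = b <;> by_cases h₂ : k = a <;>
        simp_all [Ne.symm, List.replicate_succ']
    · ring

end Cmd

/-- The word of one number. -/
def encodeNat (n : ℕ) : List (Option Bool) := n.bits.map some ++ [none]

theorem encode_cons (n : ℕ) (l : List ℕ) : encode (n :: l) = encodeNat n ++ encode l := rfl

theorem bits_two_mul_add_one (n : ℕ) : (2 * n + 1).bits = true :: n.bits := Nat.bit1_bits n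

theorem bits_two_mul (n : ℕ) (hn : n ≠ 0) : (2 * n).bits = false :: n.bits := Nat.bit0_bits n hn

/-- Propagation of the carry: the initial ones become zeros, and the next digit, which is zero or
missing, becomes one. Only in the second case does the word get longer. -/
theorem bits_succ (n : ℕ) :
    (∃ j w, n.bits = List.replicate j true ++ false :: w ∧
      (n + 1).bits = List.replicate j false ++ true :: w) ∨
    ∃ j, n.bits = List.replicate j true ∧ (n + 1).bits = List.replicate j false ++ [true] := by
  induction n using Nat.strong_induction_on with
  | _ n ih =>
  rcases Nat.even_or_odd' n with ⟨m, rfl | rfl⟩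
  · rcases Nat.eq_zero_or_pos m with rfl | hm
    · exact .inr ⟨0, by simp, by simp⟩
    · exact .inl ⟨0, m.bits, by simp [bits_two_mul m hm.ne'], by simp [bits_two_mul_add_one]⟩
  · have e : 2 * m + 1 + 1 = 2 * (m + 1) := by ring
    rw [e, bits_two_mul_add_one, bits_two_mul _ (by omega)]
    rcases ih m (by omega) with ⟨j, w, h₁, h₂⟩ | ⟨j, h₁, h₂⟩
    · exact .inl ⟨j + 1, w, by simp [h₁, List.replicate_succ], by simp [h₂, List.replicate_succ]⟩
    · exact .inr ⟨j + 1, by simp [h₁, List.replicate_succ], by simp [h₂, List.replicate_succ]⟩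

theorem length_bits_le {n B : ℕ} (h : n < 2 ^ B) : n.bits.length ≤ B := by
  rw [Nat.size_eq_bits_len]; exact Nat.size_le.2 h

/-- The stacks of numbers as stacks of symbols, with an empty auxiliary stack. -/
def encodeStacks {J : Type} (s : J → List ℕ) : Option J → List (Option Bool)
  | none => []
  | some j => encode (s j)

/-- Operations on the tops of stacks of numbers. -/
inductive Op (J : Type) : Type
  | push (k : J) (c : ℕ)
  | copy (a b : J)
  | drop (a : J)
  | bit (b : Bool) (a : J)
  | succ (a : J)

namespace Op

variable {J : Type}

/-- Is the symbol a digit? -/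
def isBit : Option (Option Bool) → Bool
  | some (some _) => true
  | _ => false

/-- Is the symbol the digit one? -/
def isOne : Option (Option Bool) → Bool
  | some (some b) => b
  | _ => false

/-- Push a number given by its digits. -/
def pushBits (k : Option J) : List Bool → Cmd (Option J)
  | [] => .push k none
  | b :: u => .seq (pushBits k u) (.push k (some b))

/-- The implementation of the operations. -/
def code : Op J → Cmd (Option J)
  | push k c => pushBits (some k) c.bits
  | copy a b =>
    .seq (.loop (some a) isBit (.mov (some a) none))
      (.seq (.push (some b) none) (.loop none Option.isSome (.dup none (some a) (some b))))
  | drop a => .seq (.loop (some a) isBit (.pop (some a))) (.pop (some a))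
  | bit true a => .push (some a) (some true)
  | bit false a =>
    .ite (some a) isBit (.push (some a) (some false)) (.seq (.push (some a) none) (.pop (some a)))
  | succ a =>
    .seq (.loop (some a) isOne (.seq (.pop (some a)) (.push none (some false))))
      (.seq (.ite (some a) isBit (.seq (.pop (some a)) (.push (some a) (some true)))
          (.push (some a) (some true)))
        (.loop none Option.isSome (.mov none (some a))))

variable [DecidableEq J]

open Function (update)

theorem encodeStacks_update (s : J → List ℕ) (k : J) (l : List ℕ) :
    encodeStacks (update s k l) = update (encodeStacks s) (some k) (encode l) := by
  funext j
  cases j with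
  | none => simp [encodeStacks]
  | some j =>
    by_cases h : j = k
    · subst h; simp [encodeStacks]
    · simp [encodeStacks, h]

theorem run_pushBits (k : Option J) (u : List Bool) (S : Cmd.Stacks (Option J)) :
    (pushBits k u).Run S (update S k ((u.map some ++ [none]) ++ S k)) (u.length + 1) := by
  induction u with
  | nil => exact Cmd.Run.push k none S
  | cons b u ih =>
    have h := ih.seq (Cmd.Run.push k (some b) _)
    exact h.cast (by simp) rfl

theorem run_push (s : J → List ℕ) (k : J) (c : ℕ) :
    (push k c).code.Run (encodeStacks s) (encodeStacks (update s k (c :: s k)))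
      (c.bits.length + 1) := by
  rw [encodeStacks_update]
  exact run_pushBits (some k) c.bits (encodeStacks s)

/-- The digits pass in reverse order to the auxiliary stack and from there to both stacks at once,
which restores the order. The separator on `a` never moves, and the one on `b` is pushed before the
digits come back. -/
theorem run_copy (s : J → List ℕ) (a b : J) (hab : a ≠ b) (n : ℕ) (l : List ℕ)
    (h : s a = n :: l) :
    (copy a b).code.Run (encodeStacks s) (encodeStacks (update s b (n :: s b)))
      (4 * n.bits.length + 3) := by
  have h₀ : encodeStacks s (some a) = n.bits.map some ++ none :: encode l := by
    simp [encodeStacks, h, encode_cons, encodeNat]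
  have h₁ := Cmd.Run.loop_mov (a := some a) (b := none) (by simp) (t := isBit) (n.bits.map some)
    (none :: encode l) _ (fun x hx => by obtain ⟨b, -, rfl⟩ := List.mem_map.1 hx; rfl) rfl h₀
  have h₂ := Cmd.Run.push (some b) none (update (update (encodeStacks s) (some a)
    (none :: encode l)) none ((n.bits.map some).reverse ++ encodeStacks s none))
  have h₃ := Cmd.Run.loop_dup (a := none) (b := some a) (c := some b) (by simp) (by simp)
    (by simpa using hab) (t := Option.isSome) ((n.bits.map some).reverse) []
    (update (update (update (encodeStacks s) (some a) (none :: encode l)) none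
      ((n.bits.map some).reverse ++ encodeStacks s none)) (some b)
      (none :: update (update (encodeStacks s) (some a) (none :: encode l)) none
        ((n.bits.map some).reverse ++ encodeStacks s none) (some b)))
    (by simp) rfl (by simp [encodeStacks])
  have h₄ := h₁.seq (h₂.seq h₃)
  refine h₄.cast ?_ ?_
  · funext j
    rw [encodeStacks_update]
    cases j with
    | none => simp [encodeStacks]
    | some j =>
      by_cases hb : j = b <;> by_cases ha : j = a <;>
        simp_all [Function.update_apply, encodeStacks, encode_cons, encodeNat]
  · simp only [List.length_map, List.length_reverse]; ring

theorem run_drop (s : J → List ℕ) (a : J) (n : ℕ) (l : List ℕ) (h : s a = n :: l) :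
    (drop a).code.Run (encodeStacks s) (encodeStacks (update s a l))
      (2 * n.bits.length + 2) := by
  have h₀ : encodeStacks s (some a) = n.bits.map some ++ none :: encode l := by
    simp [encodeStacks, h, encode_cons, encodeNat]
  have h₁ := Cmd.Run.loop_pop (a := some a) (t := isBit) (n.bits.map some)
    (none :: encode l) _ (fun x hx => by obtain ⟨b, -, rfl⟩ := List.mem_map.1 hx; rfl) rfl h₀
  have h₂ := Cmd.Run.pop (some a) (update (encodeStacks s) (some a) (none :: encode l))
    none (encode l) (by simp)
  have h₃ := h₁.seq h₂
  refine h₃.cast ?_ ?_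
  · rw [encodeStacks_update]; simp
  · simp only [List.length_map]

/-- The least significant digit is on top, so a new last digit is a single push. Zero is the word
without digits; a digit 0 on top of it would not be the word of a number, whence the test. -/
theorem run_bit (s : J → List ℕ) (b : Bool) (a : J) (n : ℕ) (l : List ℕ) (h : s a = n :: l) :
    ∃ m ≤ 3, (bit b a).code.Run (encodeStacks s)
      (encodeStacks (update s a ((2 * n + b.toNat) :: l))) m := by
  have h₀ : encodeStacks s (some a) = n.bits.map some ++ none :: encode l := by
    simp [encodeStacks, h, encode_cons, encodeNat]
  cases b with
  | true =>
    refine ⟨1, by simp, ?_⟩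
    refine (Cmd.Run.push (some a) (some true) (encodeStacks s)).cast ?_ rfl
    rw [encodeStacks_update, h₀]
    simp [encode_cons, encodeNat, bits_two_mul_add_one]
  | false =>
    rcases Nat.eq_zero_or_pos n with rfl | hn
    · refine ⟨3, le_rfl, ?_⟩
      -- A push followed by a pop: the word of zero must stay as it is.
      have h₁ := (Cmd.Run.push (some a) none (encodeStacks s)).seq
        (Cmd.Run.pop (some a) _ none (encodeStacks s (some a)) (by simp))
      have h₂ := Cmd.Run.ite_false (k := some a) (t := isBit)
        (p := .push (some a) (some false)) (by rw [h₀]; rfl) h₁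
      refine h₂.cast ?_ rfl
      rw [encodeStacks_update, h₀]
      simp [encode_cons, encodeNat]
    · refine ⟨2, by simp, ?_⟩
      have h₂ := Cmd.Run.ite_true (k := some a) (t := isBit)
        (q := .seq (.push (some a) none) (.pop (some a))) (by
          rw [h₀]
          cases hb : n.bits with
          | nil =>
            have := Nat.size_eq_bits_len n
            rw [hb, List.length_nil, eq_comm, Nat.size_eq_zero] at this
            omega
          | cons b u => simp [isBit]) (Cmd.Run.push (some a) (some false) (encodeStacks s))
      refine h₂.cast ?_ rfl
      rw [encodeStacks_update, h₀]
      simp [encode_cons, encodeNat, bits_two_mul n hn.ne']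

theorem run_succ (s : J → List ℕ) (a : J) (n : ℕ) (l : List ℕ) (h : s a = n :: l) :
    ∃ m ≤ 5 * n.bits.length + 5, (succ a).code.Run (encodeStacks s)
      (encodeStacks (update s a ((n + 1) :: l))) m := by
  have h₀ : encodeStacks s (some a) = n.bits.map some ++ none :: encode l := by
    simp [encodeStacks, h, encode_cons, encodeNat]
  -- Common frame of the two forms of the word: `j` ones are flipped onto the auxiliary stack, the
  -- middle test turns the rest `r` into `r'` in `m` steps, and the zeros return.
  have main : ∀ (j : ℕ) (r r' : List (Option Bool)) (m : ℕ),
      encodeStacks s (some a) = List.replicate j (some true) ++ r → isOne r.head? = false →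
      encode ((n + 1) :: l) = List.replicate j (some false) ++ r' →
      (∀ S : Cmd.Stacks (Option J), S (some a) = r →
        (Cmd.ite (some a) isBit (.seq (.pop (some a)) (.push (some a) (some true)))
          (.push (some a) (some true))).Run S (update S (some a) r') m) →
      (succ a).code.Run (encodeStacks s) (encodeStacks (update s a ((n + 1) :: l)))
        (5 * j + m + 2) := by
    intro j r r' m h₁ h₂ h₃ h₄
    have a₁ := Cmd.Run.loop_flip (a := some a) (b := none) (by simp) (t := isOne) (some true)
      (some false) j r _ rfl h₂ h₁
    have a₂ := h₄ (update (update (encodeStacks s) (some a) r) none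
      (List.replicate j (some false) ++ encodeStacks s none)) (by simp)
    have a₃ := Cmd.Run.loop_mov (a := none) (b := some a) (by simp) (t := Option.isSome)
      (List.replicate j (some false)) [] (update (update (update (encodeStacks s) (some a) r) none
      (List.replicate j (some false) ++ encodeStacks s none)) (some a) r')
      (by simp) rfl (by simp [encodeStacks])
    have a₄ := a₁.seq (a₂.seq a₃)
    refine a₄.cast ?_ ?_
    · rw [encodeStacks_update, h₃]
      funext i
      cases i with
      | none => simp [encodeStacks]
      | some i =>
        by_cases hi : i = a <;> simp_all [Function.update_apply, encodeStacks]
    · simp only [List.length_replicate]; ring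
  rcases bits_succ n with ⟨j, w, h₁, h₂⟩ | ⟨j, h₁, h₂⟩
  · refine ⟨5 * j + 3 + 2, by simp [h₁], main j (some false :: (w.map some ++ none :: encode l))
      (some true :: (w.map some ++ none :: encode l)) 3 (by rw [h₀, h₁]; simp) rfl
      (by rw [encode_cons, encodeNat, h₂]; simp) fun S hS => ?_⟩
    have h₃ := (Cmd.Run.pop (some a) S (some false) _ hS).seq (Cmd.Run.push (some a) (some true) _)
    have h₄ := Cmd.Run.ite_true (k := some a) (t := isBit) (q := .push (some a) (some true))
      (by rw [hS]; rfl) h₃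
    refine h₄.cast ?_ rfl
    simp
  · refine ⟨5 * j + 2 + 2, by simp [h₁], main j (none :: encode l)
      (some true :: none :: encode l) 2 (by rw [h₀, h₁]; simp) rfl
      (by rw [encode_cons, encodeNat, h₂]; simp) fun S hS => ?_⟩
    have h₄ := Cmd.Run.ite_false (k := some a) (t := isBit)
      (p := .seq (.pop (some a)) (.push (some a) (some true)))
      (by rw [hS]; rfl) (Cmd.Run.push (some a) (some true) S)
    refine h₄.cast ?_ rfl
    rw [hS]

end Op

/-- The names of the stacks of numbers. -/
inductive Stk : Type
  | inp | out | buf | una | cnt | wid | et | en | ed | dt | dn | dd | rs | rn | rd | pre | flag | fst | con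
  deriving DecidableEq

instance : Fintype Stk :=
  .ofList [.inp, .out, .buf, .una, .cnt, .wid, .et, .en, .ed, .dt, .dn, .dd, .rs,
    .rn, .rd, .pre, .flag, .fst, .con] (by rintro ⟨⟩ <;> simp)

/-- The contents of the stacks of numbers. -/
structure St where
  inp : List ℕ := []
  out : List ℕ := []
  buf : List ℕ := []
  una : List ℕ := []
  cnt : List ℕ := []
  wid : List ℕ := []
  et : List ℕ := []
  en : List ℕ := []
  ed : List ℕ := []
  dt : List ℕ := []
  dn : List ℕ := []
  dd : List ℕ := []
  rs : List ℕ := []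
  rn : List ℕ := []
  rd : List ℕ := []
  pre : List ℕ := []
  flag : List ℕ := []
  fst : List ℕ := []
  con : List ℕ := []

namespace St

/-- The stack with a given name. -/
def get (s : St) : Stk → List ℕ
  | .inp => s.inp
  | .out => s.out
  | .buf => s.buf
  | .una => s.una
  | .cnt => s.cnt
  | .wid => s.wid
  | .et => s.et
  | .en => s.en
  | .ed => s.ed
  | .dt => s.dt
  | .dn => s.dn
  | .dd => s.dd
  | .rs => s.rs
  | .rn => s.rn
  | .rd => s.rd
  | .pre => s.pre
  | .flag => s.flag
  | .fst => s.fst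
  | .con => s.con

/-- Replace the stack with a given name. -/
def set (s : St) : Stk → List ℕ → St
  | .inp, l => { s with inp := l }
  | .out, l => { s with out := l }
  | .buf, l => { s with buf := l }
  | .una, l => { s with una := l }
  | .cnt, l => { s with cnt := l }
  | .wid, l => { s with wid := l }
  | .et, l => { s with et := l }
  | .en, l => { s with en := l }
  | .ed, l => { s with ed := l }
  | .dt, l => { s with dt := l }
  | .dn, l => { s with dn := l }
  | .dd, l => { s with dd := l }
  | .rs, l => { s with rs := l }
  | .rn, l => { s with rn := l }
  | .rd, l => { s with rd := l }
  | .pre, l => { s with pre := l }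
  | .flag, l => { s with flag := l }
  | .fst, l => { s with fst := l }
  | .con, l => { s with con := l }

theorem get_set (s : St) (k : Stk) (l : List ℕ) :
    (s.set k l).get = Function.update s.get k l := by
  funext j
  cases k <;> cases j <;> rfl

theorem set_get (s : St) (k : Stk) : s.set k (s.get k) = s := by cases k <;> rfl

theorem set_set (s : St) (k : Stk) (l l' : List ℕ) : (s.set k l).set k l' = s.set k l' := by
  cases k <;> rfl

theorem set_comm (s : St) {j k : Stk} (h : j ≠ k) (l l' : List ℕ) :
    (s.set j l).set k l' = (s.set k l').set j l := by
  cases j <;> cases k <;> first | rfl | exact absurd rfl h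

theorem get_set_self (s : St) (k : Stk) (l : List ℕ) : (s.set k l).get k = l := by
  rw [get_set, Function.update_self]

theorem get_set_of_ne (s : St) {j k : Stk} (h : j ≠ k) (l : List ℕ) :
    (s.set k l).get j = s.get j := by
  rw [get_set, Function.update_of_ne h]

/-- All numbers have at most `B` binary digits. -/
def Bdd (B : ℕ) (s : St) : Prop := ∀ k, ∀ x ∈ s.get k, x < 2 ^ B

theorem Bdd.set {B : ℕ} {s : St} (h : s.Bdd B) {k : Stk} {l : List ℕ} (hl : ∀ x ∈ l, x < 2 ^ B) :
    (s.set k l).Bdd B := by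
  intro j x hx
  by_cases hj : j = k
  · subst hj; rw [get_set_self] at hx; exact hl x hx
  · rw [get_set_of_ne _ hj] at hx; exact h j x hx

end St

/-! ### Operations on the named stacks, and programs with a count of operations -/

namespace Op

/-- The effect of an operation. -/
def run : Op Stk → St → St
  | push k c, s => s.set k (c :: s.get k)
  | copy a b, s => s.set b ((s.get a).headI :: s.get b)
  | drop a, s => s.set a (s.get a).tail
  | bit b a, s => s.set a ((2 * (s.get a).headI + b.toNat) :: (s.get a).tail)
  | succ a, s => s.set a (((s.get a).headI + 1) :: (s.get a).tail)

/-- An operation is admissible if it has its operands and its result has at most `B` digits. -/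
def Ok (B : ℕ) : Op Stk → St → Prop
  | push _ c, _ => c < 2 ^ B
  | copy a b, s => a ≠ b ∧ s.get a ≠ []
  | drop a, s => s.get a ≠ []
  | bit b a, s => s.get a ≠ [] ∧ 2 * (s.get a).headI + b.toNat < 2 ^ B
  | succ a, s => s.get a ≠ [] ∧ (s.get a).headI + 1 < 2 ^ B

end Op

/-- `p` turns `s` into `s'` within `t` elementary operations, if all numbers in `s` have at most
`B` binary digits; then so do the numbers in `s'`. -/
def Exec (B : ℕ) (p : Cmd (Option Stk)) (s s' : St) (t : ℕ) : Prop :=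
  s.Bdd B → s'.Bdd B ∧ (∀ k, (s'.get k).length ≤ (s.get k).length + t) ∧
    ∃ n ≤ t * (10 * (B + 1)), p.Run (encodeStacks s.get) (encodeStacks s'.get) n

namespace Exec

variable {B t t' : ℕ} {p p' : Cmd (Option Stk)} {s s' s'' : St}

theorem mono (h : Exec B p s s' t) (ht : t ≤ t') : Exec B p s s' t' := by
  intro hs
  obtain ⟨h₁, h₂, n, h₃, h₄⟩ := h hs
  exact ⟨h₁, fun k => (h₂ k).trans (by omega), n, h₃.trans (Nat.mul_le_mul_right _ ht), h₄⟩

theorem seq (h : Exec B p s s' t) (h' : Exec B p' s' s'' t') :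
    Exec B (.seq p p') s s'' (t + t') := by
  intro hs
  obtain ⟨h₁, h₂, n, h₃, h₄⟩ := h hs
  obtain ⟨h₁', h₂', n', h₃', h₄'⟩ := h' h₁
  refine ⟨h₁', fun k => ?_, n + n', ?_, h₄.seq h₄'⟩
  · have := h₂ k
    have := h₂' k
    omega
  · rw [Nat.add_mul]; omega

/-- The most expensive operation is `succ`, with at most 5 steps per digit and 5 more; `10 * (B +
1)` leaves room for all of them. -/
theorem op (o : Op Stk) (h : o.Ok B s) : Exec B o.code s (o.run s) 1 := by
  intro hs
  have hd : ∀ {k n l}, s.get k = n :: l → n.bits.length ≤ B := fun {k n l} hk =>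
    length_bits_le (hs k n (by rw [hk]; exact List.mem_cons_self))
  have hlen : ∀ k l, l.length ≤ (s.get k).length + 1 →
      ∀ j, ((s.set k l).get j).length ≤ (s.get j).length + 1 := by
    intro k l hl j
    by_cases hj : j = k
    · subst hj; rwa [St.get_set_self]
    · rw [St.get_set_of_ne _ hj]; omega
  cases o with
  | push k c =>
    refine ⟨hs.set ?_, hlen _ _ (by simp), c.bits.length + 1, ?_, ?_⟩
    rotate_left 2
    · rw [Op.run, St.get_set]; exact Op.run_push s.get k c
    · rintro x (_ | ⟨_, hx⟩)
      · exact h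
      · exact hs k x hx
    · have := length_bits_le (n := c) h
      omega
  | copy a b =>
    obtain ⟨hab, ha⟩ := h
    obtain ⟨n, l, hl⟩ := List.exists_cons_of_ne_nil ha
    refine ⟨hs.set ?_, hlen _ _ (by simp), 4 * n.bits.length + 3, ?_, ?_⟩
    rotate_left 2
    · rw [Op.run, St.get_set, hl]; exact Op.run_copy s.get a b hab n l hl
    · rintro x (_ | ⟨_, hx⟩)
      · exact hs a _ (by simp [hl])
      · exact hs b x hx
    · have := hd hl
      omega
  | drop a =>
    obtain ⟨n, l, hl⟩ := List.exists_cons_of_ne_nil h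
    refine ⟨hs.set ?_, hlen _ _ (by simp; omega), 2 * n.bits.length + 2, ?_, ?_⟩
    rotate_left 2
    · rw [Op.run, St.get_set, hl]; exact Op.run_drop s.get a n l hl
    · exact fun x hx => hs a x (List.mem_of_mem_tail hx)
    · have := hd hl
      omega
  | bit b a =>
    obtain ⟨ha, hb⟩ := h
    obtain ⟨n, l, hl⟩ := List.exists_cons_of_ne_nil ha
    obtain ⟨m, hm, hrun⟩ := Op.run_bit s.get b a n l hl
    refine ⟨hs.set ?_, hlen _ _ (by simp [hl]), m, by omega, ?_⟩
    · rintro x (_ | ⟨_, hx⟩)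
      · exact hb
      · exact hs a x (List.mem_of_mem_tail hx)
    · rw [Op.run, St.get_set, hl]; exact hrun
  | succ a =>
    obtain ⟨ha, hb⟩ := h
    obtain ⟨n, l, hl⟩ := List.exists_cons_of_ne_nil ha
    obtain ⟨m, hm, hrun⟩ := Op.run_succ s.get a n l hl
    refine ⟨hs.set ?_, hlen _ _ (by simp [hl]), m, ?_, ?_⟩
    · rintro x (_ | ⟨_, hx⟩)
      · exact hb
      · exact hs a x (List.mem_of_mem_tail hx)
    · have := hd hl
      omega
    · rw [Op.run, St.get_set, hl]; exact hrun

end Exec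

/-- Do nothing. -/
def skip : Cmd (Option Stk) := .seq (.push none none) (.pop none)

/-- A sequence of operations. -/
def block : List (Op Stk) → Cmd (Option Stk)
  | [] => skip
  | o :: l => .seq o.code (block l)

/-- The effect of a sequence of operations. -/
def runOps : List (Op Stk) → St → St
  | [], s => s
  | o :: l, s => runOps l (o.run s)

/-- Admissibility of a sequence of operations. -/
def OkOps (B : ℕ) : List (Op Stk) → St → Prop
  | [], _ => True
  | o :: l, s => o.Ok B s ∧ OkOps B l (o.run s)

/-- Branch according to whether the top of a stack is zero. -/
def ifz (a : Stk) (p q : Cmd (Option Stk)) : Cmd (Option Stk) :=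
  .ite (some a) (fun h => h == some none) p q

/-- Repeat while the top of a stack is not zero. -/
def whilenz (a : Stk) (p : Cmd (Option Stk)) : Cmd (Option Stk) :=
  .loop (some a) (fun h => h != some none) p

/-- Repeat while a stack is not empty. -/
def whilene (a : Stk) (p : Cmd (Option Stk)) : Cmd (Option Stk) :=
  .loop (some a) Option.isSome p

theorem head_encode_zero (l : List ℕ) : (encode (0 :: l)).head? = some none := by
  simp [encode_cons, encodeNat]

theorem head_encode_ne (n : ℕ) (l : List ℕ) (hn : n ≠ 0) :
    ∃ b, (encode (n :: l)).head? = some (some b) := by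
  cases h : n.bits with
  | nil =>
    have := Nat.size_eq_bits_len n
    rw [h, List.length_nil, eq_comm, Nat.size_eq_zero] at this
    exact absurd this hn
  | cons b u => exact ⟨b, by simp [encode_cons, encodeNat, h]⟩

namespace Exec

variable {B t t' : ℕ} {p p' : Cmd (Option Stk)} {s s' s'' : St}

theorem skip : Exec B skip s s 1 := by
  intro hs
  refine ⟨hs, fun _ => Nat.le_succ _, 2, by omega, ?_⟩
  have h := (Cmd.Run.push none none (encodeStacks s.get)).seq
    (Cmd.Run.pop none _ none (encodeStacks s.get none) (by simp))
  exact h.cast (by simp) rfl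

theorem block (l : List (Op Stk)) (h : OkOps B l s) :
    Exec B (block l) s (runOps l s) (l.length + 1) := by
  induction l generalizing s with
  | nil => exact skip
  | cons o l ih => exact ((op o h.1).seq (ih h.2)).mono (by simp; omega)

theorem block_eq (l : List (Op Stk)) (h : OkOps B l s) (e : runOps l s = s') :
    Exec B (NNVerif.block l) s s' (l.length + 1) := e ▸ block l h

/-- A test is a single machine step, charged as a whole operation. -/
theorem branch_bound {n : ℕ} (hn : n ≤ t * (10 * (B + 1))) :
    n + 1 ≤ (t + 1) * (10 * (B + 1)) := by
  rw [Nat.add_mul]; omega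

theorem ifz_zero {a : Stk} {l : List ℕ} (ha : s.get a = 0 :: l) (h : Exec B p s s' t) :
    Exec B (ifz a p p') s s' (t + 1) := by
  intro hs
  obtain ⟨h₁, h₂, n, h₃, h₄⟩ := h hs
  refine ⟨h₁, fun k => (h₂ k).trans (by omega), n + 1, branch_bound h₃, .ite_true ?_ h₄⟩
  simp [encodeStacks, ha, head_encode_zero]

theorem ifz_ne {a : Stk} {n : ℕ} {l : List ℕ} (ha : s.get a = n :: l) (hn : n ≠ 0)
    (h : Exec B p' s s' t) : Exec B (ifz a p p') s s' (t + 1) := by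
  intro hs
  obtain ⟨h₁, h₂, n, h₃, h₄⟩ := h hs
  refine ⟨h₁, fun k => (h₂ k).trans (by omega), n + 1, branch_bound h₃, .ite_false ?_ h₄⟩
  obtain ⟨b, hb⟩ := head_encode_ne _ l hn
  simp [encodeStacks, ha, hb]

theorem loop_step {a : Stk} {f : Option (Option Bool) → Bool}
    (ha : f (encode (s.get a)).head? = true) (h : Exec B p s s' t)
    (h' : Exec B (.loop (some a) f p) s' s'' t') :
    Exec B (.loop (some a) f p) s s'' (t + t' + 1) := by
  intro hs
  obtain ⟨h₁, h₂, n, h₃, h₄⟩ := h hs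
  obtain ⟨h₁', h₂', n', h₃', h₄'⟩ := h' h₁
  refine ⟨h₁', fun k => ?_, n + n' + 1, branch_bound ?_, .loop_step ha h₄ h₄'⟩
  · have := h₂ k
    have := h₂' k
    omega
  · rw [Nat.add_mul]; omega

theorem loop_done {a : Stk} {f : Option (Option Bool) → Bool}
    (ha : f (encode (s.get a)).head? = false) : Exec B (.loop (some a) f p) s s 1 :=
  fun hs => ⟨hs, fun _ => Nat.le_succ _, 1, by omega, .loop_done ha⟩

theorem whilenz_done {a : Stk} {l : List ℕ} (ha : s.get a = 0 :: l) :
    Exec B (whilenz a p) s s 1 :=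
  loop_done (by rw [ha, head_encode_zero]; rfl)

theorem whilenz_step {a : Stk} {n : ℕ} {l : List ℕ} (ha : s.get a = n :: l) (hn : n ≠ 0)
    (h : Exec B p s s' t) (h' : Exec B (whilenz a p) s' s'' t') :
    Exec B (whilenz a p) s s'' (t + t' + 1) := by
  obtain ⟨b, hb⟩ := head_encode_ne n l hn
  exact loop_step (by rw [ha, hb]; rfl) h h'

theorem whilene_done {a : Stk} (ha : s.get a = []) : Exec B (whilene a p) s s 1 :=
  loop_done (by rw [ha]; rfl)

theorem whilene_step {a : Stk} {n : ℕ} {l : List ℕ} (ha : s.get a = n :: l)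
    (h : Exec B p s s' t) (h' : Exec B (whilene a p) s' s'' t') :
    Exec B (whilene a p) s s'' (t + t' + 1) :=
  loop_step (by rw [ha, encode_cons, encodeNat]; cases n.bits <;> rfl) h h'

end Exec

/-- Move one number. -/
abbrev mv (a b : Stk) : List (Op Stk) := [.copy a b, .drop a]

/-- Move all numbers of a stack to another one. -/
def flush (a b : Stk) : Cmd (Option Stk) := whilene a (block (mv a b))

/-- Empty a stack. -/
def clear (a : Stk) : Cmd (Option Stk) := whilene a (block [.drop a])

theorem exec_clear {B : ℕ} (s : St) (a : Stk) :
    Exec B (clear a) s (s.set a []) (4 * (s.get a).length + 1) := by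
  generalize h : s.get a = l
  induction l generalizing s with
  | nil => rw [← h, St.set_get, h]; exact Exec.whilene_done h
  | cons n l ih =>
    have h₁ := Exec.block (B := B) (s := s) [.drop a] (by simp [OkOps, Op.Ok, h])
    have h₂ := ih (s.set a l) (St.get_set_self _ _ _)
    rw [St.set_set] at h₂
    exact (Exec.whilene_step h h₁ (by simpa [runOps, Op.run, h, clear] using h₂)).mono
      (by simp; omega)

/-- The factor 4 counts a copy, a drop, the end of the block and the test. Flushing reverses the
order, so results collected in reverse are put right by one flush. -/
theorem exec_flush {B : ℕ} (s : St) {a b : Stk} (hab : a ≠ b) :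
    Exec B (flush a b) s ((s.set b ((s.get a).reverse ++ s.get b)).set a [])
      (4 * (s.get a).length + 1) := by
  generalize h : s.get a = l
  induction l generalizing s with
  | nil =>
    have e : (s.set b (([] : List ℕ).reverse ++ s.get b)).set a [] = s := by
      rw [List.reverse_nil, List.nil_append, St.set_get, ← h, St.set_get]
    rw [e]
    exact Exec.whilene_done h
  | cons n l ih =>
    have h₁ := Exec.block (B := B) (s := s) (mv a b) (by
      simp [OkOps, Op.Ok, Op.run, h, hab, St.get_set_of_ne])
    have h₂ := ih ((s.set b (n :: s.get b)).set a l) (St.get_set_self _ _ _)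
    have e : runOps (mv a b) s = (s.set b (n :: s.get b)).set a l := by
      simp [runOps, Op.run, h, hab, St.get_set_of_ne]
    rw [e] at h₁
    refine (Exec.whilene_step h h₁ (s'' := (s.set b ((n :: l).reverse ++ s.get b)).set a [])
      (t' := 4 * l.length + 1) ?_).mono (by simp; omega)
    rw [St.get_set_of_ne _ hab.symm, St.get_set_self, St.set_comm _ hab, St.set_set,
      St.set_set] at h₂
    simpa [flush] using h₂

/-- A program that needs a number of operations linear in the length of the description makes a
function computable in linear time. -/
theorem LinearTimeComputable.of_exec {P Q : Problem} {f : P.Inst → Q.Inst}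
    (p : Cmd (Option Stk)) (a c : ℕ)
    (h : ∀ I, Exec (maxBits (P.data I) + a) p { inp := P.data I } { inp := Q.data (f I) }
      (c * (P.data I).length)) :
    LinearTimeComputable P Q f := by
  have hmax : ∀ (l : List ℕ), ∀ x ∈ l, Nat.size x ≤ maxBits l := by
    intro l
    induction l with
    | nil => simp
    | cons y l ih =>
      rintro x (_ | ⟨_, hx⟩)
      · exact le_max_left _ _
      · exact (ih x hx).trans (le_max_right _ _)
  have hmax' : ∀ (l : List ℕ) (B : ℕ), (∀ x ∈ l, x < 2 ^ B) → maxBits l ≤ B := by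
    intro l B
    induction l with
    | nil => intro _; exact Nat.zero_le _
    | cons y l ih =>
      intro hl
      exact max_le (Nat.size_le.2 (hl y (by simp))) (ih fun x hx => hl x (by simp [hx]))
  -- An operation costs `10 * (B + 1)` steps with `B = maxBits + a`, and `B + 1` is at most `(a + 1)
  -- * (maxBits + 1)`. The summand 1 in `c + 1` accounts for the input itself in the bound on the
  -- size of the output.
  refine ⟨Cmd.machine (some Stk.inp) p, (c + 1) * (10 * (a + 1)), fun I => ?_⟩
  set l := P.data I
  have hinit : ∀ l : List ℕ, encodeStacks (St.get { inp := l }) =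
      Function.update (fun _ => []) (some Stk.inp) (encode l) := by
    intro l
    funext k
    rcases k with _ | k
    · rfl
    · cases k <;> rfl
  obtain ⟨h₁, h₂, n, h₃, h₄⟩ := h I (by
    intro k x hx
    have hx' : x ∈ l := by cases k <;> first | exact hx | simp [St.get] at hx
    exact (Nat.size_le.1 (hmax l x hx')).trans_le (Nat.pow_le_pow_right (by norm_num) (Nat.le_add_right _ _)))
  rw [hinit, hinit] at h₄
  have hB : maxBits l + a + 1 ≤ (a + 1) * (maxBits l + 1) := by nlinarith [Nat.zero_le (a * maxBits l)]
  refine ⟨h₄.outputs (h₃.trans ?_), ?_⟩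
  · rw [size]
    calc c * l.length * (10 * (maxBits l + a + 1))
        ≤ c * l.length * (10 * ((a + 1) * (maxBits l + 1))) := by gcongr
      _ ≤ (c + 1) * l.length * (10 * ((a + 1) * (maxBits l + 1))) := by gcongr; omega
      _ = _ := by ring
  -- The output is on the stack that held the input, and an operation lengthens a stack by at most
  -- one entry.
  · have hlen : (Q.data (f I)).length ≤ l.length + c * l.length := h₂ Stk.inp
    have hbits : maxBits (Q.data (f I)) ≤ maxBits l + a := hmax' _ _ (h₁ Stk.inp)
    rw [size, size]
    calc (Q.data (f I)).length * (maxBits (Q.data (f I)) + 1)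
        ≤ (l.length + c * l.length) * (maxBits l + a + 1) := by gcongr
      _ ≤ (l.length + c * l.length) * ((a + 1) * (maxBits l + 1)) := by gcongr
      _ = (c + 1) * (1 * (a + 1)) * (l.length * (maxBits l + 1)) := by ring
      _ ≤ (c + 1) * (10 * (a + 1)) * (l.length * (maxBits l + 1)) := by gcongr; norm_num

/-! ## Networks as lists of layers, and programs on their descriptions -/

/-- A node, without reference to the layer below: the number of its activation function, its bias,
and its connections. -/
structure RawNode where
  act : ℕ
  bias : ℚ
  terms : List (ℕ × ℚ)

/-- A term of a linear form: number of the variable, coefficient. -/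
def rawTerm (t : ℕ × ℚ) : List ℕ := t.1 :: ratData t.2

def RawNode.data (v : RawNode) : List ℕ := v.act :: (ratData v.bias ++ listData rawTerm v.terms)

/-- The description of a layer. -/
def rawLayer (l : List RawNode) : List ℕ := l.length :: listData RawNode.data l

/-- The description of a sequence of layers, with the mark `e` in front of the last one. -/
def rawLayers (e : ℕ) : List (List RawNode) → List ℕ
  | [] => []
  | [l] => e :: rawLayer l
  | l :: l' :: ls => 1 :: (rawLayer l ++ rawLayers e (l' :: ls))

/-- Renumber the nodes of the layer below. -/
def RawNode.map (f : ℕ → ℕ) (v : RawNode) : RawNode :=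
  { v with terms := v.terms.map fun t => (f t.1, t.2) }

theorem listData_eq {α : Type} (w : α → List ℕ) (l : List α) :
    listData w l = l.flatMap (fun a => 1 :: w a) ++ [0] := by
  induction l with
  | nil => rfl
  | cons a l ih => simp [listData, ih]

/-- `S u v` is the state in which the elements `u` are done and `v` remain. The cost of a pass,
including its test, is charged to the description `d x` of the element processed; the sum is linear
in the description of the list even if the elements differ in length. -/
theorem Exec.whilenz_list {α : Type} {B K : ℕ} {a : Stk} {p : Cmd (Option Stk)}
    (S : List α → List α → St) (d : α → List ℕ) (l : List α)
    (h₀ : ∃ r, (S l []).get a = 0 :: r)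
    (h : ∀ u x v, l = u ++ x :: v → (∃ n r, (S u (x :: v)).get a = n :: r ∧ n ≠ 0) ∧
      ∃ t, t + 1 ≤ K * (d x).length ∧ Exec B p (S u (x :: v)) (S (u ++ [x]) v) t) :
    Exec B (whilenz a p) (S [] l) (S l []) (K * (l.flatMap d).length + 1) := by
  suffices H : ∀ v u, l = u ++ v →
      Exec B (whilenz a p) (S u v) (S l []) (K * (v.flatMap d).length + 1) from H l [] rfl
  intro v
  induction v with
  | nil =>
    intro u hu
    obtain ⟨r, hr⟩ := h₀
    rw [List.append_nil] at hu
    subst hu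
    exact (Exec.whilenz_done hr).mono (by simp)
  | cons x v ih =>
    intro u hu
    obtain ⟨⟨n, r, h₁, h₂⟩, t, ht, h₃⟩ := h u x v hu
    refine (Exec.whilenz_step h₁ h₂ h₃ (ih (u ++ [x]) (by simp [hu]))).mono ?_
    rw [List.flatMap_cons, List.length_append, Nat.mul_add]
    omega

theorem Exec.whilene_list {B K : ℕ} {a : Stk} {p : Cmd (Option Stk)}
    (S : ℕ → St) (k : ℕ) (h₀ : (S k).get a = [])
    (h : ∀ i < k, (∃ n r, (S i).get a = n :: r) ∧ ∃ t, t + 1 ≤ K ∧ Exec B p (S i) (S (i + 1)) t) :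
    Exec B (whilene a p) (S 0) (S k) (K * k + 1) := by
  suffices H : ∀ j i, i + j = k → Exec B (whilene a p) (S i) (S k) (K * j + 1) from H k 0 (by simp)
  intro j
  induction j with
  | zero =>
    intro i hi
    obtain rfl : i = k := by omega
    exact (Exec.whilene_done h₀).mono (by simp)
  | succ j ih =>
    intro i hi
    obtain ⟨⟨n, r, h₁⟩, t, ht, h₃⟩ := h i (by omega)
    refine (Exec.whilene_step h₁ h₃ (ih (i + 1) (by omega))).mono ?_
    rw [Nat.mul_add]
    omega

theorem Exec.cast {B t t' : ℕ} {p : Cmd (Option Stk)} {s s' s'' : St} (h : Exec B p s s' t)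
    (e : s' = s'') (ht : t ≤ t') : Exec B p s s'' t' := (e ▸ h).mono ht

theorem exec_clear_eq {B n : ℕ} {s s' : St} {a : Stk} (e : s.set a [] = s')
    (hn : (s.get a).length ≤ n) : Exec B (clear a) s s' (4 * n + 1) :=
  (exec_clear s a).cast e (by omega)

theorem exec_flush_eq {B n : ℕ} {s s' : St} {a b : Stk} (hab : a ≠ b)
    (e : (s.set b ((s.get a).reverse ++ s.get b)).set a [] = s') (hn : (s.get a).length ≤ n) :
    Exec B (flush a b) s s' (4 * n + 1) :=
  (exec_flush s hab).cast e (by omega)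

/-- All numbers of a list have at most `B - 2` digits. -/
def Small (B : ℕ) (l : List ℕ) : Prop := ∀ x ∈ l, 4 * x + 3 < 2 ^ B

/-- Take over a number, and save it on the stack `buf`. -/
abbrev take : List (Op Stk) := [.copy .inp .buf, .copy .inp .out, .drop .inp]

/-- Copy a node, renumber the nodes of the layer below by `i ↦ 2 i + b`, and save the original. -/
def nodeProg (b : Bool) : Cmd (Option Stk) :=
  .seq (block (take ++ take ++ take ++ take))
    (.seq (whilenz .inp (block (take ++ (take ++ [.bit b .out]) ++ take ++ take ++ take)))
      (block take))

/-- Appending the digit `b` to the copied index is the renumbering `i ↦ 2 i + b`. All other numbers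
are transferred unchanged, and the saved original allows a second reading. -/
theorem exec_nodeProg {B : ℕ} (b : Bool) (s : St) (v : RawNode) (r : List ℕ)
    (hi : s.inp = v.data ++ r) (hv : Small B v.data) :
    Exec B (nodeProg b) s
      { s with
        inp := r
        out := (v.map fun i => 2 * i + b.toNat).data.reverse ++ s.out
        buf := v.data.reverse ++ s.buf } (18 * v.data.length) := by
  obtain ⟨c, q, ts⟩ := v
  simp only [RawNode.data, listData_eq] at hi hv
  set d : ℕ × ℚ → List ℕ := fun t => 1 :: rawTerm t with hd
  set e : ℕ × ℚ → List ℕ := fun t => 1 :: rawTerm (2 * t.1 + b.toNat, t.2) with he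
  refine (Exec.seq (Exec.block_eq (s' := ({ s with
      inp := ts.flatMap d ++ 0 :: r
      out := (c :: ratData q).reverse ++ s.out
      buf := (c :: ratData q).reverse ++ s.buf } : St)) _ ?_ ?_)
    (Exec.seq (Exec.whilenz_list (K := 18) (fun u v => ({ s with
      inp := v.flatMap d ++ 0 :: r
      out := (u.flatMap e).reverse ++ ((c :: ratData q).reverse ++ s.out)
      buf := (u.flatMap d).reverse ++ ((c :: ratData q).reverse ++ s.buf) } : St)) d ts ⟨_, rfl⟩ ?_)
      (Exec.block_eq _ ?_ ?_))).mono ?_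
  · simp [OkOps, Op.Ok, Op.run, St.get, St.set, hi, ratData]
  · simp [runOps, Op.run, St.get, St.set, hi, ratData]
  · intro u x v huv
    -- Three operations for each of the five numbers (mark, index, sign, numerator, denominator),
    -- one `bit`, and the end of the block.
    refine ⟨⟨1, _, rfl, one_ne_zero⟩, 17, by simp [hd, rawTerm, ratData], ?_⟩
    have hx : 4 * x.1 + 3 < 2 ^ B := hv x.1 (by simp [huv, hd, rawTerm])
    refine Exec.block_eq _ ?_ ?_
    · have : b.toNat ≤ 1 := Bool.toNat_le b
      simp [OkOps, Op.Ok, Op.run, St.get, St.set, hd, rawTerm, ratData]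
      omega
    · simp [runOps, Op.run, St.get, St.set, hd, he, rawTerm, ratData]
  · simp [OkOps, Op.Ok, Op.run, St.get, St.set]
  · simp [runOps, Op.run, St.get, St.set, RawNode.map, RawNode.data, listData_eq,
      List.flatMap_map, hd, he]
  · simp [RawNode.data, listData_eq, ratData, hd]
    omega

/-- Emit two modified copies of a node. -/
def pairProg (p p' : Cmd (Option Stk)) : Cmd (Option Stk) :=
  .seq (block [.push .out 1]) (.seq p (.seq (flush .buf .inp)
    (.seq (block [.push .out 1]) (.seq p' (clear .buf)))))

/-- The description of a pair of list elements. -/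
def pairData (v w : RawNode) : List ℕ := 1 :: (v.data ++ 1 :: w.data)

theorem two_le_of_small {B : ℕ} {l : List ℕ} {n : ℕ} (h : Small B (n :: l)) : 3 < 2 ^ B :=
  (Nat.le_add_left 3 _).trans_lt (h n (by simp))

/-- The first program leaves the node on `buf` in reverse; flushed back to `inp`, it is read once
more. The count is 18 for each of the programs and 4 for each of flushing and clearing, per entry;
the four remaining units per entry absorb the constants. -/
theorem exec_pairProg {B : ℕ} {p p' : Cmd (Option Stk)} {v w w' : RawNode}
    (hp : ∀ (s : St) (r : List ℕ), s.inp = v.data ++ r → Exec B p s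
      { s with inp := r, out := w.data.reverse ++ s.out, buf := v.data.reverse ++ s.buf }
      (18 * v.data.length))
    (hp' : ∀ (s : St) (r : List ℕ), s.inp = v.data ++ r → Exec B p' s
      { s with inp := r, out := w'.data.reverse ++ s.out, buf := v.data.reverse ++ s.buf }
      (18 * v.data.length))
    (s : St) (r : List ℕ) (hi : s.inp = v.data ++ r) (hb : s.buf = []) (hv : Small B v.data) :
    Exec B (pairProg p p') s
      { s with inp := r, out := (pairData w w').reverse ++ s.out } (48 * v.data.length) := by
  have h2 : 1 < 2 ^ B := lt_of_le_of_lt (by norm_num) (two_le_of_small hv)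
  refine (Exec.seq (Exec.block_eq (s' := { s with out := 1 :: s.out }) _ ?_ rfl)
    (Exec.seq (hp _ r hi)
    (Exec.seq (exec_flush_eq (n := v.data.length)
      (s' := { s with inp := v.data ++ r, out := w.data.reverse ++ 1 :: s.out }) (by decide) ?_ ?_)
    (Exec.seq (Exec.block_eq
      (s' := { s with inp := v.data ++ r, out := 1 :: (w.data.reverse ++ 1 :: s.out) }) _ ?_ rfl)
    (Exec.seq (hp' _ r rfl)
    (exec_clear_eq (n := v.data.length)
      (s' := { s with inp := r, out := w'.data.reverse ++ 1 :: (w.data.reverse ++ 1 :: s.out) })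
      ?_ ?_)))))).cast ?_ ?_
  · simpa [OkOps, Op.Ok] using h2
  · simp [St.get, St.set, hb]
  · simp [St.get, hb]
  · simpa [OkOps, Op.Ok] using h2
  · simp [St.set, hb]
  · simp [St.get, hb]
  · simp [pairData]
  · have : 4 ≤ v.data.length := by simp [RawNode.data, ratData]
    simp
    omega

/-- Emit two copies of a node, for which `i ↦ 2 i + b` and `i ↦ 2 i + b'` are the renumberings of
the nodes of the layer below. -/
def nodePairProg (b b' : Bool) : Cmd (Option Stk) := pairProg (nodeProg b) (nodeProg b')

theorem exec_nodePairProg {B : ℕ} (b b' : Bool) (s : St) (v : RawNode) (r : List ℕ)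
    (hi : s.inp = v.data ++ r) (hb : s.buf = []) (hv : Small B v.data) :
    Exec B (nodePairProg b b') s
      { s with
        inp := r
        out := (pairData (v.map fun i => 2 * i + b.toNat)
          (v.map fun i => 2 * i + b'.toNat)).reverse ++ s.out } (48 * v.data.length) :=
  exec_pairProg (fun s r hi => exec_nodeProg b s v r hi hv)
    (fun s r hi => exec_nodeProg b' s v r hi hv) s r hi hb hv

/-- The nodes of a layer: copy the number of nodes `k`, and emit `2 k + b`; then process the list of
nodes, pushing a mark on the stack `una` for each of them. -/
def nodesProg (b : Bool) (p : Cmd (Option Stk)) : Cmd (Option Stk) :=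
  .seq (block [.copy .inp .rs, .copy .inp .out, .drop .inp, .bit b .out])
    (whilenz .inp (.seq (block [.drop .inp, .push .una 1]) p))

/-- The marks on `una` are the width of the layer in unary, needed for loops over the output nodes;
`rs` keeps the width in binary until the layer becomes the layer below. `b` is 1 if one more node is
to follow the pairs, and the end mark 0 of the list is left on `inp`. -/
theorem exec_nodesProg {B K : ℕ} (b : Bool) (p : Cmd (Option Stk)) (f : RawNode → List ℕ)
    (l : List RawNode) (hl : Small B (rawLayer l))
    (hp : ∀ v ∈ l, ∀ (s : St) (r : List ℕ), s.inp = v.data ++ r → s.buf = [] →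
      Exec B p s { s with inp := r, out := (f v).reverse ++ s.out } (K * v.data.length))
    (s : St) (r : List ℕ) (hi : s.inp = rawLayer l ++ r) (hb : s.buf = []) (hu : s.una = []) :
    Exec B (nodesProg b p) s
      { s with
        inp := 0 :: r
        out := (l.flatMap f).reverse ++ (2 * l.length + b.toNat) :: s.out
        una := List.replicate l.length 1
        rs := l.length :: s.rs } ((K + 5) * (rawLayer l).length) := by
  simp only [rawLayer, listData_eq] at hi hl
  have h2 : 1 < 2 ^ B := lt_of_le_of_lt (by norm_num) (two_le_of_small hl)
  have hk : 4 * l.length + 3 < 2 ^ B := hl _ (by simp)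
  let S : List RawNode → List RawNode → St := fun x y => { s with
    inp := y.flatMap (fun v => 1 :: v.data) ++ 0 :: r
    out := (x.flatMap f).reverse ++ (2 * l.length + b.toNat) :: s.out
    una := List.replicate x.length 1
    rs := l.length :: s.rs }
  refine (Exec.seq (Exec.block_eq (s' := S [] l) _ ?_ ?_) (Exec.whilenz_list (K := K + 5) S
    (fun v => 1 :: v.data) l ⟨_, rfl⟩ ?_)).cast rfl ?_
  · have : b.toNat ≤ 1 := Bool.toNat_le b
    simp [OkOps, Op.Ok, Op.run, St.get, St.set, hi]
    omega
  · simp [runOps, Op.run, St.get, St.set, hi, hu, S]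
  · intro x v y hxy
    refine ⟨⟨1, _, rfl, one_ne_zero⟩, _, ?_, Exec.seq (Exec.block_eq (s' := ({ s with
      inp := v.data ++ (y.flatMap (fun v => 1 :: v.data) ++ 0 :: r)
      out := (x.flatMap f).reverse ++ (2 * l.length + b.toNat) :: s.out
      una := 1 :: List.replicate x.length 1
      rs := l.length :: s.rs } : St)) _ ?_ ?_)
      ((hp v (by simp [hxy]) ({ s with
      inp := v.data ++ (y.flatMap (fun v => 1 :: v.data) ++ 0 :: r)
      out := (x.flatMap f).reverse ++ (2 * l.length + b.toNat) :: s.out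
      una := 1 :: List.replicate x.length 1
      rs := l.length :: s.rs }) _ rfl hb).cast ?_ le_rfl)⟩
    · simp only [List.length_cons, List.length_nil]
      ring_nf
      omega
    · simpa [OkOps, Op.Ok, Op.run, St.get, St.set, S] using h2
    · simp [runOps, Op.run, St.get, St.set, S]
    · simp [List.replicate_succ, S]
  · simp [rawLayer, listData_eq]
    ring_nf
    omega

/-- The end of a layer. -/
def layerEnd : Cmd (Option Stk) :=
  block [.drop .inp, .push .out 0, .drop .wid, .copy .rs .wid, .drop .rs]

/-- A layer with two copies of each node. -/
def layerProg (b b' : Bool) : Cmd (Option Stk) :=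
  .seq (nodesProg false (nodePairProg b b')) layerEnd

/-- Add a node that passes on the value of the last node of the layer below. -/
def carryProg (code : ℕ) : Cmd (Option Stk) :=
  block [.push .out 1, .push .out code, .push .out 0, .push .out 0, .push .out 1, .push .out 1,
    .copy .wid .out, .bit false .out, .push .out 0, .push .out 1, .push .out 1, .push .out 0]

/-- A layer with two copies of each node, and one more node that passes on the value of the last
node of the layer below. -/
def carryLayerProg (code : ℕ) : Cmd (Option Stk) :=
  .seq (nodesProg true (nodePairProg false true)) (.seq (carryProg code) layerEnd)

/-- The layer with two copies of each node. -/
def rawPairs (b b' : ℕ) (l : List RawNode) : List RawNode :=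
  l.flatMap fun v => [v.map fun i => 2 * i + b, v.map fun i => 2 * i + b']

/-- The node that passes on the value of node `2 w`. -/
def rawCarry (code w : ℕ) : RawNode := ⟨code, 0, [(2 * w, 1)]⟩

theorem length_rawPairs (b b' : ℕ) (l : List RawNode) :
    (rawPairs b b' l).length = 2 * l.length := by
  simp [rawPairs, Nat.mul_comm]

theorem flatMap_pairData (b b' : ℕ) (l : List RawNode) :
    (l.flatMap fun v => pairData (v.map fun i => 2 * i + b) (v.map fun i => 2 * i + b')) =
      (rawPairs b b' l).flatMap fun v => 1 :: v.data := by
  simp [rawPairs, List.flatMap_assoc, pairData]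

/-- What a program for a layer has to do: read the layer `l` above a layer with `w` nodes, and
emit `g w l`. -/
def LayerSpec (B K : ℕ) (p : Cmd (Option Stk)) (g : ℕ → List RawNode → List RawNode) : Prop :=
  ∀ (s : St) (l : List RawNode) (w : ℕ) (r : List ℕ), Small B (rawLayer l) →
    4 * w + 3 < 2 ^ B → s.inp = rawLayer l ++ r → s.buf = [] → s.una = [] → s.rs = [] →
    s.wid = [w] →
    Exec B p s
      { s with
        inp := r
        out := (rawLayer (g w l)).reverse ++ s.out
        una := List.replicate l.length 1
        wid := [l.length] } (K * (rawLayer l).length)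

theorem layerSpec_layerProg (B : ℕ) (b b' : Bool) :
    LayerSpec B 60 (layerProg b b') fun _ l => rawPairs b.toNat b'.toNat l := by
  intro s l w r hl hw hi hb hu hr hwid
  have h2 : 1 < 2 ^ B := lt_of_le_of_lt (by norm_num) (two_le_of_small hl)
  have hsm : ∀ v ∈ l, Small B v.data := fun v hv x hx => hl x (by
    simp only [rawLayer, listData_eq, List.mem_cons, List.mem_append, List.mem_flatMap]
    exact .inr (.inl ⟨v, hv, .inr hx⟩))
  refine (Exec.seq (exec_nodesProg (K := 48) false (nodePairProg b b') _ l hl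
    (fun v hv s r hi hb => exec_nodePairProg b b' s v r hi hb (hsm v hv)) s r hi hb hu)
    (Exec.block_eq _ ?_ ?_)).cast rfl ?_
  rotate_left 2
  · simp [rawLayer]
    omega
  · simp [OkOps, Op.Ok, Op.run, St.get, St.set, hwid]
  · simp [runOps, Op.run, St.get, St.set, hwid, hr, rawLayer, listData_eq, length_rawPairs,
      flatMap_pairData]

/-- The layer below the new layer has `2 * w + 1` nodes, the last one with index `2 * w`. This is
the width on `wid` with a digit 0 appended. -/
theorem layerSpec_carryLayerProg {B code : ℕ} (hc : code < 2 ^ B) :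
    LayerSpec B 100 (carryLayerProg code) fun w l => rawPairs 0 1 l ++ [rawCarry code w] := by
  intro s l w r hl hw hi hb hu hr hwid
  have h2 : 1 < 2 ^ B := lt_of_le_of_lt (by norm_num) (two_le_of_small hl)
  have hsm : ∀ v ∈ l, Small B v.data := fun v hv x hx => hl x (by
    simp only [rawLayer, listData_eq, List.mem_cons, List.mem_append, List.mem_flatMap]
    exact .inr (.inl ⟨v, hv, .inr hx⟩))
  refine (Exec.seq (exec_nodesProg (K := 48) true (nodePairProg false true) _ l hl
    (fun v hv s r hi hb => exec_nodePairProg false true s v r hi hb (hsm v hv)) s r hi hb hu)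
    (Exec.seq (Exec.block _ ?_) (Exec.block_eq _ ?_ ?_))).cast rfl ?_
  rotate_left 3
  · simp [rawLayer]
    omega
  · simp [OkOps, Op.Ok, Op.run, St.get, St.set, hwid, h2, hc]
    have h3 : 2 * w < 2 ^ B := by omega
    exact h3
  · simp [OkOps, Op.Ok, Op.run, runOps, St.get, St.set, hwid]
  · have := flatMap_pairData 0 1 l
    simp at this
    simp [runOps, Op.run, St.get, St.set, hwid, hr, rawLayer, listData_eq, length_rawPairs,
      this, rawCarry, RawNode.data, rawTerm, ratData]

/-- Read the mark of a layer; emit `e` for the last layer and `1` for the other layers. -/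
def markProg (e : ℕ) : Cmd (Option Stk) :=
  .seq (block (mv .inp .flag)) (ifz .flag (block [.push .out e]) (block [.push .out 1]))

/-- Process the layers after the first one. -/
def layersProg (e : ℕ) (p : Cmd (Option Stk)) : Cmd (Option Stk) :=
  .seq (whilenz .flag (.seq (block [.drop .flag]) (.seq (clear .una) (.seq (markProg e) p))))
    (block [.drop .flag])

/-- Apply `g` to all layers, with the width of the layer below. -/
def mapLayers (g : ℕ → List RawNode → List RawNode) :
    ℕ → List (List RawNode) → List (List RawNode)
  | _, [] => []
  | w, l :: ls => g w l :: mapLayers g l.length ls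

/-- The width of the last layer. -/
def lastWidth : ℕ → List (List RawNode) → ℕ
  | w, [] => w
  | _, l :: ls => lastWidth l.length ls

/-- The mark of a layer that is followed by the layers `ls`. -/
def mark (e : ℕ) (ls : List (List RawNode)) : ℕ := if ls = [] then e else 1

theorem rawLayers_cons (e : ℕ) (l : List RawNode) (ls : List (List RawNode)) :
    rawLayers e (l :: ls) = mark e ls :: (rawLayer l ++ rawLayers e ls) := by
  cases ls <;> simp [rawLayers, mark]

theorem mapLayers_eq_nil {g : ℕ → List RawNode → List RawNode} {w : ℕ}
    {ls : List (List RawNode)} : mapLayers g w ls = [] ↔ ls = [] := by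
  cases ls <;> simp [mapLayers]

theorem length_le_rawLayer (l : List RawNode) : l.length + 2 ≤ (rawLayer l).length := by
  suffices h : l.length + 1 ≤ (listData RawNode.data l).length by simpa [rawLayer] using h
  induction l with
  | nil => simp [listData]
  | cons v l ih => simp [listData]; omega

/-- The mark read and the mark written differ for the last layer of `N` if further layers are
appended. The one read is kept on `flag`, where it controls the loop over the layers. -/
theorem exec_markProg {B e : ℕ} (he : e < 2 ^ B) (h1 : 1 < 2 ^ B) (s : St)
    (ls : List (List RawNode)) (r : List ℕ) (hi : s.inp = mark 0 ls :: r) (hf : s.flag = []) :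
    Exec B (markProg e) s
      { s with inp := r, flag := [mark 0 ls], out := mark e ls :: s.out } 7 := by
  have h₁ : Exec B (block (mv .inp .flag)) s { s with inp := r, flag := [mark 0 ls] } 3 :=
    Exec.block_eq _ (by simp [OkOps, Op.Ok, Op.run, St.get, St.set, hi])
      (by simp [runOps, Op.run, St.get, St.set, hi, hf])
  by_cases h : ls = []
  · have hm : mark 0 ls = 0 := by simp [mark, h]
    refine (h₁.seq (Exec.ifz_zero (l := []) (by simp [St.get, hm])
      (Exec.block_eq _ ?_ ?_))).cast rfl (by simp)
    · simpa [OkOps, Op.Ok] using he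
    · simp [runOps, Op.run, St.get, St.set, mark, h]
  · have hm : mark 0 ls = 1 := by simp [mark, h]
    refine (h₁.seq (Exec.ifz_ne (n := 1) (l := []) (by simp [St.get, hm]) one_ne_zero
      (Exec.block_eq _ ?_ ?_))).cast rfl (by simp)
    · simpa [OkOps, Op.Ok] using h1
    · simp [runOps, Op.run, St.get, St.set, mark, h]

theorem exec_layersProg {B K e : ℕ} {p : Cmd (Option Stk)}
    {g : ℕ → List RawNode → List RawNode} (hp : LayerSpec B K p g) (he : e < 2 ^ B)
    (h1 : 1 < 2 ^ B) (ls : List (List RawNode)) (w : ℕ) (s : St) (r : List ℕ)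
    (hs : Small B (rawLayers 0 ls)) (hw : 4 * w + 3 < 2 ^ B)
    (hi : s.inp = rawLayers 0 ls ++ r) (hb : s.buf = []) (hu : s.una = List.replicate w 1)
    (hr : s.rs = []) (hwid : s.wid = [w]) (hf : s.flag = [mark 0 ls]) :
    Exec B (layersProg e p) s
      { s with
        inp := r
        out := (rawLayers e (mapLayers g w ls)).reverse ++ s.out
        una := List.replicate (lastWidth w ls) 1
        wid := [lastWidth w ls]
        flag := [] } ((K + 20) * (rawLayers 0 ls).length + 4 * w + 10) := by
  suffices H : Exec B
      (whilenz .flag (.seq (block [.drop .flag]) (.seq (clear .una) (.seq (markProg e) p)))) s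
      { s with
        inp := r
        out := (rawLayers e (mapLayers g w ls)).reverse ++ s.out
        una := List.replicate (lastWidth w ls) 1
        wid := [lastWidth w ls]
        flag := [0] } ((K + 20) * (rawLayers 0 ls).length + 4 * w + 8) by
    refine (H.seq (Exec.block_eq _ ?_ ?_)).cast rfl ?_
    · simp [OkOps, Op.Ok, St.get]
    · simp [runOps, Op.run, St.get, St.set]
    · simp
  induction ls generalizing w s with
  | nil =>
    refine (Exec.whilenz_done (l := []) (by simp [St.get, hf, mark])).cast ?_ (by omega)
    obtain ⟨⟩ := s
    simp_all [rawLayers, mapLayers, lastWidth, mark]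
  | cons l ls ih =>
    rw [rawLayers_cons] at hs
    have hl : Small B (rawLayer l) := fun x hx => hs x (by simp [hx])
    have hls : Small B (rawLayers 0 ls) := fun x hx => hs x (by simp [hx])
    have hk : 4 * l.length + 3 < 2 ^ B := hl _ (by simp [rawLayer])
    have e₁ : s.inp = mark 0 ls :: (rawLayer l ++ (rawLayers 0 ls ++ r)) := by
      rw [hi, rawLayers_cons]; simp
    have e₂ := ih l.length { s with
      inp := rawLayers 0 ls ++ r
      out := (rawLayer (g w l)).reverse ++ mark e ls :: s.out
      una := List.replicate l.length 1
      wid := [l.length]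
      flag := [mark 0 ls] } hls hk rfl hb rfl hr rfl rfl
    refine (Exec.whilenz_step (n := 1) (l := []) (by simp [St.get, hf, mark]) one_ne_zero
      (Exec.seq (Exec.block_eq (s' := { s with flag := [] }) _ ?_ ?_)
      (Exec.seq (exec_clear_eq (n := w) (s' := { s with flag := [], una := [] }) ?_ ?_)
      (Exec.seq (exec_markProg he h1 _ ls _ e₁ rfl)
      (hp _ l w (rawLayers 0 ls ++ r) hl hw rfl hb rfl hr hwid)))) e₂).cast ?_ ?_
    · simp [OkOps, Op.Ok, St.get, hf]
    · simp [runOps, Op.run, St.get, St.set, hf]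
    · simp [St.set]
    · simp [St.get, hu]
    · simp [mapLayers, rawLayers_cons, lastWidth, mark, mapLayers_eq_nil]
    -- The marks on `una` for this layer are cleared in the next pass; the entries of its own
    -- description pay for that. For the layer before the first one, the term `4 * w` does.
    · have := length_le_rawLayer l
      rw [rawLayers_cons]
      simp only [List.length_cons, List.length_nil, List.length_append]
      ring_nf
      omega

/-! ## Interleaving two families -/

section Interleave

variable {α : Type} {k : ℕ}

/-- The even index `2 i`. -/
def ev (i : Fin k) : Fin (k * 2) := ⟨i * 2, by omega⟩

/-- The odd index `2 i + 1`. -/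
def od (i : Fin k) : Fin (k * 2) := ⟨i * 2 + 1, by omega⟩

/-- The family with the values `u i` at `2 i` and `v i` at `2 i + 1`. -/
def interleave (u v : Fin k → α) (i : Fin (k * 2)) : α :=
  if (i : ℕ) % 2 = 0 then u ⟨i / 2, by omega⟩ else v ⟨i / 2, by omega⟩

@[simp] theorem interleave_ev (u v : Fin k → α) (i : Fin k) : interleave u v (ev i) = u i := by
  simp [interleave, ev]

@[simp] theorem interleave_od (u v : Fin k → α) (i : Fin k) : interleave u v (od i) = v i := by
  have h : ((i : ℕ) * 2 + 1) / 2 = i := by omega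
  simp [interleave, od, h]

@[simp] theorem interleave_comp_ev (u v : Fin k → α) : interleave u v ∘ ev = u :=
  funext fun i => interleave_ev u v i

@[simp] theorem interleave_comp_od (u v : Fin k → α) : interleave u v ∘ od = v :=
  funext fun i => interleave_od u v i

theorem ev_or_od (i : Fin (k * 2)) : (∃ j, i = ev j) ∨ ∃ j, i = od j := by
  rcases Nat.even_or_odd' (i : ℕ) with ⟨j, hj | hj⟩
  · exact .inl ⟨⟨j, by omega⟩, Fin.ext (by simp [ev]; omega)⟩
  · exact .inr ⟨⟨j, by omega⟩, Fin.ext (by simp [od]; omega)⟩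

theorem ev_injective : Function.Injective (ev (k := k)) := fun i j h => by
  have := congrArg Fin.val h
  exact Fin.ext (by simp only [ev] at this; omega)

theorem od_injective : Function.Injective (od (k := k)) := fun i j h => by
  have := congrArg Fin.val h
  exact Fin.ext (by simp only [od] at this; omega)

theorem ev_ne_od (i j : Fin k) : ev i ≠ od j := fun h => by
  have := congrArg Fin.val h
  simp only [ev, od] at this
  omega

theorem ofFn_interleave (u v : Fin k → α) :
    List.ofFn (interleave u v) = (List.finRange k).flatMap fun i => [u i, v i] := by
  rw [List.ofFn_mul, List.flatMap_def, ← List.ofFn_eq_map]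
  congr 1
  congr 1
  funext i
  have h₁ := interleave_ev u v i
  have h₂ := interleave_od u v i
  simp only [ev, od] at h₁ h₂
  simp [List.ofFn_succ, h₁, h₂]

theorem comp_interleave {β : Type} (f : α → β) (u v : Fin k → α) :
    f ∘ interleave u v = interleave (f ∘ u) (f ∘ v) := by
  funext i
  simp only [Function.comp, interleave]
  split <;> rfl

end Interleave

/-! ## Linear forms -/

namespace LinForm

variable {n n' : ℕ}

/-- The form without terms. -/
def zero (n : ℕ) : LinForm n := ⟨[], by simp⟩

/-- A form with one term. -/
def single (i : Fin n) (c : ℚ) : LinForm n := ⟨[(i, c)], by simp⟩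

/-- A form with a term in an even and a term in an odd variable. -/
def cross (i j : Fin n) (c d : ℚ) : LinForm (n * 2) :=
  ⟨[(ev i, c), (od j, d)], by simpa using ev_ne_od i j⟩

/-- Renaming of the variables. -/
def reindex (e : Fin n → Fin n') (he : Function.Injective e) (a : LinForm n) : LinForm n' :=
  ⟨a.terms.map fun t => (e t.1, t.2), by
    have h := a.nodup.map he
    rwa [List.map_map] at h ⊢⟩

@[simp] theorem eval_zero (x : Fin n → ℝ) : (zero n).eval x = 0 := rfl

@[simp] theorem eval_single (i : Fin n) (c : ℚ) (x : Fin n → ℝ) :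
    (single i c).eval x = c * x i := by simp [eval, single]

@[simp] theorem eval_cross (i j : Fin n) (c d : ℚ) (x : Fin (n * 2) → ℝ) :
    (cross i j c d).eval x = c * x (ev i) + d * x (od j) := by simp [eval, cross]

@[simp] theorem eval_reindex (e : Fin n → Fin n') (he : Function.Injective e) (a : LinForm n)
    (x : Fin n' → ℝ) : (a.reindex e he).eval x = a.eval (x ∘ e) := by
  simp [eval, reindex, Function.comp_def]

end LinForm

/-! ## Networks with two copies of each node -/

section Double

variable {F : Set (ℝ → ℝ)} {m n n' k p : ℕ}

/-- Renaming of the nodes of the layer below. -/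
def Node.reindex (e : Fin n → Fin n') (he : Function.Injective e) (v : Node F n) : Node F n' :=
  { v with conns := v.conns.reindex e he }

@[simp] theorem Node.eval_reindex (e : Fin n → Fin n') (he : Function.Injective e) (v : Node F n)
    (x : Fin n' → ℝ) : (v.reindex e he).eval x = v.eval (x ∘ e) := by
  simp [Node.eval, Node.reindex]

/-- Two copies of each node of a layer, above a layer with two copies of each node. -/
def doubleLayer (layer : Fin k → Node F n) : Fin (k * 2) → Node F (n * 2) :=
  interleave (fun i => (layer i).reindex ev ev_injective)
    (fun i => (layer i).reindex od od_injective)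

/-- Two copies of each node of a layer, both above the same copy of the layer below. -/
def sameLayer (layer : Fin k → Node F n) : Fin (k * 2) → Node F (n * 2) :=
  interleave (fun i => (layer i).reindex ev ev_injective)
    (fun i => (layer i).reindex ev ev_injective)

theorem eval_interleave (u v : Fin k → Node F n) (x : Fin n → ℝ) :
    (fun i => (interleave u v i).eval x) =
      interleave (fun i => (u i).eval x) (fun i => (v i).eval x) :=
  comp_interleave (fun w : Node F n => w.eval x) u v

theorem eval_doubleLayer (layer : Fin k → Node F n) (x : Fin (n * 2) → ℝ) :
    (fun i => (doubleLayer layer i).eval x) =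
      interleave (fun i => (layer i).eval (x ∘ ev)) (fun i => (layer i).eval (x ∘ od)) := by
  rw [doubleLayer, eval_interleave]
  simp

theorem eval_sameLayer (layer : Fin k → Node F n) (x : Fin (n * 2) → ℝ) :
    (fun i => (sameLayer layer i).eval x) =
      interleave (fun i => (layer i).eval (x ∘ ev)) (fun i => (layer i).eval (x ∘ ev)) := by
  rw [sameLayer, eval_interleave]
  simp

/-- Two copies of a network. -/
def Net.double {m : ℕ} : {n : ℕ} → Net F m n → Net F (m * 2) (n * 2)
  | _, .output layer => .output (doubleLayer layer)
  | _, .hidden layer rest => .hidden (doubleLayer layer) rest.double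

theorem Net.eval_double (N : Net F m n) (x : Fin (n * 2) → ℝ) :
    N.double.eval x = interleave (N.eval (x ∘ ev)) (N.eval (x ∘ od)) := by
  induction N with
  | output layer => exact eval_doubleLayer layer x
  | hidden layer rest ih =>
    rw [double, eval, eval_doubleLayer, ih]
    simp [eval]

/-- Two copies of a network with the same inputs. -/
def Net.doubleSame {m : ℕ} : {n : ℕ} → Net F m n → Net F (m * 2) (n * 2)
  | _, .output layer => .output (sameLayer layer)
  | _, .hidden layer rest => .hidden (sameLayer layer) rest.double

/-- Once the first layer has equal values in both copies, so have all others. Only the first layer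
needs special connections; ordinary doubling does the rest. -/
theorem Net.eval_doubleSame (N : Net F m n) (x : Fin (n * 2) → ℝ) :
    N.doubleSame.eval x = interleave (N.eval (x ∘ ev)) (N.eval (x ∘ ev)) := by
  cases N with
  | output layer => exact eval_sameLayer layer x
  | hidden layer rest =>
    rw [doubleSame, eval, eval_sameLayer, eval_double]
    simp [eval]

/-- Two copies of a network, and another layer. -/
def Net.doubleThen {m : ℕ} (last : Fin p → Node F (m * 2)) :
    {n : ℕ} → Net F m n → Net F p (n * 2)
  | _, .output layer => .hidden (doubleLayer layer) (.output last)
  | _, .hidden layer rest => .hidden (doubleLayer layer) (rest.doubleThen last)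

theorem Net.eval_doubleThen (last : Fin p → Node F (m * 2)) (N : Net F m n)
    (x : Fin (n * 2) → ℝ) :
    (N.doubleThen last).eval x =
      fun i => (last i).eval (interleave (N.eval (x ∘ ev)) (N.eval (x ∘ od))) := by
  induction N with
  | output layer =>
    change (Net.output last).eval (fun i => (doubleLayer layer i).eval x) = _
    rw [eval_doubleLayer]
    rfl
  | hidden layer rest ih =>
    rw [doubleThen, eval, eval_doubleLayer, ih]
    simp [eval]

end Double

/-! ## The ball as a system of inequalities -/

/-- The inequalities `x_{2i+1} = x̄_i` and `|x_{2i} - x_{2i+1}| ≤ ε`. -/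
def ballIneqs {n : ℕ} (ε : WithTop NNRat) (center : Fin n → ℚ) (i : Fin n) :
    List (LinIneq (n * 2)) :=
  ⟨.single (od i) 1, center i⟩ :: ⟨.single (od i) (-1), -center i⟩ ::
    match ε with
    | none => []
    | some q => [⟨.cross i i 1 (-1), q⟩, ⟨.cross i i (-1) 1, q⟩]

/-- The system that describes the pairs of a point of the ball and the centre. -/
def ballSpec {n : ℕ} (ε : WithTop NNRat) (center : Fin n → ℚ) : LP (n * 2) :=
  (List.finRange n).flatMap (ballIneqs ε center)

theorem within_dist_iff {n : ℕ} (x y : Fin n → ℝ) (ε : WithTop NNRat) :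
    Within ((dInf n).dist x y) ε ↔ ∀ i, Within |x i - y i| ε := by
  cases ε with
  | top => simp [Within]
  | coe q =>
    change dist x y ≤ ((q : ℚ) : ℝ) ↔ _
    -- Nonnegativity of the radius is what makes this correct for `n = 0`.
    rw [dist_pi_le_iff (by exact_mod_cast q.2)]
    rfl

/-- Since the odd variables carry the centre, ε bounds a difference of variables. The numbers `x̄_i
± ε`, whose computation would take multiplications, do not occur. -/
theorem sat_ballSpec {n : ℕ} (ε : WithTop NNRat) (center : Fin n → ℚ) (x : Fin (n * 2) → ℝ) :
    (ballSpec ε center).Sat x ↔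
      x ∘ od = toReal center ∧ Within ((dInf n).dist (x ∘ ev) (toReal center)) ε := by
  have h : (ballSpec ε center).Sat x ↔
      ∀ i, x (od i) = center i ∧ Within |x (ev i) - x (od i)| ε := by
    simp only [LP.Sat, ballSpec, List.mem_flatMap, List.mem_finRange, true_and,
      forall_exists_index]
    rw [forall_comm]
    refine forall_congr' fun i => ?_
    cases ε with
    | top =>
      simp [ballIneqs, Within, le_antisymm_iff]
    | coe q =>
      simp [ballIneqs, Within, le_antisymm_iff, abs_le]
      constructor
      · rintro ⟨h₁, h₂, h₃, h₄⟩
        exact ⟨⟨h₁, h₂⟩, by linarith, by linarith⟩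
      · rintro ⟨⟨h₁, h₂⟩, h₃, h₄⟩
        exact ⟨h₁, h₂, by linarith, by linarith⟩
  rw [h, within_dist_iff, forall_and, funext_iff]
  refine and_congr_right fun h => forall_congr' fun i => ?_
  rw [h i]
  rfl

/-! ## Standard robustness as verification -/

section Reductions

variable {F : Set (ℝ → ℝ)}

/-- The inequalities `|y_{2i} - y_{2i+1}| ≤ δ`. -/
def closeSpec (m : ℕ) : WithTop NNRat → LP (m * 2)
  | none => []
  | some q => (List.finRange m).flatMap fun i =>
      [⟨.cross i i 1 (-1), q⟩, ⟨.cross i i (-1) 1, q⟩]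

theorem sat_closeSpec (m : ℕ) (δ : WithTop NNRat) (y : Fin (m * 2) → ℝ) :
    (closeSpec m δ).Sat y ↔ Within ((dInf m).dist (y ∘ od) (y ∘ ev)) δ := by
  rw [within_dist_iff]
  cases δ with
  | top => simp [closeSpec, LP.Sat, Within]
  | coe q =>
    simp only [LP.Sat, closeSpec, List.mem_flatMap, List.mem_finRange, true_and,
      forall_exists_index]
    rw [forall_comm]
    refine forall_congr' fun i => ?_
    simp [Within, abs_le]
    constructor
    · rintro ⟨h₁, h₂⟩
      exact ⟨by linarith, by linarith⟩
    · rintro ⟨h₁, h₂⟩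
      exact ⟨by linarith, by linarith⟩

/-- Standard robustness as an instance of the verification problem. -/
def SRInst.toVIP (I : SRInst F) : VIPInst F where
  n := I.n * 2
  m := I.m * 2
  net := I.net.double
  inSpec := ballSpec I.ε I.center
  outSpec := closeSpec I.m I.δ

/-- Every pair of vectors consists of the even and the odd part of its interleaving. -/
theorem forall_pair_iff {n : ℕ} {P : (Fin n → ℝ) → (Fin n → ℝ) → Prop} :
    (∀ x : Fin (n * 2) → ℝ, P (x ∘ ev) (x ∘ od)) ↔ ∀ x y, P x y :=
  ⟨fun h x y => by simpa using h (interleave x y), fun h x => h _ _⟩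

theorem SRInst.toVIP_holds (I : SRInst F) : I.toVIP.Holds ↔ I.Holds dInf := by
  simp only [VIPInst.Holds, toVIP, sat_ballSpec, sat_closeSpec, Net.eval_double,
    interleave_comp_ev, interleave_comp_od]
  rw [forall_pair_iff (P := fun x y => y = toReal I.center ∧
    Within ((dInf I.n).dist x (toReal I.center)) I.ε →
      Within ((dInf I.m).dist (I.net.eval y) (I.net.eval x)) I.δ)]
  exact ⟨fun h x hx => h x _ ⟨rfl, hx⟩, fun h x y hxy => hxy.1 ▸ h x hxy.2⟩

/-- The inequalities `y_{2i} ≤ y_{2j+1}`. -/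
def maxSpec (m : ℕ) (j : Fin m) : LP (m * 2) :=
  (List.finRange m).map fun i => ⟨.cross i j 1 (-1), 0⟩

/-- Classification robustness as an instance of the verification problem. -/
def CRInst.toVIP (I : CRInst F) : VIPInst F where
  n := I.n * 2
  m := I.m * 2
  net := I.net.doubleSame
  inSpec := ballSpec I.ε I.center
  outSpec := maxSpec I.m I.j

/-- The odd inputs are not read by the network; they only serve to describe the ball. On two equal
copies of the outputs, the inequality between variables `2 i` and `2 j + 1` says `y_i ≤ y_j`, and
the two variables are distinct for `i = j` too, as a sparse linear form requires. -/
theorem CRInst.toVIP_holds (I : CRInst F) : I.toVIP.Holds ↔ I.Holds dInf := by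
  simp only [VIPInst.Holds, toVIP, sat_ballSpec, Net.eval_doubleSame]
  rw [forall_pair_iff (P := fun x y => y = toReal I.center ∧
    Within ((dInf I.n).dist x (toReal I.center)) I.ε →
      (maxSpec I.m I.j).Sat (interleave (I.net.eval x) (I.net.eval x)))]
  have h : ∀ y : Fin I.m → ℝ, (maxSpec I.m I.j).Sat (interleave y y) ↔ ∀ i, y i ≤ y I.j := by
    intro y
    simp [LP.Sat, maxSpec]
  simp only [h]
  exact ⟨fun h x hx => h x _ ⟨rfl, hx⟩, fun h x y hxy => h x hxy.2⟩

/-! ## Standard robustness as classification robustness -/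

/-- The layer with the inputs and the constants `x̄_i`. -/
def centerLayer (id' : F) {n : ℕ} (center : Fin n → ℚ) : Fin (n * 2) → Node F n :=
  interleave (fun i => ⟨id', 0, .single i 1⟩) (fun i => ⟨id', center i, .zero n⟩)

/-- The layer with `δ` and the differences of corresponding nodes of the two copies. -/
def diffLayer (id' : F) (m : ℕ) (q : ℚ) : Fin (m * 2 + 1) → Node F (m * 2) :=
  Fin.cons ⟨id', q, .zero _⟩
    (interleave (fun i => ⟨id', 0, .cross i i 1 (-1)⟩) (fun i => ⟨id', 0, .cross i i (-1) 1⟩))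

/-- Standard robustness as an instance of classification robustness. -/
def SRInst.toCR (id' : F) (I : SRInst F) : CRInst F :=
  match I.δ with
  | none => ⟨I.n, 1, .hidden (centerLayer id' I.center)
      (I.net.doubleThen fun _ => ⟨id', 0, .zero _⟩), I.ε, I.center, 0⟩
  | some q => ⟨I.n, I.m * 2 + 1, .hidden (centerLayer id' I.center)
      (I.net.doubleThen (diffLayer id' I.m q)), I.ε, I.center, 0⟩

theorem SRInst.toCR_holds (hid : (id : ℝ → ℝ) ∈ F) (I : SRInst F) :
    (I.toCR ⟨id, hid⟩).Holds dInf ↔ I.Holds dInf := by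
  obtain ⟨n, m, N, ε, δ, c⟩ := I
  cases δ with
  | top =>
    -- For δ = ∞ the new network has a single output, which is always maximal.
    refine iff_of_true ?_ fun x _ => trivial
    intro x _ i
    have hi : i = (0 : Fin 1) := Subsingleton.elim (α := Fin 1) _ _
    rw [hi]
    rfl
  | coe q =>
    change (∀ x : Fin n → ℝ, Within ((dInf n).dist x (toReal c)) ε → ∀ i : Fin (m * 2 + 1),
      (Net.hidden (centerLayer ⟨id, hid⟩ c) (N.doubleThen (diffLayer ⟨id, hid⟩ m q))).eval x i ≤
      (Net.hidden (centerLayer ⟨id, hid⟩ c) (N.doubleThen (diffLayer ⟨id, hid⟩ m q))).eval x 0) ↔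
      ∀ x : Fin n → ℝ, Within ((dInf n).dist x (toReal c)) ε →
        Within ((dInf m).dist (N.eval (toReal c)) (N.eval x)) (q : WithTop NNRat)
    refine forall_congr' fun x => imp_congr_right fun _ => ?_
    have h₁ : ∀ x : Fin n → ℝ, (fun i => (centerLayer ⟨id, hid⟩ c i).eval x) =
        interleave x (toReal c) := by
      intro x
      rw [centerLayer, eval_interleave]
      simp [Node.eval]
      rfl
    have h₂ : (Net.hidden (centerLayer ⟨id, hid⟩ c)
        (N.doubleThen (diffLayer ⟨id, hid⟩ m q))).eval x =
        fun i => (diffLayer ⟨id, hid⟩ m q i).eval (interleave (N.eval x) (N.eval (toReal c))) := by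
      rw [Net.eval, h₁, Net.eval_doubleThen]
      simp
    rw [h₂, within_dist_iff]
    -- Output 0 is δ and satisfies its own inequality trivially; the outputs above it are the
    -- differences, at even and odd positions with opposite signs.
    rw [Fin.forall_fin_succ]
    simp only [diffLayer, Fin.cons_zero, Fin.cons_succ, le_refl, true_and]
    have h₃ : ∀ P : Fin (m * 2) → Prop, (∀ i, P i) ↔ ∀ i, P (ev i) ∧ P (od i) := fun P =>
      ⟨fun h i => ⟨h _, h _⟩, fun h i => by
        rcases ev_or_od i with ⟨j, rfl⟩ | ⟨j, rfl⟩
        exacts [(h j).1, (h j).2]⟩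
    rw [h₃]
    refine forall_congr' fun i => ?_
    simp [Node.eval, Within, abs_le]
    constructor
    · rintro ⟨h₁, h₂⟩
      exact ⟨by linarith, by linarith⟩
    · rintro ⟨h₁, h₂⟩
      exact ⟨by linarith, by linarith⟩

end Reductions

/-! ## Classification robustness as standard robustness -/

section Extend

variable {α : Type} {k : ℕ}

/-- A family with one more value at the end. -/
def extend (u : Fin k → α) (a : α) : Fin (k + 1) → α := Fin.snoc (α := fun _ => α) u a

@[simp] theorem extend_castSucc (u : Fin k → α) (a : α) (i : Fin k) :
    extend u a i.castSucc = u i := Fin.snoc_castSucc (α := fun _ => α) a u i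

@[simp] theorem extend_last (u : Fin k → α) (a : α) : extend u a (Fin.last k) = a :=
  Fin.snoc_last (α := fun _ => α) a u

theorem comp_extend {β : Type} (f : α → β) (u : Fin k → α) (a : α) :
    (fun i => f (extend u a i)) = extend (fun i => f (u i)) (f a) := by
  funext i
  refine Fin.lastCases ?_ (fun i => ?_) i <;> simp

theorem ofFn_extend (u : Fin k → α) (a : α) : List.ofFn (extend u a) = List.ofFn u ++ [a] := by
  rw [List.ofFn_succ', List.concat_eq_append]
  simp

end Extend

/-! ### The comparing network: two copies of `N` and a carried distance from the centre -/

section Guard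

variable {F : Set (ℝ → ℝ)} {m n n' k p : ℕ}

/-- The even position in a layer with one additional node. -/
def ev' (i : Fin n) : Fin (n * 2 + 1) := (ev i).castSucc

/-- The odd position in a layer with one additional node. -/
def od' (i : Fin n) : Fin (n * 2 + 1) := (od i).castSucc

theorem ev'_injective : Function.Injective (ev' (n := n)) :=
  (Fin.castSucc_injective _).comp ev_injective

theorem od'_injective : Function.Injective (od' (n := n)) :=
  (Fin.castSucc_injective _).comp od_injective

/-- Two copies of each node of a layer, and a node that passes on the last value of the layer
below. -/
def guardLayer (r : F) (layer : Fin k → Node F n) : Fin (k * 2 + 1) → Node F (n * 2 + 1) :=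
  extend (interleave (fun i => (layer i).reindex ev' ev'_injective)
    (fun i => (layer i).reindex od' od'_injective)) ⟨r, 0, .single (Fin.last _) 1⟩

/-- The values of two copies of a layer, and a further value. -/
def guarded (y : Fin n → ℝ) (w : ℝ) : Fin (n * 2 + 1) → ℝ := extend (interleave y y) w

@[simp] theorem guarded_comp_ev' (y : Fin n → ℝ) (w : ℝ) : guarded y w ∘ ev' = y := by
  funext i; simp [guarded, ev']

@[simp] theorem guarded_comp_od' (y : Fin n → ℝ) (w : ℝ) : guarded y w ∘ od' = y := by
  funext i; simp [guarded, od']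

/-- The additional node applies ReLU to `w`, which is harmless as `w ≥ 0`. The nodes of the network
are doubled in order that outputs `i` and `j` can later be taken from different copies. -/
theorem eval_guardLayer {r : F} (hr : (r : ℝ → ℝ) = ReLU) (layer : Fin k → Node F n)
    (y : Fin n → ℝ) {w : ℝ} (hw : 0 ≤ w) :
    (fun i => (guardLayer r layer i).eval (guarded y w)) =
      guarded (fun i => (layer i).eval y) w := by
  rw [guardLayer, comp_extend (fun v : Node F (n * 2 + 1) => v.eval (guarded y w)),
    eval_interleave]
  have h : Node.eval ⟨r, 0, .single (Fin.last _) 1⟩ (guarded y w) = w := by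
    simp [Node.eval, hr, ReLU, guarded, hw]
  rw [h]
  simp only [Node.eval_reindex, guarded_comp_ev', guarded_comp_od']
  rfl

/-- Apply `guardLayer` to all layers, and add a layer. -/
def Net.guardThen (r : F) {m : ℕ} (last : Fin p → Node F (m * 2 + 1)) :
    {n : ℕ} → Net F m n → Net F p (n * 2 + 1)
  | _, .output layer => .hidden (guardLayer r layer) (.output last)
  | _, .hidden layer rest => .hidden (guardLayer r layer) (rest.guardThen r last)

theorem Net.eval_guardThen {r : F} (hr : (r : ℝ → ℝ) = ReLU) (last : Fin p → Node F (m * 2 + 1))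
    (N : Net F m n) (y : Fin n → ℝ) {w : ℝ} (hw : 0 ≤ w) :
    (N.guardThen r last).eval (guarded y w) = fun i => (last i).eval (guarded (N.eval y) w) := by
  induction N with
  | output layer =>
    change (Net.output last).eval (fun i => (guardLayer r layer i).eval (guarded y w)) = _
    rw [eval_guardLayer hr _ _ hw]
    rfl
  | hidden layer rest ih =>
    rw [guardThen, eval, eval_guardLayer hr _ _ hw, ih]
    rfl

/-- Replace each variable by the difference of two variables. -/
def LinForm.split (e : Fin n → Fin n') (he : Function.Injective e) (a : LinForm n) :
    LinForm (n' * 2 * 2) :=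
  ⟨a.terms.flatMap fun t => [(ev (ev (e t.1)), t.2), (od (ev (e t.1)), -t.2)], by
    rw [List.map_flatMap]
    have h := a.nodup
    rw [List.Nodup, List.pairwise_map] at h
    refine List.nodup_flatMap.2 ⟨fun t _ => by simpa using ev_ne_od _ _, h.imp fun {s t} hst => ?_⟩
    have h₁ : e s.1 ≠ e t.1 := fun h => hst (he h)
    have h₂ : ev (e s.1) ≠ ev (e t.1) := fun h => h₁ (ev_injective h)
    simp [Function.onFun, ev_injective.eq_iff, od_injective.eq_iff, ev_ne_od, h₁.symm,
      fun i j : Fin (n' * 2) => (ev_ne_od j i).symm]⟩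

theorem LinForm.eval_split (e : Fin n → Fin n') (he : Function.Injective e) (a : LinForm n)
    (x : Fin (n' * 2 * 2) → ℝ) :
    (a.split e he).eval x = a.eval fun i => x (ev (ev (e i))) - x (od (ev (e i))) := by
  obtain ⟨l, hl⟩ := a
  simp only [eval, split]
  clear hl
  induction l with
  | nil => simp
  | cons t l ih =>
    simp only [List.flatMap_cons, List.map_append, List.sum_append, ih, List.map_cons,
      List.sum_cons, List.map_nil, List.sum_nil]
    push_cast
    ring

/-- The sum of the variables with indices `4 i + 2` and `4 i + 3`. -/
def sumForm (n : ℕ) : LinForm (n * 2 * 2) :=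
  ⟨(List.finRange n).flatMap fun i => [(ev (od i), 1), (od (od i), 1)], by
    rw [List.map_flatMap]
    refine List.nodup_flatMap.2 ⟨fun t _ => by simpa using ev_ne_od _ _,
      (List.nodup_finRange n).imp fun {s t} hst => ?_⟩
    simp [Function.onFun, ev_injective.eq_iff, od_injective.eq_iff, ev_ne_od, Ne.symm hst,
      fun i j : Fin (n * 2) => (ev_ne_od j i).symm]⟩

theorem eval_sumForm (x : Fin (n * 2 * 2) → ℝ) :
    (sumForm n).eval x = ∑ i : Fin n, (x (ev (od i)) + x (od (od i))) := by
  simp only [LinForm.eval, sumForm]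
  rw [← List.sum_ofFn, List.ofFn_eq_map, List.map_flatMap, List.flatMap_def, List.sum_flatten]
  simp [Function.comp_def]

/-- Two copies of each node of a layer, with inputs that are differences of two nodes of the layer
below, and a node with the sum of the other nodes. -/
def firstLayer (r : F) (e : Fin n → Fin n') (he : Function.Injective e)
    (layer : Fin k → Node F n) : Fin (k * 2 + 1) → Node F (n' * 2 * 2) :=
  extend (interleave (fun i => { layer i with conns := (layer i).conns.split e he })
    (fun i => { layer i with conns := (layer i).conns.split e he })) ⟨r, 0, sumForm n'⟩

/-- The network `guardThen`, with the first layer `firstLayer`. -/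
def Net.guardFirst (r : F) (e : Fin n → Fin n') (he : Function.Injective e)
    (last : Fin p → Node F (m * 2 + 1)) : Net F m n → Net F p (n' * 2 * 2)
  | .output layer => .hidden (firstLayer r e he layer) (.output last)
  | .hidden layer rest => .hidden (firstLayer r e he layer) (rest.guardThen r last)

theorem eval_firstLayer {r : F} (hr : (r : ℝ → ℝ) = ReLU) (e : Fin n → Fin n')
    (he : Function.Injective e) (layer : Fin k → Node F n) (x : Fin (n' * 2 * 2) → ℝ)
    (hw : 0 ≤ ∑ i : Fin n', (x (ev (od i)) + x (od (od i)))) :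
    (fun i => (firstLayer r e he layer i).eval x) =
      guarded (fun i => (layer i).eval fun i => x (ev (ev (e i))) - x (od (ev (e i))))
        (∑ i : Fin n', (x (ev (od i)) + x (od (od i)))) := by
  rw [firstLayer, comp_extend (fun v : Node F (n' * 2 * 2) => v.eval x), eval_interleave]
  have h : Node.eval ⟨r, 0, sumForm n'⟩ x = ∑ i : Fin n', (x (ev (od i)) + x (od (od i))) := by
    simp [Node.eval, hr, ReLU, eval_sumForm, hw]
  rw [h]
  simp [guarded, Node.eval, LinForm.eval_split]

theorem Net.eval_guardFirst {r : F} (hr : (r : ℝ → ℝ) = ReLU) (e : Fin n → Fin n')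
    (he : Function.Injective e) (last : Fin p → Node F (m * 2 + 1)) (N : Net F m n)
    (x : Fin (n' * 2 * 2) → ℝ) (hw : 0 ≤ ∑ i : Fin n', (x (ev (od i)) + x (od (od i)))) :
    (N.guardFirst r e he last).eval x =
      fun i => (last i).eval (guarded
        (N.eval fun i => x (ev (ev (e i))) - x (od (ev (e i))))
        (∑ i : Fin n', (x (ev (od i)) + x (od (od i))))) := by
  cases N with
  | output layer =>
    change (Net.output last).eval (fun i => (firstLayer r e he layer i).eval x) = _
    rw [eval_firstLayer hr e he _ _ hw]
    rfl
  | hidden layer rest =>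
    rw [guardFirst, eval, eval_firstLayer hr e he _ _ hw, eval_guardThen hr _ _ _ hw]
    rfl

/-- Positive and negative parts of the inputs (or of `c`, if `b`), and of their differences from
`c`. -/
def partsLayer (r : F) (b : Bool) (c : Fin n → ℚ) : Fin (n * 2 * 2) → Node F n :=
  interleave
    (interleave
      (fun i => if b then ⟨r, c i, .zero n⟩ else ⟨r, 0, .single i 1⟩)
      (fun i => ⟨r, -c i, .single i 1⟩))
    (interleave
      (fun i => if b then ⟨r, -c i, .zero n⟩ else ⟨r, 0, .single i (-1)⟩)
      (fun i => ⟨r, c i, .single i (-1)⟩))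

/-- The nodes `ReLU(y_i - y_j)` and `ReLU(y_i - y_j - w)`. -/
def compareLayer (r : F) (j : Fin m) : Fin (m * 2) → Node F (m * 2 + 1) :=
  interleave (fun i => ⟨r, 0, ⟨[(ev' i, 1), (od' j, -1)], by
      simpa [ev', od'] using ev_ne_od i j⟩⟩)
    (fun i => ⟨r, 0, ⟨[(ev' i, 1), (od' j, -1), (Fin.last _, -1)], by
      simpa [ev', od', Fin.castSucc_ne_last] using ev_ne_od i j⟩⟩)

/-- The network that compares the outputs of `N`. -/
def Net.compare (r : F) (b : Bool) (c : Fin n' → ℚ) (e : Fin n → Fin n')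
    (he : Function.Injective e) (j : Fin m) (N : Net F m n) : Net F (m * 2) n' :=
  .hidden (partsLayer r b c) (N.guardFirst r e he (compareLayer r j))

/-- This identity and the next one are the reason why ReLU suffices: inputs of either sign are
recovered from two nonnegative values, and absolute values are sums of such values. -/
theorem relu_sub_relu_neg (t : ℝ) : ReLU t - ReLU (-t) = t := by
  rcases le_total 0 t with h | h
  · simp [ReLU, h]
  · simp [ReLU, h]

theorem relu_add_relu_neg (t : ℝ) : ReLU t + ReLU (-t) = |t| := by
  rcases le_total 0 t with h | h
  · simp [ReLU, h, abs_of_nonneg h]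
  · simp [ReLU, h, abs_of_nonpos h]

/-- For each input `i` the first layer has four nodes: at `4 i` and `4 i + 1` the values of ReLU at
`± x_i` (at `± c_i` if `b` holds), at `4 i + 2` and `4 i + 3` those at `± (x_i - c_i)`. The first
pair is read by `N` through `e`; the second pair, for all `n'` inputs, adds up to `w`. A dummy input
outside the range of `e` thus influences `w` only. -/
theorem Net.eval_compare {r : F} (hr : (r : ℝ → ℝ) = ReLU) (b : Bool) (c : Fin n' → ℚ)
    (e : Fin n → Fin n') (he : Function.Injective e) (j : Fin m) (N : Net F m n)
    (x : Fin n' → ℝ) (y : Fin m → ℝ) (hy : y = N.eval ((if b then toReal c else x) ∘ e)) (w : ℝ)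
    (hw : w = ∑ i, |x i - c i|) :
    (N.compare r b c e he j).eval x =
      interleave (fun i => ReLU (y i - y j)) (fun i => ReLU (y i - y j - w)) := by
  set x' : Fin (n' * 2 * 2) → ℝ := fun i => (partsLayer r b c i).eval x with hx'
  have h : x' = interleave
      (interleave (fun i => ReLU ((if b then toReal c else x) i)) (fun i => ReLU (x i - c i)))
      (interleave (fun i => ReLU (-(if b then toReal c else x) i))
        (fun i => ReLU (-(x i - c i)))) := by
    rw [hx', partsLayer, eval_interleave]
    congr 1
    · rw [eval_interleave]
      cases b <;> simp [Node.eval, hr, toReal, sub_eq_add_neg]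
    · rw [eval_interleave]
      cases b <;> simp [Node.eval, hr, toReal, neg_add_eq_sub]
  have hw' : ∑ i : Fin n', (x' (ev (od i)) + x' (od (od i))) = w := by
    rw [hw]
    refine Finset.sum_congr rfl fun i _ => ?_
    rw [h]
    simp only [interleave_ev, interleave_od, relu_add_relu_neg]
  have hw0 : 0 ≤ w := hw ▸ Finset.sum_nonneg fun i _ => abs_nonneg _
  have hz : (fun i => x' (ev (ev (e i))) - x' (od (ev (e i)))) =
      (if b then toReal c else x) ∘ e := by
    funext i
    rw [h]
    simp only [interleave_ev, interleave_od, relu_sub_relu_neg]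
    rfl
  rw [compare, eval, eval_guardFirst hr e he _ _ _ (by rw [hw']; exact hw0), hw', hz, ← hy,
    compareLayer, eval_interleave]
  have h₁ : ∀ i, guarded y w (ev' i) = y i := fun i => congrFun (guarded_comp_ev' y w) i
  have h₂ : ∀ i, guarded y w (od' i) = y i := fun i => congrFun (guarded_comp_od' y w) i
  have h₃ : guarded y w (Fin.last _) = w := extend_last _ _
  congr 1
  · funext i
    simp [Node.eval, hr, LinForm.eval, h₁, h₂, sub_eq_add_neg]
  · funext i
    simp [Node.eval, hr, LinForm.eval, h₁, h₂, h₃, sub_eq_add_neg, add_assoc]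

/-- If the ball contains a point other than `c`, the comparing network is constant on it if and
only if output `j` is maximal on it. -/
theorem Net.compare_const_iff {r : F} (hr : (r : ℝ → ℝ) = ReLU) (b : Bool) (c : Fin n' → ℚ)
    (e : Fin n → Fin n') (he : Function.Injective e) (j : Fin m) (N : Net F m n)
    (S : Set (Fin n' → ℝ)) (hc : toReal c ∈ S) (hS : ∃ z ∈ S, z ≠ toReal c) :
    (∀ x ∈ S, (N.compare r b c e he j).eval (toReal c) = (N.compare r b c e he j).eval x) ↔
      ∀ x ∈ S, ∀ i, N.eval ((if b then toReal c else x) ∘ e) i ≤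
        N.eval ((if b then toReal c else x) ∘ e) j := by
  set Y : (Fin n' → ℝ) → Fin m → ℝ := fun x => N.eval ((if b then toReal c else x) ∘ e) with hY
  set w : (Fin n' → ℝ) → ℝ := fun x => ∑ i, |x i - c i| with hw
  have hG : ∀ x, (N.compare r b c e he j).eval x = interleave
      (fun i => ReLU (Y x i - Y x j)) (fun i => ReLU (Y x i - Y x j - w x)) := fun x =>
    N.eval_compare hr b c e he j x _ rfl _ rfl
  have hw0 : ∀ x, 0 ≤ w x := fun x => Finset.sum_nonneg fun i _ => abs_nonneg _
  have hwc : w (toReal c) = 0 := by simp [hw, toReal]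
  have hzero : ∀ x, (∀ i, Y x i ≤ Y x j) → (N.compare r b c e he j).eval x = fun _ => 0 := by
    intro x hx
    rw [hG]
    funext i
    rcases ev_or_od i with ⟨i, rfl⟩ | ⟨i, rfl⟩
    · rw [interleave_ev, ReLU, max_eq_left (by linarith [hx i])]
    · rw [interleave_od, ReLU, max_eq_left (by linarith [hx i, hw0 x])]
  constructor
  · intro h x hx i
    -- At the centre `w` vanishes, so both nodes for `i` have the same value there; by constancy
    -- this value is also that of either node at every point of the ball.
    have hG' : ∀ x ∈ S, (ReLU (Y (toReal c) i - Y (toReal c) j) = ReLU (Y x i - Y x j)) ∧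
        ReLU (Y (toReal c) i - Y (toReal c) j) = ReLU (Y x i - Y x j - w x) := by
      intro x hx
      have hx := h x hx
      rw [hG, hG, hwc] at hx
      have h₁ := congrFun hx (ev i)
      have h₂ := congrFun hx (od i)
      simp only [interleave_ev, interleave_od, sub_zero] at h₁ h₂
      exact ⟨h₁, h₂⟩
    -- A violation at `x` would make the common value positive, and constancy would carry it to the
    -- second point `z`.
    by_contra hlt
    have hlt : 0 < Y x i - Y x j := sub_pos.2 (not_le.1 hlt)
    have hpos : 0 < ReLU (Y (toReal c) i - Y (toReal c) j) := by
      rw [(hG' x hx).1, ReLU]; exact lt_max_of_lt_right hlt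
    obtain ⟨z, hz, hzc⟩ := hS
    obtain ⟨h₁, h₂⟩ := hG' z hz
    -- A sum of absolute values vanishes only if all coordinates agree, and `z` is not the centre.
    have hwz : 0 < w z := by
      refine (hw0 z).lt_of_ne fun h0 => hzc ?_
      rw [eq_comm, hw, Finset.sum_eq_zero_iff_of_nonneg fun i _ => abs_nonneg _] at h0
      funext i
      exact sub_eq_zero.1 (abs_eq_zero.1 (h0 i (Finset.mem_univ i)))
    rw [h₁] at h₂ hpos
    simp only [ReLU] at h₂ hpos
    -- With `w z > 0` the values of ReLU at `t` and `t - w z` agree only for `t ≤ 0`, and then they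
    -- are 0, contrary to `hpos`.
    rcases le_total (Y z i - Y z j) 0 with h0 | h0
    · rw [max_eq_left h0] at hpos
      exact lt_irrefl _ hpos
    · rw [max_eq_right h0] at h₂ hpos
      rcases le_total (Y z i - Y z j - w z) 0 with h3 | h3
      · rw [max_eq_left h3] at h₂; linarith
      · rw [max_eq_right h3] at h₂; linarith
  · intro h x hx
    rw [hzero _ (h _ hc), hzero _ (h _ hx)]

end Guard

/-! ### Constancy on a ball as standard robustness, with the degenerate balls -/

section Reduction

variable {F : Set (ℝ → ℝ)}

/-- Classification robustness as an instance of standard robustness. -/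
def CRInst.toSR (r : F) (I : CRInst F) : SRInst F :=
  if h : I.n = 0 then
    ⟨1, I.m * 2, I.net.compare r true (fun _ => 0) (fun i => (finCongr h i).elim0)
      (fun i => (finCongr h i).elim0) I.j, ((1 : NNRat) : WithTop NNRat),
      ((0 : NNRat) : WithTop NNRat), fun _ => 0⟩
  else if I.ε = ((0 : NNRat) : WithTop NNRat) then
    ⟨I.n, I.m * 2, I.net.compare r true I.center id Function.injective_id I.j,
      ((1 : NNRat) : WithTop NNRat), ((0 : NNRat) : WithTop NNRat), I.center⟩
  else
    ⟨I.n, I.m * 2, I.net.compare r false I.center id Function.injective_id I.j, I.ε,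
      ((0 : NNRat) : WithTop NNRat), I.center⟩

theorem within_zero_iff (t : ℝ) : Within t ((0 : NNRat) : WithTop NNRat) ↔ t ≤ 0 := by
  change t ≤ (((0 : NNRat) : ℚ) : ℝ) ↔ _
  simp

/-- With δ = 0 the metric on the outputs is irrelevant; `d` matters only through the ball in the
input space. -/
theorem within_dist_zero_iff {n : ℕ} (d : MetricSpace (Fin n → ℝ)) (x y : Fin n → ℝ) :
    Within (d.dist x y) ((0 : NNRat) : WithTop NNRat) ↔ x = y := by
  rw [within_zero_iff]
  exact ⟨fun h => d.eq_of_dist_eq_zero (le_antisymm h (@dist_nonneg _ d.toPseudoMetricSpace x y)),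
    fun h => h ▸ (d.dist_self x).le⟩

theorem exists_ne_within {d : ∀ n : ℕ, MetricSpace (Fin n → ℝ)} (hd : NoIsolatedPoints d) {n : ℕ}
    (hn : 0 < n) (c : Fin n → ℝ) {ε : WithTop NNRat} (hε : ε ≠ ((0 : NNRat) : WithTop NNRat)) :
    ∃ z ∈ {x | Within ((d n).dist x c) ε}, z ≠ c := by
  cases ε with
  | top =>
    obtain ⟨z, hz, -⟩ := hd n hn c 1 one_pos
    exact ⟨z, trivial, hz⟩
  | coe q =>
    have hq : (0 : NNRat) < q := pos_iff_ne_zero.2 fun h => hε (by rw [h])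
    obtain ⟨z, hz, h⟩ := hd n hn c (q : ℝ) (by exact_mod_cast hq)
    exact ⟨z, h, hz⟩

theorem mem_ball_self {n : ℕ} (d : MetricSpace (Fin n → ℝ)) (c : Fin n → ℝ) (ε : WithTop NNRat) :
    c ∈ {x | Within (d.dist x c) ε} := by
  cases ε with
  | top => trivial
  | coe q =>
    change d.dist c c ≤ ((q : ℚ) : ℝ)
    rw [d.dist_self]
    exact_mod_cast q.2

/-- For `n = 0` or ε = 0 the old ball is a single point and the comparison with a second point is
impossible. The new network then evaluates `N` at the centre only, and radius 1 supplies the second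
point without changing the question; for `n = 0` this takes an additional input. In the remaining
case the ball contains a second point because the centre is not isolated. -/
theorem CRInst.toSR_holds {d : ∀ n : ℕ, MetricSpace (Fin n → ℝ)} (hd : NoIsolatedPoints d)
    {r : F} (hr : (r : ℝ → ℝ) = ReLU) (I : CRInst F) : (I.toSR r).Holds d ↔ I.Holds d := by
  obtain ⟨n, m, N, ε, c, j⟩ := I
  have h1 : ((1 : NNRat) : WithTop NNRat) ≠ ((0 : NNRat) : WithTop NNRat) := by
    intro h
    exact one_ne_zero (WithTop.coe_injective h)
  rw [toSR]
  split_ifs with h h'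
  · dsimp only at h
    subst h
    simp only [SRInst.Holds, within_dist_zero_iff]
    refine (N.compare_const_iff hr true _ _ _ j {x | Within ((d 1).dist x _) _}
      (mem_ball_self _ _ _) (exists_ne_within hd one_pos _ h1)).trans ?_
    simp only [if_true, CRInst.Holds]
    -- The radius of the old ball does not matter, since `ℝ⁰` has only one point.
    have hsub : ∀ x y : Fin 0 → ℝ, x = y := fun x y => Subsingleton.elim x y
    constructor
    · intro H x _ i
      have := H _ (mem_ball_self _ _ _) i
      rwa [hsub x]
    · intro H x _ i
      have := H (toReal c) (mem_ball_self _ _ _) i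
      rwa [hsub (toReal c)] at this
  · dsimp only at h h'
    subst h'
    simp only [SRInst.Holds, within_dist_zero_iff]
    refine (N.compare_const_iff hr true _ _ _ j {x | Within ((d n).dist x _) _}
      (mem_ball_self _ _ _) (exists_ne_within hd (Nat.pos_of_ne_zero h) _ h1)).trans ?_
    simp only [if_true, CRInst.Holds, within_dist_zero_iff, Function.comp_id]
    constructor
    · rintro H x rfl i
      exact H _ (mem_ball_self _ _ _) i
    · intro H x _ i
      exact H _ rfl i
  · dsimp only at h h'
    simp only [SRInst.Holds, within_dist_zero_iff]
    refine (N.compare_const_iff hr false _ _ _ j {x | Within ((d n).dist x _) _}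
      (mem_ball_self _ _ _) (exists_ne_within hd (Nat.pos_of_ne_zero h) _ h')).trans ?_
    simp [CRInst.Holds]

end Reduction

/-! ## Emission of numbers, and loops over the centre and over the output nodes -/

/-- Something to be pushed on a stack: a constant, or the top of another stack with further binary
digits appended. -/
inductive Item : Type
  | num (c : ℕ)
  | top (k : Stk) (bs : List Bool)

namespace Item

/-- The number to be pushed. -/
def value (s : St) : Item → ℕ
  | num c => c
  | top k bs => bs.foldl (fun n b => 2 * n + b.toNat) (s.get k).headI

/-- The operations that push an item on the stack `o`. -/
def ops (o : Stk) : Item → List (Op Stk)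
  | num c => [.push o c]
  | top k bs => .copy k o :: bs.map fun b => .bit b o

/-- Admissibility of an item that is to be pushed on the stack `o`. -/
def Ok (B : ℕ) (o : Stk) (s : St) : Item → Prop
  | num c => c < 2 ^ B
  | top k bs => k ≠ o ∧ s.get k ≠ [] ∧ value s (top k bs) < 2 ^ B

end Item

/-- Push items on the stack `o`. -/
def emit (o : Stk) (l : List Item) : Cmd (Option Stk) := block (l.flatMap (Item.ops o))

theorem runOps_append (l l' : List (Op Stk)) (s : St) :
    runOps (l ++ l') s = runOps l' (runOps l s) := by
  induction l generalizing s with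
  | nil => rfl
  | cons o l ih => exact ih _

theorem okOps_append {B : ℕ} {l l' : List (Op Stk)} {s : St} :
    OkOps B (l ++ l') s ↔ OkOps B l s ∧ OkOps B l' (runOps l s) := by
  induction l generalizing s with
  | nil => simp [OkOps, runOps]
  | cons o l ih => simp [OkOps, runOps, ih, and_assoc]

/-- Appending digits never makes a number smaller, so a bound for the final number covers the
intermediate ones. -/
theorem le_foldl_bit (bs : List Bool) (n : ℕ) :
    n ≤ bs.foldl (fun n b => 2 * n + b.toNat) n := by
  induction bs generalizing n with
  | nil => exact le_rfl
  | cons b bs ih => exact le_trans (by dsimp only; omega) (ih _)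

theorem ops_bits {B : ℕ} (o : Stk) (bs : List Bool) (n : ℕ) (s : St) (l : List ℕ)
    (h : bs.foldl (fun n b => 2 * n + b.toNat) n < 2 ^ B) :
    OkOps B (bs.map fun b => .bit b o) (s.set o (n :: l)) ∧
      runOps (bs.map fun b => .bit b o) (s.set o (n :: l)) =
        s.set o (bs.foldl (fun n b => 2 * n + b.toNat) n :: l) := by
  induction bs generalizing n with
  | nil => exact ⟨trivial, rfl⟩
  | cons b bs ih =>
    obtain ⟨h₁, h₂⟩ := ih _ h
    have e : (Op.bit b o).run (s.set o (n :: l)) = s.set o ((2 * n + b.toNat) :: l) := by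
      rw [Op.run, St.get_set_self, St.set_set]
      rfl
    refine ⟨⟨⟨by simp [St.get_set_self], ?_⟩, by rw [e]; exact h₁⟩, ?_⟩
    · rw [St.get_set_self]
      exact (le_foldl_bit bs _).trans_lt h
    · rw [List.map_cons, runOps, e, h₂]
      rfl

theorem ops_item {B : ℕ} {o : Stk} {s : St} {x : Item} (h : x.Ok B o s) :
    OkOps B (x.ops o) s ∧ runOps (x.ops o) s = s.set o (x.value s :: s.get o) := by
  cases x with
  | num c => exact ⟨⟨h, trivial⟩, rfl⟩
  | top k bs =>
    obtain ⟨h₁, h₂, h₃⟩ := h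
    obtain ⟨h₄, h₅⟩ := ops_bits o bs _ s (s.get o) h₃
    exact ⟨⟨⟨h₁, h₂⟩, h₄⟩, h₅⟩

/-- Items are read from stacks other than `o`, so all their values can be taken in the initial
state. -/
theorem exec_emit {B : ℕ} (o : Stk) (l : List Item) (s : St) (h : ∀ x ∈ l, x.Ok B o s) :
    Exec B (emit o l) s (s.set o ((l.map (Item.value s)).reverse ++ s.get o))
      ((l.flatMap (Item.ops o)).length + 1) := by
  suffices H : ∀ u, OkOps B (l.flatMap (Item.ops o)) (s.set o u) ∧
      runOps (l.flatMap (Item.ops o)) (s.set o u) =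
        s.set o ((l.map (Item.value s)).reverse ++ u) by
    have := H (s.get o)
    rw [St.set_get] at this
    exact Exec.block_eq _ this.1 this.2
  induction l with
  | nil => exact fun u => ⟨trivial, rfl⟩
  | cons x l ih =>
    intro u
    have hv : x.value (s.set o u) = x.value s ∧ x.Ok B o (s.set o u) := by
      have hx := h x (by simp)
      cases x with
      | num c => exact ⟨rfl, hx⟩
      | top k bs =>
        obtain ⟨h₁, h₂, h₃⟩ := hx
        simp only [Item.value, Item.Ok] at h₃ ⊢
        rw [St.get_set_of_ne _ h₁]
        exact ⟨rfl, h₁, h₂, h₃⟩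
    obtain ⟨h₁, h₂⟩ := ops_item hv.2
    rw [St.get_set_self, St.set_set, hv.1] at h₂
    obtain ⟨h₃, h₄⟩ := ih (fun y hy => h y (by simp [hy])) (x.value s :: u)
    rw [List.flatMap_cons, okOps_append, runOps_append, h₂]
    exact ⟨⟨h₁, h₃⟩, by rw [h₄]; simp⟩

theorem exec_emit_eq {B t : ℕ} {o : Stk} {l : List Item} {s s' : St} (h : ∀ x ∈ l, x.Ok B o s)
    (e : s.set o ((l.map (Item.value s)).reverse ++ s.get o) = s')
    (ht : (l.flatMap (Item.ops o)).length + 1 ≤ t) : Exec B (emit o l) s s' t :=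
  (exec_emit o l s h).cast e ht

/-- The sign of a rational number as it is written. -/
def sgn (q : ℚ) : ℕ := if q < 0 then 1 else 0

theorem ratData_eq (q : ℚ) : ratData q = [sgn q, q.num.natAbs, q.den] := rfl

theorem ratData_neg (q : ℚ) : ratData (-q) = [sgn (-q), q.num.natAbs, q.den] := by
  simp [ratData, sgn]

/-- Zero is written with sign 0, and so is its negative. Therefore the numerator is tested before
the sign is flipped. -/
theorem sgn_neg (q : ℚ) : sgn (-q) = if q.num.natAbs = 0 then 0 else if sgn q = 0 then 1 else 0 := by
  rcases lt_trichotomy q 0 with h | h | h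
  · have : ¬ 0 < q := not_lt.2 h.le
    simp [sgn, h, this]
  · simp [sgn, h]
  · have : ¬ q < 0 := not_lt.2 h.le
    simp [sgn, h, this, h.ne']

/-- Push the sign of the negative of the rational number on the stacks `rs`, `rn`, `rd`. -/
def negSign (o : Stk) : Cmd (Option Stk) :=
  ifz .rn (emit o [.num 0]) (ifz .rs (emit o [.num 1]) (emit o [.num 0]))

theorem exec_negSign {B : ℕ} (hB : 1 < 2 ^ B) (o : Stk) (s : St) (q : ℚ) {u v : List ℕ}
    (h₁ : s.rs = sgn q :: u) (h₂ : s.rn = q.num.natAbs :: v) :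
    Exec B (negSign o) s (s.set o (sgn (-q) :: s.get o)) 4 := by
  have hB' : 0 < 2 ^ B := by omega
  rw [sgn_neg]
  by_cases hn : q.num.natAbs = 0
  · rw [if_pos hn]
    refine (Exec.ifz_zero (l := v) (by rw [← hn]; exact h₂)
      (exec_emit_eq (t := 2) ?_ rfl le_rfl)).cast rfl (by norm_num)
    simp [Item.Ok]
  · rw [if_neg hn]
    by_cases hs : sgn q = 0
    · rw [if_pos hs]
      refine (Exec.ifz_ne (a := .rn) (l := v) h₂ hn (Exec.ifz_zero (l := u) (by rw [← hs]; exact h₁)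
        (exec_emit_eq (t := 2) ?_ rfl le_rfl))).cast rfl (by norm_num)
      simpa [Item.Ok] using hB
    · rw [if_neg hs]
      refine (Exec.ifz_ne (a := .rn) (l := v) h₂ hn (Exec.ifz_ne (a := .rs) (l := u) h₁ hs
        (exec_emit_eq (t := 2) ?_ rfl le_rfl))).cast rfl (by norm_num)
      simp [Item.Ok]

/-- Repeat `body` for all points on the list of rational numbers on top of `inp`, with the number
on the stacks `rs`, `rn`, `rd`, and the index on `cnt`. -/
def forRats (body : Cmd (Option Stk)) : Cmd (Option Stk) :=
  whilenz .inp (.seq (block (.drop .inp :: (mv .inp .rs ++ mv .inp .rn ++ mv .inp .rd)))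
    (.seq body (block [.drop .rs, .drop .rn, .drop .rd, .succ .cnt])))

/-- `G u` describes the stacks after the coordinates `u`. The body is specified for every content
`r` of `inp`, so the coordinates not yet read are out of its reach. -/
theorem exec_forRats {B t : ℕ} {body : Cmd (Option Stk)} (G : List ℚ → St) (cs : List ℚ)
    (r : List ℕ) (hn : 4 * cs.length + 3 < 2 ^ B)
    (h : ∀ u x v, cs = u ++ x :: v → ∀ r,
      Exec B body { G u with
        inp := r, cnt := [u.length], rs := [sgn x], rn := [x.num.natAbs], rd := [x.den] }
      { G (u ++ [x]) with
        inp := r, cnt := [u.length], rs := [sgn x], rn := [x.num.natAbs], rd := [x.den] } t) :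
    Exec B (forRats body)
      { G [] with inp := listData ratData cs ++ r, cnt := [0], rs := [], rn := [], rd := [] }
      { G cs with inp := 0 :: r, cnt := [cs.length], rs := [], rn := [], rd := [] }
      ((t + 14) * (listData ratData cs).length) := by
  rw [listData_eq, List.append_assoc, List.singleton_append]
  refine (Exec.whilenz_list (a := .inp) (K := t + 14) (fun u v => { G u with
      inp := v.flatMap (fun x => 1 :: ratData x) ++ 0 :: r
      cnt := [u.length], rs := [], rn := [], rd := [] }) (fun x => 1 :: ratData x) cs ⟨r, rfl⟩
      ?_).cast rfl ?_
  · intro u x v huv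
    refine ⟨⟨1, _, rfl, one_ne_zero⟩, _, ?_, Exec.seq (Exec.block_eq (s' := { G u with
      inp := v.flatMap (fun x => 1 :: ratData x) ++ 0 :: r
      cnt := [u.length], rs := [sgn x], rn := [x.num.natAbs], rd := [x.den] }) _ ?_ rfl)
      (Exec.seq (h u x v huv _) (Exec.block_eq _ ?_ ?_))⟩
    · simp [ratData]
      omega
    · simp [OkOps, Op.Ok, Op.run, St.get, St.set, ratData]
    · have : u.length + 1 ≤ cs.length := by rw [huv]; simp
      simp [OkOps, Op.Ok, Op.run, St.get, St.set]
      omega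
    · simp [runOps, Op.run, St.get, St.set]
  · simp

/-- Repeat `body` as often as the stack `una` says, with the index on `cnt`. -/
def forUna (body : Cmd (Option Stk)) : Cmd (Option Stk) :=
  whilene .una (.seq (block [.drop .una]) (.seq body (block [.succ .cnt])))

theorem exec_forUna {B t : ℕ} {body : Cmd (Option Stk)} (G : ℕ → St) (k : ℕ)
    (hk : 4 * k + 3 < 2 ^ B)
    (h : ∀ i < k, ∀ r, Exec B body { G i with una := r, cnt := [i] }
      { G (i + 1) with una := r, cnt := [i] } t) :
    Exec B (forUna body) { G 0 with una := List.replicate k 1, cnt := [0] }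
      { G k with una := [], cnt := [k] } ((t + 5) * k + 1) := by
  refine (Exec.whilene_list (K := t + 5) (fun i => { G i with
    una := List.replicate (k - i) 1, cnt := [i] }) k (by simp [St.get]) ?_).cast (by simp) le_rfl
  intro i hi
  have e : k - i = (k - (i + 1)) + 1 := by omega
  refine ⟨⟨1, List.replicate (k - (i + 1)) 1, by rw [e]; rfl⟩, _, ?_,
    Exec.seq (Exec.block_eq (s' := { G i with una := List.replicate (k - (i + 1)) 1, cnt := [i] })
      _ ?_ ?_) (Exec.seq (h i hi _) (Exec.block_eq _ ?_ rfl))⟩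
  · simp
    omega
  · simp [OkOps, Op.Ok, St.get, e]
  · simp [runOps, Op.run, St.get, St.set, e, List.replicate_succ]
  · simp [OkOps, Op.Ok, St.get]
    omega

/-! ## Bounds -/

/-- The tag of a bound. -/
def boundTag : WithTop NNRat → List ℕ
  | none => [0]
  | some _ => [1]

/-- The numerator of a bound. -/
def boundNum : WithTop NNRat → List ℕ
  | none => []
  | some q => [q.num]

/-- The denominator of a bound. -/
def boundDen : WithTop NNRat → List ℕ
  | none => []
  | some q => [q.den]

/-- Read a bound to the stacks `et`, `en`, `ed`. -/
def readEps : Cmd (Option Stk) :=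
  .seq (block (mv .inp .et)) (ifz .et skip (block (mv .inp .en ++ mv .inp .ed)))

theorem exec_readEps {B : ℕ} (s : St) (e : WithTop NNRat) (r : List ℕ)
    (hi : s.inp = boundData e ++ r) (h₁ : s.et = []) (h₂ : s.en = []) (h₃ : s.ed = []) :
    Exec B readEps s
      { s with inp := r, et := boundTag e, en := boundNum e, ed := boundDen e } 9 := by
  cases e with
  | top =>
    refine (Exec.seq (Exec.block_eq (s' := { s with inp := r, et := [0] }) _ ?_ ?_)
      (Exec.ifz_zero (l := []) rfl Exec.skip)).cast ?_ (by simp)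
    · simp [OkOps, Op.Ok, Op.run, St.get, St.set, hi, boundData]
    · simp [runOps, Op.run, St.get, St.set, hi, boundData, h₁]
    · obtain ⟨⟩ := s
      simp_all [boundTag, boundNum, boundDen]
  | coe q =>
    refine (Exec.seq (Exec.block_eq (s' := { s with inp := q.num :: q.den :: r, et := [1] }) _ ?_ ?_)
      (Exec.ifz_ne (n := 1) (l := []) rfl one_ne_zero
        (Exec.block_eq _ ?_ ?_))).cast rfl (by simp)
    · simp [OkOps, Op.Ok, Op.run, St.get, St.set, hi, boundData]
    · simp [runOps, Op.run, St.get, St.set, hi, boundData, h₁]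
    · simp [OkOps, Op.Ok, Op.run, St.get, St.set]
    · simp [runOps, Op.run, St.get, St.set, h₂, h₃, boundTag, boundNum, boundDen]

/-- Read a bound to the stacks `dt`, `dn`, `dd`. -/
def readDelta : Cmd (Option Stk) :=
  .seq (block (mv .inp .dt)) (ifz .dt skip (block (mv .inp .dn ++ mv .inp .dd)))

theorem exec_readDelta {B : ℕ} (s : St) (e : WithTop NNRat) (r : List ℕ)
    (hi : s.inp = boundData e ++ r) (h₁ : s.dt = []) (h₂ : s.dn = []) (h₃ : s.dd = []) :
    Exec B readDelta s
      { s with inp := r, dt := boundTag e, dn := boundNum e, dd := boundDen e } 9 := by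
  cases e with
  | top =>
    refine (Exec.seq (Exec.block_eq (s' := { s with inp := r, dt := [0] }) _ ?_ ?_)
      (Exec.ifz_zero (l := []) rfl Exec.skip)).cast ?_ (by simp)
    · simp [OkOps, Op.Ok, Op.run, St.get, St.set, hi, boundData]
    · simp [runOps, Op.run, St.get, St.set, hi, boundData, h₁]
    · obtain ⟨⟩ := s
      simp_all [boundTag, boundNum, boundDen]
  | coe q =>
    refine (Exec.seq (Exec.block_eq (s' := { s with inp := q.num :: q.den :: r, dt := [1] }) _ ?_ ?_)
      (Exec.ifz_ne (n := 1) (l := []) rfl one_ne_zero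
        (Exec.block_eq _ ?_ ?_))).cast rfl (by simp)
    · simp [OkOps, Op.Ok, Op.run, St.get, St.set, hi, boundData]
    · simp [runOps, Op.run, St.get, St.set, hi, boundData, h₁]
    · simp [OkOps, Op.Ok, Op.run, St.get, St.set]
    · simp [runOps, Op.run, St.get, St.set, h₂, h₃, boundTag, boundNum, boundDen]

/-- Emit the bound on the stacks `et`, `en`, `ed`. -/
def emitEps : Cmd (Option Stk) :=
  ifz .et (emit .out [.num 0]) (emit .out [.num 1, .top .en [], .top .ed []])

/-- A bound consists of numbers with at most `B` digits. -/
def BoundOk (B : ℕ) (e : WithTop NNRat) : Prop := ∀ x ∈ boundData e, x < 2 ^ B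

theorem exec_emitEps {B : ℕ} (hB : 1 < 2 ^ B) (s : St) (e : WithTop NNRat) (he : BoundOk B e)
    (h₁ : s.et = boundTag e) (h₂ : s.en = boundNum e) (h₃ : s.ed = boundDen e) :
    Exec B emitEps s { s with out := (boundData e).reverse ++ s.out } 5 := by
  cases e with
  | top =>
    refine (Exec.ifz_zero (a := .et) (l := []) h₁ (exec_emit_eq (t := 2) ?_ rfl le_rfl)).mono (by norm_num)
    simp only [List.mem_singleton, forall_eq, Item.Ok]
    omega
  | coe q =>
    refine (Exec.ifz_ne (a := .et) (n := 1) (l := []) h₁ one_ne_zero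
      (exec_emit_eq (t := 4) ?_ ?_ le_rfl)).mono (by norm_num)
    · have e₁ := he q.num (by simp [boundData])
      have e₂ := he q.den (by simp [boundData])
      simp [Item.Ok, Item.value, St.get, h₂, h₃, boundNum, boundDen, hB, e₁, e₂]
    · simp [Item.value, St.get, St.set, h₂, h₃, boundNum, boundDen, boundData]

/-! ## The layers of a network -/

/-- Process all layers, the first one with `p₁`. -/
def netProg (e : ℕ) (p₁ p : Cmd (Option Stk)) : Cmd (Option Stk) :=
  .seq (markProg e) (.seq p₁ (layersProg e p))

/-- The first layer has a program of its own because in the reduction from CR to VIP both its copies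
read the same inputs. -/
theorem exec_netProg {B K e : ℕ} {p₁ p : Cmd (Option Stk)}
    {g₁ g : ℕ → List RawNode → List RawNode} (hp₁ : LayerSpec B K p₁ g₁) (hp : LayerSpec B K p g)
    (he : e < 2 ^ B) (h1 : 1 < 2 ^ B) (l : List RawNode) (ls : List (List RawNode)) (w : ℕ)
    (s : St) (r : List ℕ) (hs : Small B (rawLayers 0 (l :: ls))) (hw : 4 * w + 3 < 2 ^ B)
    (hi : s.inp = rawLayers 0 (l :: ls) ++ r) (hb : s.buf = []) (hu : s.una = [])
    (hr : s.rs = []) (hwid : s.wid = [w]) (hf : s.flag = []) :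
    Exec B (netProg e p₁ p) s
      { s with
        inp := r
        out := (rawLayers e (g₁ w l :: mapLayers g l.length ls)).reverse ++ s.out
        una := List.replicate (lastWidth w (l :: ls)) 1
        wid := [lastWidth w (l :: ls)] } ((K + 40) * (rawLayers 0 (l :: ls)).length) := by
  rw [rawLayers_cons] at hs hi
  have hl : Small B (rawLayer l) := fun x hx => hs x (by simp [hx])
  have hls : Small B (rawLayers 0 ls) := fun x hx => hs x (by simp [hx])
  have hk : 4 * l.length + 3 < 2 ^ B := hl _ (by simp [rawLayer])
  refine (Exec.seq (exec_markProg he h1 s ls _ (by simpa using hi) hf)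
    (Exec.seq (hp₁ { s with
      inp := rawLayer l ++ (rawLayers 0 ls ++ r), flag := [mark 0 ls], out := mark e ls :: s.out }
      l w _ hl hw rfl hb hu hr hwid)
    (exec_layersProg hp he h1 ls l.length _ r hls hk rfl hb rfl hr rfl rfl))).cast ?_ ?_
  · simp [rawLayers_cons, lastWidth, mark, mapLayers_eq_nil]
    exact hf
  · have := length_le_rawLayer l
    rw [rawLayers_cons]
    simp only [List.length_cons, List.length_append]
    ring_nf
    omega

/-! ## Networks without the numbers of nodes in their types -/

section Raw

variable {F : Set (ℝ → ℝ)} (code : F ↪ ℕ) {m n n' k p : ℕ}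

/-- A node without reference to the layer below. -/
def Node.raw (v : Node F n) : RawNode :=
  ⟨code v.act, v.bias, v.conns.terms.map fun t => ((t.1 : ℕ), t.2)⟩

/-- A layer as a list of nodes. -/
def rawOf (layer : Fin k → Node F n) : List RawNode := List.ofFn fun i => (layer i).raw code

/-- A network as a list of layers. -/
def Net.raw {m : ℕ} : {n : ℕ} → Net F m n → List (List RawNode)
  | _, .output layer => [rawOf code layer]
  | _, .hidden layer rest => rawOf code layer :: rest.raw

@[simp] theorem length_rawOf (layer : Fin k → Node F n) : (rawOf code layer).length = k := by
  simp [rawOf]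

theorem listData_map {α β : Type} (w : β → List ℕ) (f : α → β) (l : List α) :
    listData w (l.map f) = listData (fun a => w (f a)) l := by
  simp [listData_eq, List.flatMap_map]

theorem Node.data_raw (v : Node F n) : (v.raw code).data = v.data code := by
  simp only [RawNode.data, Node.raw, Node.data, LinForm.data, listData_map]
  rfl

theorem rawLayer_rawOf (layer : Fin k → Node F n) :
    rawLayer (rawOf code layer) = layerData code layer := by
  have h : rawOf code layer = (List.ofFn layer).map (Node.raw code) := by
    simp [rawOf, List.map_ofFn, Function.comp_def]
  rw [rawLayer, length_rawOf, layerData, h, listData_map]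
  simp only [Node.data_raw]

theorem Net.raw_ne_nil (N : Net F m n) : N.raw code ≠ [] := by
  cases N <;> simp [Net.raw]

/-- The description does not see the widths in the type of a network, so the programs can be
specified on plain lists of layers. -/
theorem Net.layersData_eq (N : Net F m n) : N.layersData code = rawLayers 0 (N.raw code) := by
  induction N with
  | output layer => simp [layersData, raw, rawLayers, rawLayer_rawOf]
  | hidden layer rest ih =>
    rw [raw, rawLayers_cons, mark, if_neg (rest.raw_ne_nil code), layersData, rawLayer_rawOf, ih]

theorem Net.lastWidth_raw (N : Net F m n) (w : ℕ) : lastWidth w (N.raw code) = m := by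
  induction N generalizing w with
  | output layer => simp [raw, lastWidth]
  | hidden layer rest ih => exact ih _

theorem rawOf_interleave (u v : Fin k → Node F n) :
    rawOf code (interleave u v) =
      (List.finRange k).flatMap fun i => [(u i).raw code, (v i).raw code] := by
  rw [rawOf, ← ofFn_interleave]
  congr 1
  exact comp_interleave (Node.raw code) u v

theorem Node.raw_reindex (e : Fin n → Fin n') (he : Function.Injective e) (v : Node F n)
    (f : ℕ → ℕ) (hf : ∀ i, (e i : ℕ) = f i) : (v.reindex e he).raw code = (v.raw code).map f := by
  simp [Node.raw, Node.reindex, LinForm.reindex, RawNode.map, hf]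

theorem rawOf_pairs (e e' : Fin n → Fin n') (he : Function.Injective e)
    (he' : Function.Injective e') (b b' : ℕ) (h : ∀ i, (e i : ℕ) = 2 * i + b)
    (h' : ∀ i, (e' i : ℕ) = 2 * i + b') (layer : Fin k → Node F n) :
    rawOf code (interleave (fun i => (layer i).reindex e he) fun i => (layer i).reindex e' he') =
      rawPairs b b' (rawOf code layer) := by
  rw [rawOf_interleave, rawPairs, rawOf, List.ofFn_eq_map, List.flatMap_map]
  simp only [Node.raw_reindex code e he _ (fun i => 2 * i + b) h,
    Node.raw_reindex code e' he' _ (fun i => 2 * i + b') h']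

theorem rawOf_doubleLayer (layer : Fin k → Node F n) :
    rawOf code (doubleLayer layer) = rawPairs 0 1 (rawOf code layer) :=
  rawOf_pairs code ev od _ _ 0 1 (fun i => by simp [ev, mul_comm])
    (fun i => by simp [od, mul_comm]) layer

theorem rawOf_sameLayer (layer : Fin k → Node F n) :
    rawOf code (sameLayer layer) = rawPairs 0 0 (rawOf code layer) :=
  rawOf_pairs code ev ev _ _ 0 0 (fun i => by simp [ev, mul_comm])
    (fun i => by simp [ev, mul_comm]) layer

theorem Net.raw_double (N : Net F m n) (w : ℕ) :
    N.double.raw code = mapLayers (fun _ l => rawPairs 0 1 l) w (N.raw code) := by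
  induction N generalizing w with
  | output layer => simp [double, raw, mapLayers, rawOf_doubleLayer]
  | hidden layer rest ih => simp [double, raw, mapLayers, rawOf_doubleLayer, ← ih]

/-- The layer that used to be the last one becomes a hidden layer; its mark turns from 0 into 1.
This is the purpose of the parameter `e`. -/
theorem rawLayers_append_one (ls : List (List RawNode)) (l : List RawNode) :
    rawLayers 0 (ls ++ [l]) = rawLayers 1 ls ++ 0 :: rawLayer l := by
  induction ls with
  | nil => rfl
  | cons l' ls ih => simp [rawLayers_cons, mark, ih]

theorem Net.raw_doubleThen (last : Fin p → Node F (m * 2)) (N : Net F m n) (w : ℕ) :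
    (N.doubleThen last).raw code =
      mapLayers (fun _ l => rawPairs 0 1 l) w (N.raw code) ++ [rawOf code last] := by
  induction N generalizing w with
  | output layer => simp [doubleThen, raw, mapLayers, rawOf_doubleLayer]
  | hidden layer rest ih => simp [doubleThen, raw, mapLayers, rawOf_doubleLayer, ← ih]

theorem rawOf_extend (u : Fin k → Node F n) (v : Node F n) :
    rawOf code (extend u v) = rawOf code u ++ [v.raw code] := by
  rw [rawOf, comp_extend, ofFn_extend]
  rfl

theorem rawOf_guardLayer (r : F) (layer : Fin k → Node F n) :
    rawOf code (guardLayer r layer) =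
      rawPairs 0 1 (rawOf code layer) ++ [rawCarry (code r) n] := by
  rw [guardLayer, rawOf_extend, rawOf_pairs code ev' od' _ _ 0 1
    (fun i => by simp [ev', ev, mul_comm]) (fun i => by simp [od', od, mul_comm])]
  simp [Node.raw, rawCarry, LinForm.single, mul_comm]

theorem Net.raw_guardThen (r : F) (last : Fin p → Node F (m * 2 + 1)) (N : Net F m n) :
    (N.guardThen r last).raw code =
      mapLayers (fun w l => rawPairs 0 1 l ++ [rawCarry (code r) w]) n (N.raw code) ++
        [rawOf code last] := by
  induction N with
  | output layer => simp [guardThen, raw, mapLayers, rawOf_guardLayer]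
  | hidden layer rest ih => simp [guardThen, raw, mapLayers, rawOf_guardLayer, ih]

/-- Replace each variable by the difference of two variables. -/
def RawNode.split (v : RawNode) : RawNode :=
  { v with terms := v.terms.flatMap fun t => [(4 * t.1, t.2), (4 * t.1 + 1, -t.2)] }

/-- The node with the sum of the variables with indices `4 i + 2` and `4 i + 3`. -/
def rawSum (code n : ℕ) : RawNode :=
  ⟨code, 0, (List.range n).flatMap fun i => [(4 * i + 2, 1), (4 * i + 3, 1)]⟩

theorem rawOf_firstLayer (r : F) (e : Fin n → Fin n') (he : Function.Injective e)
    (hv : ∀ i, (e i : ℕ) = i) (layer : Fin k → Node F n) :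
    rawOf code (firstLayer r e he layer) =
      (rawOf code layer).flatMap (fun v => [v.split, v.split]) ++ [rawSum (code r) n'] := by
  have h : ∀ v : Node F n,
      Node.raw code { v with conns := v.conns.split e he } = (v.raw code).split := by
    intro v
    simp only [Node.raw, LinForm.split, RawNode.split, List.map_flatMap, List.flatMap_map, ev, od,
      hv, List.map_cons, List.map_nil]
    congr 2
    funext t
    rw [show (t.1 : ℕ) * 2 * 2 = 4 * t.1 by ring]
  have h' : (⟨r, 0, sumForm n'⟩ : Node F (n' * 2 * 2)).raw code = rawSum (code r) n' := by
    simp only [Node.raw, sumForm, rawSum, List.map_flatMap, ev, od, List.map_cons, List.map_nil]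
    rw [← List.map_coe_finRange_eq_range, List.flatMap_map]
    congr 2
    funext t
    rw [show ((t : ℕ) * 2 + 1) * 2 = 4 * t + 2 by ring]
  rw [firstLayer, rawOf_extend, rawOf_interleave, h', rawOf, List.ofFn_eq_map, List.flatMap_map]
  simp only [h]

/-- The layers of a network above `firstLayer`, without the output layer. -/
def guardLayers (code n' : ℕ) : List (List RawNode) → List (List RawNode)
  | [] => []
  | l :: ls => (l.flatMap (fun v => [v.split, v.split]) ++ [rawSum code n']) ::
      mapLayers (fun w l => rawPairs 0 1 l ++ [rawCarry code w]) l.length ls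

theorem Net.raw_guardFirst (r : F) (e : Fin n → Fin n') (he : Function.Injective e)
    (hv : ∀ i, (e i : ℕ) = i) (last : Fin p → Node F (m * 2 + 1)) (N : Net F m n) :
    (N.guardFirst r e he last).raw code =
      guardLayers (code r) n' (N.raw code) ++ [rawOf code last] := by
  cases N with
  | output layer => simp [guardFirst, raw, guardLayers, mapLayers, rawOf_firstLayer code r e he hv]
  | hidden layer rest =>
    simp [guardFirst, raw, guardLayers, rawOf_firstLayer code r e he hv, raw_guardThen]

/-! ## The description of the special layers and systems -/

theorem zipIdx_ofFn {α : Type} (c : Fin n → α) :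
    (List.ofFn c).zipIdx = (List.finRange n).map fun i => (c i, (i : ℕ)) := by
  refine List.ext_getElem (by simp) fun i h₁ h₂ => ?_
  simp

theorem flatMap_finRange {α β : Type} (c : Fin n → α) (f : ℕ → α → List β) :
    ((List.finRange n).flatMap fun i : Fin n => f i (c i)) =
      (List.ofFn c).zipIdx.flatMap fun x => f x.2 x.1 := by
  rw [zipIdx_ofFn, List.flatMap_map]

theorem flatMap_finRange_range {β : Type} (f : ℕ → List β) :
    ((List.finRange n).flatMap fun i : Fin n => f i) = (List.range n).flatMap f := by
  rw [← List.map_coe_finRange_eq_range, List.flatMap_map]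

theorem ratData_one : ratData 1 = [0, 1, 1] := by simp [ratData]

theorem ratData_neg_one : ratData (-1) = [1, 1, 1] := by simp [ratData]

theorem ratData_zero : ratData 0 = [0, 0, 1] := by simp [ratData]

theorem ratData_nnrat (q : NNRat) : ratData (q : ℚ) = [0, q.num, q.den] := by
  have h : ¬ (q : ℚ) < 0 := not_lt.2 q.2
  simp only [ratData, h, if_false]
  rfl

/-- The description of the inequalities `|x_{2i} - x_{2i+1}| ≤ ε`. -/
def closeData (ε : WithTop NNRat) (i : ℕ) : List ℕ :=
  match ε with
  | none => []
  | some q => [1, 1, 2 * i, 0, 1, 1, 1, 2 * i + 1, 1, 1, 1, 0, 0, q.num, q.den,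
      1, 1, 2 * i, 1, 1, 1, 1, 2 * i + 1, 0, 1, 1, 0, 0, q.num, q.den]

/-- The description of the inequalities for one coordinate of the centre. -/
def ballData (ε : WithTop NNRat) (i : ℕ) (x : ℚ) : List ℕ :=
  [1, 1, 2 * i + 1, 0, 1, 1, 0] ++ (ratData x ++ ([1, 1, 2 * i + 1, 1, 1, 1, 0] ++
    (ratData (-x) ++ closeData ε i)))

theorem data_ballSpec (ε : WithTop NNRat) (c : Fin n → ℚ) :
    (ballSpec ε c).data =
      ((List.ofFn c).zipIdx.flatMap fun x => ballData ε x.2 x.1) ++ [0] := by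
  rw [LP.data, listData_eq, ballSpec, List.flatMap_assoc, ← flatMap_finRange c (ballData ε)]
  refine congrArg (· ++ [0]) (List.flatMap_congr fun i _ => ?_)
  cases ε with
  | top =>
    simp [ballIneqs, ballData, closeData, LinIneq.data, LinForm.data, LinForm.single, listData,
      termData, ratData_one, ratData_neg_one, od, mul_comm]
  | coe q =>
    simp [ballIneqs, ballData, closeData, LinIneq.data, LinForm.data, LinForm.single, listData,
      LinForm.cross, termData, ratData_one, ratData_neg_one, ratData_nnrat, ev, od, mul_comm]

theorem data_closeSpec (m : ℕ) (δ : WithTop NNRat) :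
    (closeSpec m δ).data = ((List.range m).flatMap (closeData δ)) ++ [0] := by
  rw [LP.data, listData_eq]
  congr 1
  cases δ with
  | top =>
    simp [closeSpec, closeData]
  | coe q =>
    simp only [closeSpec]
    rw [List.flatMap_assoc, ← flatMap_finRange_range]
    refine List.flatMap_congr fun i _ => ?_
    simp [closeData, LinIneq.data, LinForm.data, listData,
      LinForm.cross, termData, ratData_one, ratData_neg_one, ratData_nnrat, ev, od, mul_comm]

/-- The description of the inequality `y_{2i} ≤ y_{2j+1}`. -/
def maxData (j i : ℕ) : List ℕ := [1, 1, 2 * i, 0, 1, 1, 1, 2 * j + 1, 1, 1, 1, 0, 0, 0, 1]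

theorem data_maxSpec (m : ℕ) (j : Fin m) :
    (maxSpec m j).data = ((List.range m).flatMap (maxData j)) ++ [0] := by
  rw [LP.data, listData_eq, maxSpec, List.flatMap_map, ← flatMap_finRange_range]
  refine congrArg (· ++ [0]) (List.flatMap_congr fun i _ => ?_)
  simp [maxData, LinIneq.data, LinForm.data, listData,
    LinForm.cross, termData, ratData_one, ratData_neg_one, ratData_zero, ev, od, mul_comm]

/-- The description of the nodes for one coordinate of the centre. -/
def centerData (code i : ℕ) (x : ℚ) : List ℕ :=
  [1, code, 0, 0, 1, 1, i, 0, 1, 1, 0, 1, code] ++ (ratData x ++ [0])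

theorem rawLayer_centerLayer (r : F) (c : Fin n → ℚ) :
    rawLayer (rawOf code (centerLayer r c)) =
      (2 * n) :: (((List.ofFn c).zipIdx.flatMap fun x => centerData (code r) x.2 x.1) ++ [0]) := by
  rw [rawLayer, length_rawOf, listData_eq, centerLayer, rawOf_interleave,
    ← flatMap_finRange c (centerData (code r)), List.flatMap_assoc]
  refine congrArg₂ List.cons (mul_comm _ _) (congrArg (· ++ [0])
    (List.flatMap_congr fun i _ => ?_))
  simp [centerData, Node.raw, RawNode.data, LinForm.single, LinForm.zero, listData, rawTerm,
    ratData_one, ratData_zero]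

/-- The description of the nodes that compare the two copies of one output node. -/
def diffData (code i : ℕ) : List ℕ :=
  [1, code, 0, 0, 1, 1, 2 * i, 0, 1, 1, 1, 2 * i + 1, 1, 1, 1, 0,
    1, code, 0, 0, 1, 1, 2 * i, 1, 1, 1, 1, 2 * i + 1, 0, 1, 1, 0]

theorem rawLayer_diffLayer (r : F) (m : ℕ) (q : NNRat) :
    rawLayer (rawOf code (diffLayer r m q)) =
      [2 * m + 1, 1, code r, 0, q.num, q.den, 0] ++
        ((List.range m).flatMap (diffData (code r)) ++ [0]) := by
  have h : rawOf code (diffLayer r m q) = (⟨r, q, .zero _⟩ : Node F (m * 2)).raw code ::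
      rawOf code (interleave (fun i : Fin m => (⟨r, 0, .cross i i 1 (-1)⟩ : Node F (m * 2)))
        (fun i => ⟨r, 0, .cross i i (-1) 1⟩)) := by
    rw [rawOf, List.ofFn_succ]
    rfl
  rw [rawLayer, length_rawOf, listData_eq, h, rawOf_interleave, List.flatMap_cons,
    ← flatMap_finRange_range, List.flatMap_assoc]
  simp only [Node.raw, RawNode.data, LinForm.zero, listData, ratData_nnrat, List.map_nil,
    List.cons_append, List.nil_append]
  refine congrArg₂ (fun w l => (w + 1) :: _ :: _ :: _ :: _ :: _ :: _ :: (l ++ [0])) (mul_comm m 2)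
    (List.flatMap_congr fun i _ => ?_)
  simp [diffData, LinForm.cross, listData, rawTerm, ratData_one,
    ratData_neg_one, ratData_zero, ev, od, mul_comm]

/-- The description of the nodes for the positive and negative parts of one input. -/
def partsData (code : ℕ) (b : Bool) (i : ℕ) (x : ℚ) : List ℕ :=
  (bif b then 1 :: code :: (ratData x ++ [0]) else [1, code, 0, 0, 1, 1, i, 0, 1, 1, 0]) ++
  ((bif b then 1 :: code :: (ratData (-x) ++ [0]) else [1, code, 0, 0, 1, 1, i, 1, 1, 1, 0]) ++
  (1 :: code :: (ratData (-x) ++ ([1, i, 0, 1, 1, 0] ++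
  (1 :: code :: (ratData x ++ [1, i, 1, 1, 1, 0]))))))

theorem rawLayer_partsLayer (r : F) (b : Bool) (c : Fin n → ℚ) :
    rawLayer (rawOf code (partsLayer r b c)) =
      (4 * n) :: (((List.ofFn c).zipIdx.flatMap fun x => partsData (code r) b x.2 x.1) ++ [0]) := by
  have h : rawOf code (partsLayer r b c) = (List.finRange n).flatMap fun i =>
      [(if b then ⟨r, c i, .zero n⟩ else ⟨r, 0, .single i 1⟩ : Node F n).raw code,
        (if b then ⟨r, -c i, .zero n⟩ else ⟨r, 0, .single i (-1)⟩ : Node F n).raw code,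
        (⟨r, -c i, .single i 1⟩ : Node F n).raw code,
        (⟨r, c i, .single i (-1)⟩ : Node F n).raw code] := by
    -- In a double interleaving, the first members of both inner families come before the second
    -- members: the order for index `i` is `u`, `u'`, `v`, `v'`.
    have h₁ : ∀ (α : Type) (u : Fin n → α) (v : Fin n → α) (u' : Fin n → α) (v' : Fin n → α),
        List.ofFn (interleave (interleave u v) (interleave u' v')) =
          (List.finRange n).flatMap fun i => [u i, u' i, v i, v' i] := by
      intro α u v u' v'
      have h₂ : List.finRange (n * 2) = (List.finRange n).flatMap fun i => [ev i, od i] := by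
        rw [← ofFn_interleave, List.finRange]
        congr 1
        funext i
        rcases ev_or_od i with ⟨j, rfl⟩ | ⟨j, rfl⟩ <;> simp
      rw [ofFn_interleave, h₂, List.flatMap_assoc]
      simp
    rw [← h₁]
    rw [rawOf, partsLayer]
    congr 1
    refine (comp_interleave (Node.raw code) _ _).trans ?_
    rw [comp_interleave, comp_interleave]
    rfl
  rw [rawLayer, length_rawOf, listData_eq, h, ← flatMap_finRange c (partsData (code r) b),
    List.flatMap_assoc]
  refine congrArg₂ List.cons (by ring) (congrArg (· ++ [0]) (List.flatMap_congr fun i _ => ?_))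
  cases b <;> simp [partsData, Node.raw, RawNode.data, LinForm.single, LinForm.zero, listData,
    rawTerm, ratData_one, ratData_neg_one, ratData_zero]

/-- The description of the nodes that compare output `i` with output `j`. -/
def compareData (code m j i : ℕ) : List ℕ :=
  [1, code, 0, 0, 1, 1, 2 * i, 0, 1, 1, 1, 2 * j + 1, 1, 1, 1, 0,
    1, code, 0, 0, 1, 1, 2 * i, 0, 1, 1, 1, 2 * j + 1, 1, 1, 1, 1, 2 * m, 1, 1, 1, 0]

theorem rawLayer_compareLayer (r : F) (j : Fin m) :
    rawLayer (rawOf code (compareLayer r j)) =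
      (2 * m) :: ((List.range m).flatMap (compareData (code r) m j) ++ [0]) := by
  rw [rawLayer, length_rawOf, listData_eq, compareLayer, rawOf_interleave,
    ← flatMap_finRange_range, List.flatMap_assoc]
  refine congrArg₂ List.cons (mul_comm _ _) (congrArg (· ++ [0])
    (List.flatMap_congr fun i _ => ?_))
  simp [compareData, Node.raw, RawNode.data, listData, rawTerm, ratData_one, ratData_neg_one,
    ratData_zero, ev', od', ev, od, mul_comm]

end Raw

/-! ## The machines for the reductions to the verification problem -/

/-- Emit the inequalities `|x_{2i} - x_{2i+1}| ≤ ε`, with `i` on `cnt` and `ε` on `t`, `a`, `b`. -/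
def closeProg (t a b : Stk) : Cmd (Option Stk) :=
  ifz t skip (emit .out
    [.num 1, .num 1, .top .cnt [false], .num 0, .num 1, .num 1, .num 1, .top .cnt [true], .num 1,
      .num 1, .num 1, .num 0, .num 0, .top a [], .top b [],
      .num 1, .num 1, .top .cnt [false], .num 1, .num 1, .num 1, .num 1, .top .cnt [true], .num 0,
      .num 1, .num 1, .num 0, .num 0, .top a [], .top b []])

theorem exec_closeProg {B i : ℕ} (t a b : Stk) (ha : a ≠ .out) (hb : b ≠ .out)
    (hB : 4 * i + 3 < 2 ^ B) (s : St) (e : WithTop NNRat) (he : BoundOk B e) (hc : s.cnt = [i])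
    (h₁ : s.get t = boundTag e) (h₂ : s.get a = boundNum e) (h₃ : s.get b = boundDen e) :
    Exec B (closeProg t a b) s { s with out := (closeData e i).reverse ++ s.out } 40 := by
  have hc' : s.get .cnt = [i] := hc
  cases e with
  | top => exact (Exec.ifz_zero (l := []) h₁ Exec.skip).cast rfl (by norm_num)
  | coe q =>
    have e₁ := he q.num (by simp [boundData])
    have e₂ := he q.den (by simp [boundData])
    refine (Exec.ifz_ne (n := 1) (l := []) h₁ one_ne_zero
      (exec_emit_eq (t := 39) ?_ ?_ ?_)).cast rfl (by norm_num)
    · have e₃ : 2 * i < 2 ^ B := by omega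
      have e₄ : 2 * i + 1 < 2 ^ B := by omega
      have e₅ : 1 < 2 ^ B := by omega
      simp [Item.Ok, Item.value, hc', h₂, h₃, boundNum, boundDen, e₁, e₂, e₃, e₄, e₅, ha, hb]
    · simp [Item.value, hc', h₂, h₃, boundNum, boundDen, closeData]
      rfl
    · simp [Item.ops]

/-- Emit the inequalities for one coordinate of the centre. -/
def ballProg : Cmd (Option Stk) :=
  .seq (emit .out [.num 1, .num 1, .top .cnt [true], .num 0, .num 1, .num 1, .num 0, .top .rs [],
      .top .rn [], .top .rd [], .num 1, .num 1, .top .cnt [true], .num 1, .num 1, .num 1, .num 0])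
    (.seq (negSign .out) (.seq (emit .out [.top .rn [], .top .rd []]) (closeProg .et .en .ed)))

/-- The numbers of the description of `x` have at most `B` digits. -/
def RatOk (B : ℕ) (x : ℚ) : Prop := ∀ a ∈ ratData x, a < 2 ^ B

theorem exec_ballProg {B i : ℕ} (hB : 4 * i + 3 < 2 ^ B) (s : St) (e : WithTop NNRat) (x : ℚ)
    (he : BoundOk B e) (hx : RatOk B x) (hc : s.cnt = [i])
    (h₁ : s.et = boundTag e) (h₂ : s.en = boundNum e) (h₃ : s.ed = boundDen e)
    (h₄ : s.rs = [sgn x]) (h₅ : s.rn = [x.num.natAbs]) (h₆ : s.rd = [x.den]) :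
    Exec B ballProg s { s with out := (ballData e i x).reverse ++ s.out } 80 := by
  have e₀ : sgn x < 2 ^ B := hx _ (by simp [ratData_eq])
  have e₁ : x.num.natAbs < 2 ^ B := hx _ (by simp [ratData_eq])
  have e₂ : x.den < 2 ^ B := hx _ (by simp [ratData_eq])
  have e₄ : 2 * i + 1 < 2 ^ B := by omega
  have e₅ : 1 < 2 ^ B := by omega
  refine (Exec.seq (exec_emit_eq (t := 20) ?_ rfl ?_)
    (Exec.seq (exec_negSign e₅ .out _ x (u := []) (v := []) ?_ ?_)
    (Exec.seq (exec_emit_eq (t := 3) ?_ rfl le_rfl)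
    (exec_closeProg .et .en .ed (by decide) (by decide) hB _ e he ?_ ?_ ?_ ?_)))).cast ?_ ?_
  · simp [Item.Ok, Item.value, St.get, hc, h₄, h₅, h₆, e₀, e₁, e₂, e₄, e₅]
  · simp [Item.ops]
  · simp [St.set, h₄]
  · simp [St.set, h₅]
  · simp [Item.Ok, Item.value, St.get, St.set, h₅, h₆, e₁, e₂]
  · simp [St.set, hc]
  · simp [St.set, St.get, h₁]
  · simp [St.set, St.get, h₂]
  · simp [St.set, St.get, h₃]
  · simp [Item.value, St.set, St.get, hc, h₄, h₅, h₆, ballData, ratData_neg, ratData_eq x]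
  · simp

/-- Emit the inequality `y_{2i} ≤ y_{2j+1}`, with `i` on `cnt` and `j` on `con`. -/
def maxProg : Cmd (Option Stk) :=
  emit .out [.num 1, .num 1, .top .cnt [false], .num 0, .num 1, .num 1, .num 1, .top .con [true],
    .num 1, .num 1, .num 1, .num 0, .num 0, .num 0, .num 1]

theorem exec_maxProg {B i j : ℕ} (hi : 4 * i + 3 < 2 ^ B) (hj : 4 * j + 3 < 2 ^ B) (s : St)
    (h₁ : s.cnt = [i]) (h₂ : s.con = [j]) :
    Exec B maxProg s { s with out := (maxData j i).reverse ++ s.out } 20 := by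
  refine exec_emit_eq ?_ ?_ ?_
  · have e₁ : 2 * i < 2 ^ B := by omega
    have e₂ : 2 * j + 1 < 2 ^ B := by omega
    have e₃ : 1 < 2 ^ B := by omega
    simp [Item.Ok, Item.value, St.get, h₁, h₂, e₁, e₂, e₃]
  · simp [Item.value, St.get, St.set, h₁, h₂, maxData]
  · simp [Item.ops]

/-- Empty several stacks. -/
def clearAll : List Stk → Cmd (Option Stk)
  | [] => skip
  | k :: l => .seq (clear k) (clearAll l)

theorem exec_clearAll {B : ℕ} (l : List Stk) (s : St) (hs : ∀ k ∈ l, (s.get k).length ≤ 1) :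
    Exec B (clearAll l) s (l.foldl (fun s k => s.set k []) s) (5 * l.length + 1) := by
  induction l generalizing s with
  | nil => exact Exec.skip
  | cons k l ih =>
    refine (Exec.seq (exec_clear_eq (n := 1) rfl (hs k (by simp))) (ih _ fun j hj => ?_)).cast rfl ?_
    · by_cases h : j = k
      · subst h
        simp [St.get_set_self]
      · rw [St.get_set_of_ne _ h]
        exact hs j (by simp [hj])
    · simp
      omega

/-- The number of operations bounds the number of entries to be moved. -/
theorem Exec.seq_flush {B t : ℕ} {p : Cmd (Option Stk)} {s s' : St} (h : Exec B p s s' t)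
    {a b : Stk} (hab : a ≠ b) (hs : s.get a = []) :
    Exec B (.seq p (flush a b)) s
      ((s'.set b ((s'.get a).reverse ++ s'.get b)).set a []) (5 * t + 1) := by
  -- The bound on the length of the stack `a` is part of `Exec`, under its assumption on the digits.
  -- Flushing costs 4 per entry, hence 5 times the old bound in all.
  intro hB
  have h₁ := (h hB).2.1 a
  rw [hs, List.length_nil] at h₁
  exact ((h.seq (exec_flush s' hab)).mono (by omega)) hB

theorem length_boundTag (e : WithTop NNRat) : (boundTag e).length ≤ 1 := by cases e <;> simp [boundTag]

theorem length_boundNum (e : WithTop NNRat) : (boundNum e).length ≤ 1 := by cases e <;> simp [boundNum]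

theorem length_boundDen (e : WithTop NNRat) : (boundDen e).length ≤ 1 := by cases e <;> simp [boundDen]

/-- The program for the reduction from standard robustness to verification. -/
def srToVIPProg : Cmd (Option Stk) :=
  .seq (.seq (block [.copy .inp .out, .bit false .out, .copy .inp .wid, .drop .inp])
  (.seq (netProg 0 (layerProg false true) (layerProg false true))
  (.seq readEps (.seq readDelta
  (.seq (block [.push .cnt 0]) (.seq (forRats ballProg)
  (.seq (block [.drop .inp, .push .out 0, .drop .cnt, .push .cnt 0])
  (.seq (forUna (closeProg .dt .dn .dd))
  (.seq (block [.push .out 0])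
  (clearAll [.wid, .cnt, .et, .en, .ed, .dt, .dn, .dd])))))))))) (flush .out .inp)

theorem small_left {B : ℕ} {l l' : List ℕ} (h : Small B (l ++ l')) : Small B l :=
  fun x hx => h x (by simp [hx])

theorem small_right {B : ℕ} {l l' : List ℕ} (h : Small B (l ++ l')) : Small B l' :=
  fun x hx => h x (by simp [hx])

theorem Small.lt {B : ℕ} {l : List ℕ} (h : Small B l) : ∀ x ∈ l, x < 2 ^ B :=
  fun x hx => by have := h x hx; omega

/-- Each width is an entry of the description; this limits the digits of all indices formed from it.
-/
theorem lastWidth_lt {B w : ℕ} (ls : List (List RawNode)) (h : Small B (rawLayers 0 ls))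
    (hw : 4 * w + 3 < 2 ^ B) : 4 * lastWidth w ls + 3 < 2 ^ B := by
  induction ls generalizing w with
  | nil => exact hw
  | cons l ls ih =>
    rw [rawLayers_cons] at h
    refine ih (fun x hx => h x (by simp [hx])) (h l.length (by simp [rawLayer]))

/-- The nodes of the last layer are listed one by one, so a loop over the output nodes has at most
as many passes as the description has entries. -/
theorem lastWidth_le (l : List RawNode) (ls : List (List RawNode)) (w : ℕ) :
    lastWidth w (l :: ls) ≤ (rawLayers 0 (l :: ls)).length := by
  induction ls generalizing l w with
  | nil =>
    have := length_le_rawLayer l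
    simp [lastWidth, rawLayers]
    omega
  | cons l' ls ih =>
    have := ih l' l.length
    rw [rawLayers_cons]
    simp only [List.length_cons, List.length_append] at this ⊢
    simp only [lastWidth] at this ⊢
    omega

theorem ratOk_of_small {B : ℕ} {cs : List ℚ} (h : Small B (listData ratData cs)) {x : ℚ}
    (hx : x ∈ cs) : RatOk B x := fun a ha => h.lt a (by
  rw [listData_eq]
  simp only [List.mem_append, List.mem_flatMap, List.mem_cons]
  exact .inl ⟨x, hx, .inr ha⟩)

/-- The new description follows the order of the old one: network, inequalities for the coordinates
of the centre, inequalities for the outputs. It can be collected on `out` in one go, with ε and δ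
waiting on their own stacks, and a single flush at the end puts it into the right order. -/
theorem exec_srToVIPProg {B n : ℕ} (l : List RawNode) (ls : List (List RawNode))
    (ε δ : WithTop NNRat) (cs : List ℚ) (hn : cs.length = n) (s : List ℕ)
    (hs : s = n :: (rawLayers 0 (l :: ls) ++
      (boundData ε ++ (boundData δ ++ listData ratData cs))))
    (hB : Small B s) :
    Exec B srToVIPProg { inp := s }
      { inp := (2 * n) :: (rawLayers 0 (mapLayers (fun _ l => rawPairs 0 1 l) n (l :: ls)) ++
        ((cs.zipIdx.flatMap fun x => ballData ε x.2 x.1) ++ [0] ++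
        ((List.range (lastWidth n (l :: ls))).flatMap (closeData δ) ++ [0]))) }
      (1000 * s.length) := by
  subst hs
  set m := lastWidth n (l :: ls)
  have b1 : 4 * n + 3 < 2 ^ B := hB n (by simp)
  have hB := small_right (l := [n]) hB
  have b2 := small_left hB
  have hB := small_right hB
  have b3 := (small_left hB).lt
  have hB := small_right hB
  have b4 := (small_left hB).lt
  have b5 := small_right hB
  have bm : 4 * m + 3 < 2 ^ B := lastWidth_lt _ b2 b1
  have h1 : 1 < 2 ^ B := by omega
  have hm : m ≤ (rawLayers 0 (l :: ls)).length := lastWidth_le l ls n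
  set D := boundData ε ++ (boundData δ ++ listData ratData cs)
  set X := rawLayers 0 (mapLayers (fun _ l => rawPairs 0 1 l) n (l :: ls))
  set O := X.reverse ++ [2 * n]
  set Y := fun u : List ℚ => u.zipIdx.flatMap fun x => ballData ε x.2 x.1 with hY
  set Z := fun i => (List.range i).flatMap (closeData δ) with hZ
  have A₁ : Exec B (block [.copy .inp .out, .bit false .out, .copy .inp .wid, .drop .inp])
      { inp := n :: (rawLayers 0 (l :: ls) ++ D) }
      { inp := rawLayers 0 (l :: ls) ++ D, out := [2 * n], wid := [n] } 5 :=
    Exec.block_eq _ (by simp [OkOps, Op.Ok, Op.run, St.get, St.set]; omega)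
      (by simp [runOps, Op.run, St.get, St.set])
  have A₂ := exec_netProg (layerSpec_layerProg B false true) (layerSpec_layerProg B false true)
    (e := 0) (by omega) h1 l ls n
    { inp := rawLayers 0 (l :: ls) ++ D, out := [2 * n], wid := [n] } D b2 b1 rfl rfl rfl rfl
    rfl rfl
  have A₃ := exec_readEps (B := B)
    { inp := D, out := O, una := List.replicate m 1, wid := [m] } ε _ rfl rfl rfl rfl
  have A₄ := exec_readDelta (B := B)
    { inp := boundData δ ++ listData ratData cs, out := O, una := List.replicate m 1, wid := [m],
      et := boundTag ε, en := boundNum ε, ed := boundDen ε } δ _ rfl rfl rfl rfl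
  have A₅ : Exec B (block [.push .cnt 0])
      { inp := listData ratData cs, out := O, una := List.replicate m 1, wid := [m],
        et := boundTag ε, en := boundNum ε, ed := boundDen ε,
        dt := boundTag δ, dn := boundNum δ, dd := boundDen δ }
      { inp := listData ratData cs ++ [], out := O, una := List.replicate m 1, wid := [m],
        et := boundTag ε, en := boundNum ε, ed := boundDen ε,
        dt := boundTag δ, dn := boundNum δ, dd := boundDen δ, cnt := [0] } 2 :=
    Exec.block_eq _ (by simp [OkOps, Op.Ok]) (by simp [runOps, Op.run, St.get, St.set])
  have A₆ := exec_forRats (B := B) (t := 80) (body := ballProg) (fun u => {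
      out := (Y u).reverse ++ O, una := List.replicate m 1, wid := [m],
      et := boundTag ε, en := boundNum ε, ed := boundDen ε,
      dt := boundTag δ, dn := boundNum δ, dd := boundDen δ }) cs [] (by omega) (by
    intro u x v huv r
    refine (exec_ballProg (i := u.length) ?_ _ ε x b3 (ratOk_of_small b5 (by simp [huv]))
      rfl rfl rfl rfl rfl rfl rfl).cast ?_ le_rfl
    · have : u.length ≤ cs.length := by rw [huv]; simp
      omega
    · simp [hY, List.zipIdx_append])
  have A₇ : Exec B (block [.drop .inp, .push .out 0, .drop .cnt, .push .cnt 0])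
      { inp := [0], out := (Y cs).reverse ++ O, una := List.replicate m 1, wid := [m],
        et := boundTag ε, en := boundNum ε, ed := boundDen ε,
        dt := boundTag δ, dn := boundNum δ, dd := boundDen δ, cnt := [cs.length] }
      { out := 0 :: ((Y cs).reverse ++ O), una := List.replicate m 1, wid := [m],
        et := boundTag ε, en := boundNum ε, ed := boundDen ε,
        dt := boundTag δ, dn := boundNum δ, dd := boundDen δ, cnt := [0] } 5 :=
    Exec.block_eq _ (by simp [OkOps, Op.Ok, Op.run, St.get, St.set])
      (by simp [runOps, Op.run, St.get, St.set])
  have A₈ := exec_forUna (B := B) (t := 40) (body := closeProg .dt .dn .dd) (fun i => {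
      out := (Z i).reverse ++ 0 :: ((Y cs).reverse ++ O), wid := [m],
      et := boundTag ε, en := boundNum ε, ed := boundDen ε,
      dt := boundTag δ, dn := boundNum δ, dd := boundDen δ }) m bm (by
    intro i hi r
    refine (exec_closeProg (i := i) .dt .dn .dd (by decide) (by decide) (by omega) _ δ b4
      rfl rfl rfl rfl).cast ?_ le_rfl
    simp [hZ, List.range_succ])
  have A₉ : Exec B (block [.push .out 0])
      { out := (Z m).reverse ++ 0 :: ((Y cs).reverse ++ O), wid := [m],
        et := boundTag ε, en := boundNum ε, ed := boundDen ε,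
        dt := boundTag δ, dn := boundNum δ, dd := boundDen δ, cnt := [m] }
      { out := 0 :: ((Z m).reverse ++ 0 :: ((Y cs).reverse ++ O)), wid := [m],
        et := boundTag ε, en := boundNum ε, ed := boundDen ε,
        dt := boundTag δ, dn := boundNum δ, dd := boundDen δ, cnt := [m] } 2 :=
    Exec.block_eq _ (by simp [OkOps, Op.Ok]) (by simp [runOps, Op.run, St.get, St.set])
  have A₁₀ := exec_clearAll (B := B) [.wid, .cnt, .et, .en, .ed, .dt, .dn, .dd]
      { out := 0 :: ((Z m).reverse ++ 0 :: ((Y cs).reverse ++ O)), wid := [m],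
        et := boundTag ε, en := boundNum ε, ed := boundDen ε,
        dt := boundTag δ, dn := boundNum δ, dd := boundDen δ, cnt := [m] } (by
    simp [St.get, length_boundTag, length_boundNum, length_boundDen])
  refine ((A₁.seq (A₂.seq (A₃.seq (A₄.seq (A₅.seq (A₆.seq (A₇.seq (A₈.seq (A₉.seq
    A₁₀))))))))).seq_flush (a := .out) (b := .inp) (by decide) rfl).cast ?_ ?_
  · simp [St.get, St.set, O]
    rfl
  · simp only [List.length_cons, List.length_nil, List.length_append, D]
    omega

/-- The program for the reduction from classification robustness to verification. -/
def crToVIPProg : Cmd (Option Stk) :=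
  .seq (.seq (block [.copy .inp .out, .bit false .out, .copy .inp .wid, .drop .inp])
  (.seq (netProg 0 (layerProg false false) (layerProg false true))
  (.seq readEps
  (.seq (block [.push .cnt 0]) (.seq (forRats ballProg)
  (.seq (block ([.drop .inp, .push .out 0, .drop .cnt, .push .cnt 0] ++ mv .inp .con))
  (.seq (forUna maxProg)
  (.seq (block [.push .out 0])
  (clearAll [.wid, .cnt, .et, .en, .ed, .con]))))))))) (flush .out .inp)

/-- As for standard robustness, except that `j`, the last entry of the input, has to be fetched
before the loop over the outputs. -/
theorem exec_crToVIPProg {B n j : ℕ} (l : List RawNode) (ls : List (List RawNode))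
    (ε : WithTop NNRat) (cs : List ℚ) (hn : cs.length = n) (s : List ℕ)
    (hs : s = n :: (rawLayers 0 (l :: ls) ++ (boundData ε ++ (listData ratData cs ++ [j]))))
    (hB : Small B s) :
    Exec B crToVIPProg { inp := s }
      { inp := (2 * n) :: (rawLayers 0 (rawPairs 0 0 l ::
          mapLayers (fun _ l => rawPairs 0 1 l) l.length ls) ++
        ((cs.zipIdx.flatMap fun x => ballData ε x.2 x.1) ++ [0] ++
        ((List.range (lastWidth n (l :: ls))).flatMap (maxData j) ++ [0]))) }
      (1000 * s.length) := by
  subst hs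
  set m := lastWidth n (l :: ls)
  have b1 : 4 * n + 3 < 2 ^ B := hB n (by simp)
  have hB := small_right (l := [n]) hB
  have b2 := small_left hB
  have hB := small_right hB
  have b3 := (small_left hB).lt
  have hB := small_right hB
  have b5 := small_left hB
  have bj : 4 * j + 3 < 2 ^ B := small_right hB j (by simp)
  have bm : 4 * m + 3 < 2 ^ B := lastWidth_lt _ b2 b1
  have h1 : 1 < 2 ^ B := by omega
  have hm : m ≤ (rawLayers 0 (l :: ls)).length := lastWidth_le l ls n
  set D := boundData ε ++ (listData ratData cs ++ [j])
  set X := rawLayers 0 (rawPairs 0 0 l :: mapLayers (fun _ l => rawPairs 0 1 l) l.length ls)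
  set O := X.reverse ++ [2 * n]
  set Y := fun u : List ℚ => u.zipIdx.flatMap fun x => ballData ε x.2 x.1 with hY
  set Z := fun i => (List.range i).flatMap (maxData j) with hZ
  have A₁ : Exec B (block [.copy .inp .out, .bit false .out, .copy .inp .wid, .drop .inp])
      { inp := n :: (rawLayers 0 (l :: ls) ++ D) }
      { inp := rawLayers 0 (l :: ls) ++ D, out := [2 * n], wid := [n] } 5 :=
    Exec.block_eq _ (by simp [OkOps, Op.Ok, Op.run, St.get, St.set]; omega)
      (by simp [runOps, Op.run, St.get, St.set])
  have A₂ := exec_netProg (layerSpec_layerProg B false false) (layerSpec_layerProg B false true)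
    (e := 0) (by omega) h1 l ls n
    { inp := rawLayers 0 (l :: ls) ++ D, out := [2 * n], wid := [n] } D b2 b1 rfl rfl rfl rfl
    rfl rfl
  have A₃ := exec_readEps (B := B)
    { inp := D, out := O, una := List.replicate m 1, wid := [m] } ε _ rfl rfl rfl rfl
  have A₅ : Exec B (block [.push .cnt 0])
      { inp := listData ratData cs ++ [j], out := O, una := List.replicate m 1, wid := [m],
        et := boundTag ε, en := boundNum ε, ed := boundDen ε }
      { inp := listData ratData cs ++ [j], out := O, una := List.replicate m 1, wid := [m],
        et := boundTag ε, en := boundNum ε, ed := boundDen ε, cnt := [0] } 2 :=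
    Exec.block_eq _ (by simp [OkOps, Op.Ok]) (by simp [runOps, Op.run, St.get, St.set])
  have A₆ := exec_forRats (B := B) (t := 80) (body := ballProg) (fun u => {
      out := (Y u).reverse ++ O, una := List.replicate m 1, wid := [m],
      et := boundTag ε, en := boundNum ε, ed := boundDen ε }) cs [j] (by omega) (by
    intro u x v huv r
    refine (exec_ballProg (i := u.length) ?_ _ ε x b3 (ratOk_of_small b5 (by simp [huv]))
      rfl rfl rfl rfl rfl rfl rfl).cast ?_ le_rfl
    · have : u.length ≤ cs.length := by rw [huv]; simp
      omega
    · simp [hY, List.zipIdx_append])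
  have A₇ : Exec B (block ([.drop .inp, .push .out 0, .drop .cnt, .push .cnt 0] ++ mv .inp .con))
      { inp := [0, j], out := (Y cs).reverse ++ O, una := List.replicate m 1, wid := [m],
        et := boundTag ε, en := boundNum ε, ed := boundDen ε, cnt := [cs.length] }
      { out := 0 :: ((Y cs).reverse ++ O), una := List.replicate m 1, wid := [m],
        et := boundTag ε, en := boundNum ε, ed := boundDen ε, cnt := [0], con := [j] } 7 :=
    Exec.block_eq _ (by simp [OkOps, Op.Ok, Op.run, St.get, St.set])
      (by simp [runOps, Op.run, St.get, St.set])
  have A₈ := exec_forUna (B := B) (t := 20) (body := maxProg) (fun i => {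
      out := (Z i).reverse ++ 0 :: ((Y cs).reverse ++ O), wid := [m],
      et := boundTag ε, en := boundNum ε, ed := boundDen ε, con := [j] }) m bm (by
    intro i hi r
    refine (exec_maxProg (i := i) (by omega) bj _ rfl rfl).cast ?_ le_rfl
    simp [hZ, List.range_succ])
  have A₉ : Exec B (block [.push .out 0])
      { out := (Z m).reverse ++ 0 :: ((Y cs).reverse ++ O), wid := [m],
        et := boundTag ε, en := boundNum ε, ed := boundDen ε, cnt := [m], con := [j] }
      { out := 0 :: ((Z m).reverse ++ 0 :: ((Y cs).reverse ++ O)), wid := [m],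
        et := boundTag ε, en := boundNum ε, ed := boundDen ε, cnt := [m], con := [j] } 2 :=
    Exec.block_eq _ (by simp [OkOps, Op.Ok]) (by simp [runOps, Op.run, St.get, St.set])
  have A₁₀ := exec_clearAll (B := B) [.wid, .cnt, .et, .en, .ed, .con]
      { out := 0 :: ((Z m).reverse ++ 0 :: ((Y cs).reverse ++ O)), wid := [m],
        et := boundTag ε, en := boundNum ε, ed := boundDen ε, cnt := [m], con := [j] } (by
    simp [St.get, length_boundTag, length_boundNum, length_boundDen])
  refine ((A₁.seq (A₂.seq (A₃.seq (A₅.seq (A₆.seq (A₇.seq (A₈.seq (A₉.seq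
    A₁₀)))))))).seq_flush (a := .out) (b := .inp) (by decide) rfl).cast ?_ ?_
  · simp [St.get, St.set, O]
    rfl
  · simp only [List.length_cons, List.length_nil, List.length_append, D]
    omega

/-- The largest number formed from an entry `x` is at most `4 * x + 3`, which takes two additional
digits. -/
theorem small_maxBits (l : List ℕ) {a : ℕ} (ha : 2 ≤ a) : Small (maxBits l + a) l := by
  have h : ∀ x ∈ l, x < 2 ^ maxBits l := by
    intro x hx
    rw [← Nat.size_le]
    induction l with
    | nil => simp at hx
    | cons y l ih =>
      rcases List.mem_cons.1 hx with rfl | hx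
      · exact le_max_left _ _
      · exact (ih hx).trans (le_max_right _ _)
  intro x hx
  have h₁ := h x hx
  have h₂ : 2 ^ (maxBits l + 2) ≤ 2 ^ (maxBits l + a) :=
    Nat.pow_le_pow_right two_pos (by omega)
  rw [pow_add] at h₂
  omega

/-! ### The linear-time reductions to verification -/

section Verification

variable {F : Set (ℝ → ℝ)} (code : F ↪ ℕ)

theorem SRInst.data_eq (I : SRInst F) : I.data code =
    I.n :: (rawLayers 0 (I.net.raw code) ++
      (boundData I.ε ++ (boundData I.δ ++ listData ratData (List.ofFn I.center)))) := by
  simp [data, Net.data, Net.layersData_eq, pointData]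

theorem CRInst.data_eq (I : CRInst F) : I.data code =
    I.n :: (rawLayers 0 (I.net.raw code) ++
      (boundData I.ε ++ (listData ratData (List.ofFn I.center) ++ [(I.j : ℕ)]))) := by
  simp [data, Net.data, Net.layersData_eq, pointData]

theorem sr_reducible_vip : LinearTimeReducible (SR F code dInf) (VIP F code) := by
  -- Two additional digits for the indices; 1000 is a generous bound for the operations per entry.
  refine ⟨SRInst.toVIP, .of_exec srToVIPProg 2 1000 fun I => ?_, fun I => I.toVIP_holds.symm⟩
  change Exec (maxBits (I.data code) + 2) _ { inp := I.data code }
    { inp := I.toVIP.data code } (1000 * (I.data code).length)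
  obtain ⟨l, ls, h⟩ := List.exists_cons_of_ne_nil (I.net.raw_ne_nil code)
  refine (exec_srToVIPProg (n := I.n) l ls I.ε I.δ (List.ofFn I.center) (by simp) _
    (by rw [I.data_eq, h]) (small_maxBits _ le_rfl)).cast ?_ le_rfl
  rw [← h, Net.lastWidth_raw, ← Net.raw_double]
  simp [VIPInst.data, SRInst.toVIP, Net.data, Net.layersData_eq, data_ballSpec, data_closeSpec,
    mul_comm]

theorem Net.raw_doubleSame {m n : ℕ} (N : Net F m n) {l : List RawNode}
    {ls : List (List RawNode)} (h : N.raw code = l :: ls) :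
    N.doubleSame.raw code =
      rawPairs 0 0 l :: mapLayers (fun _ l => rawPairs 0 1 l) l.length ls := by
  cases N with
  | output layer =>
    obtain ⟨rfl, rfl⟩ := List.cons.inj h
    simp [doubleSame, raw, mapLayers, rawOf_sameLayer]
  | hidden layer rest =>
    obtain ⟨rfl, rfl⟩ := List.cons.inj h
    simp [doubleSame, raw, rawOf_sameLayer, ← raw_double]

theorem cr_reducible_vip : LinearTimeReducible (CR F code dInf) (VIP F code) := by
  refine ⟨CRInst.toVIP, .of_exec crToVIPProg 2 1000 fun I => ?_, fun I => I.toVIP_holds.symm⟩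
  change Exec (maxBits (I.data code) + 2) _ { inp := I.data code }
    { inp := I.toVIP.data code } (1000 * (I.data code).length)
  obtain ⟨l, ls, h⟩ := List.exists_cons_of_ne_nil (I.net.raw_ne_nil code)
  refine (exec_crToVIPProg (n := I.n) l ls I.ε (List.ofFn I.center) (by simp) _
    (by rw [I.data_eq, h]) (small_maxBits _ le_rfl)).cast ?_ le_rfl
  rw [← h, Net.lastWidth_raw, ← Net.raw_doubleSame code I.net h]
  simp [VIPInst.data, CRInst.toVIP, Net.data, Net.layersData_eq, data_ballSpec, data_maxSpec,
    mul_comm]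

end Verification

/-! ## The machine for the reduction from standard to classification robustness -/

/-- Copy one coordinate of the centre, and emit the nodes for it on the stack `pre`. -/
def centerProg (code : ℕ) : Cmd (Option Stk) :=
  .seq (emit .out [.num 1, .top .rs [], .top .rn [], .top .rd []])
    (emit .pre [.num 1, .num code, .num 0, .num 0, .num 1, .num 1, .top .cnt [], .num 0, .num 1,
      .num 1, .num 0, .num 1, .num code, .top .rs [], .top .rn [], .top .rd [], .num 0])

theorem exec_centerProg {B i code : ℕ} (hB : 4 * i + 3 < 2 ^ B) (hc : code < 2 ^ B) (s : St)
    (x : ℚ) (hx : RatOk B x) (h₀ : s.cnt = [i])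
    (h₁ : s.rs = [sgn x]) (h₂ : s.rn = [x.num.natAbs]) (h₃ : s.rd = [x.den]) :
    Exec B (centerProg code) s { s with
      out := (1 :: ratData x).reverse ++ s.out
      pre := (centerData code i x).reverse ++ s.pre } 30 := by
  have e₀ : sgn x < 2 ^ B := hx _ (by simp [ratData_eq])
  have e₁ : x.num.natAbs < 2 ^ B := hx _ (by simp [ratData_eq])
  have e₂ : x.den < 2 ^ B := hx _ (by simp [ratData_eq])
  have e₄ : i < 2 ^ B := by omega
  have e₅ : 1 < 2 ^ B := by omega
  refine (Exec.seq (exec_emit_eq (t := 5) ?_ rfl le_rfl)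
    (exec_emit_eq (t := 18) ?_ rfl le_rfl)).cast ?_ (by norm_num)
  · simp [Item.Ok, Item.value, St.get, h₁, h₂, h₃, e₀, e₁, e₂, e₅]
  · simp [Item.Ok, Item.value, St.get, St.set, h₀, h₁, h₂, h₃, e₀, e₁, e₂, e₄, e₅, hc]
  · simp [Item.value, St.get, St.set, h₀, h₁, h₂, h₃, ratData_eq, centerData]

/-- Emit the nodes that compare the two copies of one output node. -/
def diffProg (code : ℕ) : Cmd (Option Stk) :=
  emit .out [.num 1, .num code, .num 0, .num 0, .num 1, .num 1, .top .cnt [false], .num 0, .num 1,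
    .num 1, .num 1, .top .cnt [true], .num 1, .num 1, .num 1, .num 0,
    .num 1, .num code, .num 0, .num 0, .num 1, .num 1, .top .cnt [false], .num 1, .num 1,
    .num 1, .num 1, .top .cnt [true], .num 0, .num 1, .num 1, .num 0]

theorem exec_diffProg {B i code : ℕ} (hB : 4 * i + 3 < 2 ^ B) (hc : code < 2 ^ B) (s : St)
    (h : s.cnt = [i]) :
    Exec B (diffProg code) s { s with out := (diffData code i).reverse ++ s.out } 40 := by
  refine exec_emit_eq ?_ ?_ ?_
  · have e₁ : 2 * i < 2 ^ B := by omega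
    have e₂ : 2 * i + 1 < 2 ^ B := by omega
    have e₃ : 1 < 2 ^ B := by omega
    simp [Item.Ok, Item.value, St.get, h, e₁, e₂, e₃, hc]
  · simp [Item.value, St.get, St.set, h, diffData]
  · simp [Item.ops]

/-- The description of the output layer. -/
def deltaData (code m : ℕ) : WithTop NNRat → List ℕ
  | none => [0, 1, 1, code, 0, 0, 1, 0, 0]
  | some q => [0, 2 * m + 1, 1, code, 0, q.num, q.den, 0] ++
      ((List.range m).flatMap (diffData code) ++ [0])

/-- Emit the output layer. -/
def deltaProg (code : ℕ) : Cmd (Option Stk) :=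
  ifz .dt
    (.seq (emit .out [.num 0, .num 1, .num 1, .num code, .num 0, .num 0, .num 1, .num 0, .num 0])
      (clear .una))
    (.seq (emit .out [.num 0, .top .wid [true], .num 1, .num code, .num 0, .top .dn [],
        .top .dd [], .num 0])
      (.seq (forUna (diffProg code)) (block [.push .out 0, .drop .cnt, .push .cnt 0])))

/-- For δ = ∞ no loop consumes the marks on `una`, so they are cleared explicitly. Otherwise the
loop leaves `m` on `cnt`, which is reset to 0 for the subsequent loop over the centre. -/
theorem exec_deltaProg {B m code : ℕ} (hB : 4 * m + 3 < 2 ^ B) (hc : code < 2 ^ B) (s : St)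
    (δ : WithTop NNRat) (hδ : BoundOk B δ) (h₁ : s.una = List.replicate m 1) (h₂ : s.wid = [m])
    (h₃ : s.cnt = [0]) (h₄ : s.dt = boundTag δ) (h₅ : s.dn = boundNum δ) (h₆ : s.dd = boundDen δ) :
    Exec B (deltaProg code) s
      { s with out := (deltaData code m δ).reverse ++ s.out, una := [] } (45 * m + 20) := by
  have e₅ : 1 < 2 ^ B := by omega
  cases δ with
  | top =>
    refine (Exec.ifz_zero (a := .dt) (l := []) h₄ (Exec.seq (exec_emit_eq (t := 10) ?_ rfl le_rfl)
      (exec_clear_eq (n := m) rfl ?_))).cast ?_ (by omega)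
    · simp [Item.Ok, hc, e₅]
    · simp [St.get, St.set, h₁]
    · simp [Item.value, St.get, St.set, deltaData]
  | coe q =>
    have e₁ := hδ q.num (by simp [boundData])
    have e₂ := hδ q.den (by simp [boundData])
    have e₃ : 2 * m + 1 < 2 ^ B := by omega
    set O := [q.den, q.num, 0, code, 1, 2 * m + 1, 0]
    have A := exec_forUna (B := B) (t := 40) (body := diffProg code) (fun i => { s with
      out := ((List.range i).flatMap (diffData code)).reverse ++ 0 :: (O ++ s.out) }) m hB (by
        intro i hi r
        refine (exec_diffProg (i := i) (by omega) hc _ rfl).cast ?_ le_rfl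
        simp [List.range_succ])
    refine (Exec.ifz_ne (a := .dt) (n := 1) (l := []) h₄ one_ne_zero
      (Exec.seq (exec_emit_eq (t := 10) (s' := { s with
        out := 0 :: (O ++ s.out), una := List.replicate m 1, cnt := [0] }) ?_ ?_ ?_)
      (Exec.seq A (Exec.block_eq _ ?_ ?_)))).cast rfl ?_
    · simp [Item.Ok, Item.value, St.get, h₂, h₅, h₆, boundNum, boundDen, e₁, e₂, e₃, e₅, hc]
    · rw [← h₁, ← h₃]
      simp [Item.value, St.get, St.set, h₂, h₅, h₆, boundNum, boundDen, O]
    · simp [Item.ops]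
    · simp [OkOps, Op.Ok, Op.run, St.get, St.set]
    · simp [runOps, Op.run, St.get, St.set, deltaData, O, h₃]
    · simp
      omega

/-- The program for the reduction from standard to classification robustness. -/
def srToCRProg (code : ℕ) : Cmd (Option Stk) :=
  .seq (.seq (.seq (.seq (block (mv .inp .wid))
  (.seq (netProg 1 (layerProg false true) (layerProg false true))
  (.seq readEps (.seq readDelta
  (.seq (block [.push .cnt 0]) (.seq (deltaProg code) (.seq emitEps (.seq (forRats (centerProg code))
  (block [.drop .inp, .push .out 0, .push .out 0, .push .pre 0]))))))))) (flush .out .inp))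
  (flush .pre .inp)) (.seq (emit .inp [.top .cnt [false], .num 1, .top .cnt []])
  (clearAll [.wid, .cnt, .et, .en, .ed, .dt, .dn, .dd]))

/-- The layer with the constants `x̄_i` precedes the network in the new description, but the centre
is read after the network. Its nodes are therefore collected on `pre` and put in front at the end.
-/
theorem exec_srToCRProg {B n code : ℕ} (hc : code < 2 ^ B) (l : List RawNode)
    (ls : List (List RawNode)) (ε δ : WithTop NNRat) (cs : List ℚ) (hn : cs.length = n)
    (s : List ℕ)
    (hs : s = n :: (rawLayers 0 (l :: ls) ++
      (boundData ε ++ (boundData δ ++ listData ratData cs))))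
    (hB : Small B s) :
    Exec B (srToCRProg code) { inp := s }
      { inp := n :: 1 :: (2 * n) :: ((cs.zipIdx.flatMap fun x => centerData code x.2 x.1) ++ 0 ::
        (rawLayers 1 (mapLayers (fun _ l => rawPairs 0 1 l) n (l :: ls)) ++
        (deltaData code (lastWidth n (l :: ls)) δ ++
        (boundData ε ++ (listData ratData cs ++ [0]))))) }
      (10000 * s.length) := by
  subst hs
  set m := lastWidth n (l :: ls)
  have b1 : 4 * n + 3 < 2 ^ B := hB n (by simp)
  have hB := small_right (l := [n]) hB
  have b2 := small_left hB
  have hB := small_right hB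
  have b3 := (small_left hB).lt
  have hB := small_right hB
  have b4 := (small_left hB).lt
  have b5 := small_right hB
  have bm : 4 * m + 3 < 2 ^ B := lastWidth_lt _ b2 b1
  have h1 : 1 < 2 ^ B := by omega
  have hm : m ≤ (rawLayers 0 (l :: ls)).length := lastWidth_le l ls n
  set D := boundData ε ++ (boundData δ ++ listData ratData cs)
  set O := (rawLayers 1 (mapLayers (fun _ l => rawPairs 0 1 l) n (l :: ls))).reverse
  set P := (boundData ε).reverse ++ ((deltaData code m δ).reverse ++ O) with hP
  set Y := fun u : List ℚ => u.zipIdx.flatMap fun x => centerData code x.2 x.1 with hY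
  set Z := fun u : List ℚ => u.flatMap fun x => 1 :: ratData x with hZ
  have A₁ : Exec B (block (mv .inp .wid)) { inp := n :: (rawLayers 0 (l :: ls) ++ D) }
      { inp := rawLayers 0 (l :: ls) ++ D, wid := [n] } 3 :=
    Exec.block_eq _ (by simp [OkOps, Op.Ok, Op.run, St.get, St.set])
      (by simp [runOps, Op.run, St.get, St.set])
  have A₂ := (exec_netProg (layerSpec_layerProg B false true) (layerSpec_layerProg B false true)
    (e := 1) h1 h1 l ls n
    { inp := rawLayers 0 (l :: ls) ++ D, wid := [n] } D b2 b1 rfl rfl rfl rfl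
    rfl rfl).cast (s'' := { inp := D, out := O, una := List.replicate m 1, wid := [m] })
    (by simp [O, m, mapLayers]) le_rfl
  have A₃ := exec_readEps (B := B)
    { inp := D, out := O, una := List.replicate m 1, wid := [m] } ε _ rfl rfl rfl rfl
  have A₄ := exec_readDelta (B := B)
    { inp := boundData δ ++ listData ratData cs, out := O, una := List.replicate m 1, wid := [m],
      et := boundTag ε, en := boundNum ε, ed := boundDen ε } δ _ rfl rfl rfl rfl
  have A₅ : Exec B (block [.push .cnt 0])
      { inp := listData ratData cs, out := O, una := List.replicate m 1, wid := [m],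
        et := boundTag ε, en := boundNum ε, ed := boundDen ε,
        dt := boundTag δ, dn := boundNum δ, dd := boundDen δ }
      { inp := listData ratData cs ++ [], out := O, una := List.replicate m 1, wid := [m],
        et := boundTag ε, en := boundNum ε, ed := boundDen ε,
        dt := boundTag δ, dn := boundNum δ, dd := boundDen δ, cnt := [0] } 2 :=
    Exec.block_eq _ (by simp [OkOps, Op.Ok]) (by simp [runOps, Op.run, St.get, St.set])
  have A₆ := exec_deltaProg bm hc
      { inp := listData ratData cs ++ [], out := O, una := List.replicate m 1, wid := [m],
        et := boundTag ε, en := boundNum ε, ed := boundDen ε,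
        dt := boundTag δ, dn := boundNum δ, dd := boundDen δ, cnt := [0] } δ b4 rfl rfl rfl rfl
      rfl rfl
  have A₇ := exec_emitEps h1
      { inp := listData ratData cs ++ [], out := (deltaData code m δ).reverse ++ O, wid := [m],
        et := boundTag ε, en := boundNum ε, ed := boundDen ε,
        dt := boundTag δ, dn := boundNum δ, dd := boundDen δ, cnt := [0] } ε b3 rfl rfl rfl
  have A₈ := exec_forRats (B := B) (t := 30) (body := centerProg code) (fun u => {
      out := (Z u).reverse ++ P, pre := (Y u).reverse, wid := [m],
      et := boundTag ε, en := boundNum ε, ed := boundDen ε,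
      dt := boundTag δ, dn := boundNum δ, dd := boundDen δ }) cs [] (by omega) (by
    intro u x v huv r
    refine (exec_centerProg (i := u.length) ?_ hc _ x (ratOk_of_small b5 (by simp [huv]))
      rfl rfl rfl rfl).cast ?_ le_rfl
    · have : u.length ≤ cs.length := by rw [huv]; simp
      omega
    · simp [hY, hZ, List.zipIdx_append])
  rw [hn] at A₈
  have A₉ : Exec B (block [.drop .inp, .push .out 0, .push .out 0, .push .pre 0])
      { inp := [0], out := (Z cs).reverse ++ P, pre := (Y cs).reverse, wid := [m],
        et := boundTag ε, en := boundNum ε, ed := boundDen ε,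
        dt := boundTag δ, dn := boundNum δ, dd := boundDen δ, cnt := [n] }
      { out := 0 :: 0 :: ((Z cs).reverse ++ P), pre := 0 :: (Y cs).reverse, wid := [m],
        et := boundTag ε, en := boundNum ε, ed := boundDen ε,
        dt := boundTag δ, dn := boundNum δ, dd := boundDen δ, cnt := [n] } 5 :=
    Exec.block_eq _ (by simp [OkOps, Op.Ok, St.get])
      (by simp [runOps, Op.run, St.get, St.set])
  have A₁₀ := (((A₁.seq (A₂.seq (A₃.seq (A₄.seq (A₅.seq (A₆.seq (A₇.seq (A₈.seq A₉)))))))).seq_flush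
    (a := .out) (b := .inp) (by decide) rfl).seq_flush (a := .pre) (b := .inp) (by decide) rfl).cast
    (s'' := {
      inp := Y cs ++ 0 :: ((0 :: 0 :: ((Z cs).reverse ++ P)).reverse), wid := [m],
      et := boundTag ε, en := boundNum ε, ed := boundDen ε,
      dt := boundTag δ, dn := boundNum δ, dd := boundDen δ, cnt := [n] })
    (by simp [St.get, St.set]) le_rfl
  -- After the loop over the centre `cnt` holds `n`. The three leading entries are pushed directly
  -- on `inp`, the last of them first.
  have A₁₁ := exec_emit (B := B) .inp [.top .cnt [false], .num 1, .top .cnt []] {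
      inp := Y cs ++ 0 :: ((0 :: 0 :: ((Z cs).reverse ++ P)).reverse), wid := [m],
      et := boundTag ε, en := boundNum ε, ed := boundDen ε,
      dt := boundTag δ, dn := boundNum δ, dd := boundDen δ, cnt := [n] } (by
    simp [Item.Ok, Item.value, St.get, h1]
    omega)
  refine (A₁₀.seq (A₁₁.seq (exec_clearAll [.wid, .cnt, .et, .en, .ed, .dt, .dn, .dd] _ ?_))).cast
    ?_ ?_
  · simp [St.get, St.set, length_boundTag, length_boundNum, length_boundDen]
  · simp [Item.value, St.get, St.set, hP, O, listData_eq, hZ, hY]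
  · simp [Item.ops, D]
    omega

/-! ### The linear-time reduction from standard to classification robustness -/

section Classification

variable {F : Set (ℝ → ℝ)} (code : F ↪ ℕ)

theorem SRInst.data_toCR (id' : F) (I : SRInst F) : (I.toCR id').data code =
    I.n :: 1 :: (2 * I.n) :: (((List.ofFn I.center).zipIdx.flatMap fun x =>
      centerData (code id') x.2 x.1) ++ 0 ::
    (rawLayers 1 (mapLayers (fun _ l => rawPairs 0 1 l) I.n (I.net.raw code)) ++
    (deltaData (code id') I.m I.δ ++
    (boundData I.ε ++ (listData ratData (List.ofFn I.center) ++ [0]))))) := by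
  obtain ⟨n, m, N, ε, δ, c⟩ := I
  have h : ∀ (p : ℕ) (last : Fin p → Node F (m * 2)),
      (Net.hidden (centerLayer id' c) (N.doubleThen last)).layersData code =
        1 :: (2 * n) :: (((List.ofFn c).zipIdx.flatMap fun x =>
          centerData (code id') x.2 x.1) ++ 0 ::
        (rawLayers 1 (mapLayers (fun _ l => rawPairs 0 1 l) n (N.raw code)) ++ 0 ::
        rawLayer (rawOf code last))) := by
    intro p last
    rw [Net.layersData, ← rawLayer_rawOf, rawLayer_centerLayer, Net.layersData_eq,
      Net.raw_doubleThen code last N n, rawLayers_append_one]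
    simp
  cases δ with
  | top =>
    have e : rawLayer (rawOf code fun _ : Fin 1 => (⟨id', 0, .zero _⟩ : Node F (m * 2))) =
        [1, 1, code id', 0, 0, 1, 0, 0] := by
      simp [rawOf, rawLayer, listData, RawNode.data, Node.raw, ratData_zero, LinForm.zero]
    change n :: (Net.hidden (centerLayer id' c) (N.doubleThen
      fun _ : Fin 1 => (⟨id', 0, .zero _⟩ : Node F (m * 2)))).layersData code ++
      (boundData ε ++ (pointData c ++ [0])) = _
    rw [h, e]
    simp [deltaData, pointData]
  | coe q =>
    change n :: (Net.hidden (centerLayer id' c) (N.doubleThen (diffLayer id' m q))).layersData code ++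
      (boundData ε ++ (pointData c ++ [0])) = _
    rw [h, rawLayer_diffLayer]
    simp [deltaData, pointData]

theorem sr_reducible_cr (hid : (id : ℝ → ℝ) ∈ F) :
    LinearTimeReducible (SR F code dInf) (CR F code dInf) := by
  refine ⟨SRInst.toCR ⟨id, hid⟩, .of_exec (srToCRProg (code ⟨id, hid⟩)) (2 + code ⟨id, hid⟩) 10000
    fun I => ?_, fun I => (I.toCR_holds hid).symm⟩
  change Exec (maxBits (I.data code) + (2 + code ⟨id, hid⟩)) _ { inp := I.data code }
    { inp := (I.toCR ⟨id, hid⟩).data code } (10000 * (I.data code).length)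
  obtain ⟨l, ls, h⟩ := List.exists_cons_of_ne_nil (I.net.raw_ne_nil code)
  -- The number of the identity does not depend on the instance; as many additional digits as its
  -- own value are more than enough for it.
  have hc : code ⟨id, hid⟩ < 2 ^ (maxBits (I.data code) + (2 + code ⟨id, hid⟩)) :=
    Nat.lt_two_pow_self.trans_le (Nat.pow_le_pow_right two_pos (by omega))
  refine (exec_srToCRProg (n := I.n) hc l ls I.ε I.δ (List.ofFn I.center) (by simp) _
    (by rw [I.data_eq, h]) (small_maxBits _ (Nat.le_add_right _ _))).cast ?_ le_rfl
  rw [← h, Net.lastWidth_raw]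
  exact congrArg (fun s => ({ inp := s } : St)) (SRInst.data_toCR code ⟨id, hid⟩ I).symm

end Classification

/-! ## The machine for the reduction from classification to standard robustness -/

/-- Copy a node, replace each variable by the difference of two variables, and save the original. -/
def splitNodeProg : Cmd (Option Stk) :=
  .seq (block (take ++ take ++ take ++ take))
  (.seq (whilenz .inp
    (.seq (block ([.copy .inp .buf, .drop .inp] ++ (.copy .inp .buf :: mv .inp .cnt) ++
      (.copy .inp .buf :: mv .inp .rs) ++ (.copy .inp .buf :: mv .inp .rn) ++
      (.copy .inp .buf :: mv .inp .rd)))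
    (.seq (emit .out [.num 1, .top .cnt [false, false], .top .rs [], .top .rn [], .top .rd [],
      .num 1, .top .cnt [false, true]])
    (.seq (negSign .out) (.seq (emit .out [.top .rn [], .top .rd []])
    (block [.drop .cnt, .drop .rs, .drop .rn, .drop .rd]))))))
  (block take))

/-- A term becomes two terms with opposite coefficients, which differ only in the sign entry. The
stacks used need not be empty (`rs` holds the width of the layer), so the numbers are placed on top
of their contents and dropped afterwards. -/
theorem exec_splitNodeProg {B : ℕ} (s : St) (v : RawNode) (r : List ℕ)
    (hi : s.inp = v.data ++ r) (hv : Small B v.data) :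
    Exec B splitNodeProg s
      { s with
        inp := r
        out := v.split.data.reverse ++ s.out
        buf := v.data.reverse ++ s.buf } (18 * v.data.length) := by
  obtain ⟨c, q, ts⟩ := v
  have h1 : 1 < 2 ^ B := lt_of_le_of_lt (by norm_num) (two_le_of_small hv)
  simp only [RawNode.data, listData_eq] at hi hv
  set d : ℕ × ℚ → List ℕ := fun t => 1 :: rawTerm t with hd
  set e : ℕ × ℚ → List ℕ := fun t => 1 :: rawTerm (4 * t.1, t.2) ++ 1 :: rawTerm (4 * t.1 + 1, -t.2)
    with he
  refine (Exec.seq (Exec.block_eq (s' := ({ s with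
      inp := ts.flatMap d ++ 0 :: r
      out := (c :: ratData q).reverse ++ s.out
      buf := (c :: ratData q).reverse ++ s.buf } : St)) _ ?_ ?_)
    (Exec.seq (Exec.whilenz_list (K := 18) (fun u v => ({ s with
      inp := v.flatMap d ++ 0 :: r
      out := (u.flatMap e).reverse ++ ((c :: ratData q).reverse ++ s.out)
      buf := (u.flatMap d).reverse ++ ((c :: ratData q).reverse ++ s.buf) } : St)) d ts ⟨_, rfl⟩ ?_)
      (Exec.block_eq _ ?_ ?_))).mono ?_
  · simp [OkOps, Op.Ok, Op.run, St.get, St.set, hi, ratData]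
  · simp [runOps, Op.run, St.get, St.set, hi, ratData]
  · intro u x v huv
    obtain ⟨i, x⟩ := x
    have hx : Small B (i :: ratData x) := fun a ha => hv a (by
      simp only [huv, hd, rawTerm, List.mem_append, List.mem_cons, List.mem_flatMap]
      exact .inr (.inr (.inl ⟨(i, x), by simp, .inr (by simpa using ha)⟩)))
    have hi : 4 * i + 3 < 2 ^ B := hx _ (by simp)
    have e₀ : sgn x < 2 ^ B := hx.lt _ (by simp [ratData_eq])
    have e₁ : x.num.natAbs < 2 ^ B := hx.lt _ (by simp [ratData_eq])
    have e₂ : x.den < 2 ^ B := hx.lt _ (by simp [ratData_eq])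
    refine ⟨⟨1, _, rfl, one_ne_zero⟩, _, ?_, Exec.seq (Exec.block_eq (s' := ({ s with
      inp := v.flatMap d ++ 0 :: r
      out := (u.flatMap e).reverse ++ ((c :: ratData q).reverse ++ s.out)
      buf := (d (i, x)).reverse ++ ((u.flatMap d).reverse ++ ((c :: ratData q).reverse ++ s.buf))
      cnt := i :: s.cnt, rs := sgn x :: s.rs, rn := x.num.natAbs :: s.rn,
      rd := x.den :: s.rd } : St)) _ ?_ ?_)
      (Exec.seq (exec_emit_eq (t := 12) ?_ rfl ?_)
      (Exec.seq (exec_negSign h1 .out _ x (u := s.rs) (v := s.rn) rfl rfl)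
      (Exec.seq (exec_emit_eq (t := 3) ?_ rfl le_rfl)
      (Exec.block_eq _ ?_ ?_))))⟩
    · simp [hd, rawTerm, ratData]
    · simp [OkOps, Op.Ok, Op.run, St.get, St.set, hd, rawTerm, ratData_eq]
    · simp [runOps, Op.run, St.get, St.set, hd, rawTerm, ratData_eq]
    · have e₃ : 2 * (2 * i) < 2 ^ B := by omega
      have e₄ : 2 * (2 * i) + 1 < 2 ^ B := by omega
      simp [Item.Ok, Item.value, St.get, e₀, e₁, e₂, e₃, e₄, h1]
    · simp [Item.ops]
    · simp [Item.Ok, Item.value, St.get, St.set, e₁, e₂]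
    · simp [OkOps, Op.Ok, Op.run, St.get, St.set]
    · have e₃ : 2 * (2 * i) = 4 * i := by ring
      simp [runOps, Op.run, Item.value, St.get, St.set, hd, he, rawTerm, ratData_neg, ratData_eq x,
        e₃]
  · simp [OkOps, Op.Ok, Op.run, St.get, St.set]
  · simp [runOps, Op.run, St.get, St.set, RawNode.split, RawNode.data, listData_eq,
      List.flatMap_assoc, hd, he]
  · simp [RawNode.data, listData_eq, ratData, hd]
    omega

/-- The first layer, up to the connections of its last node. -/
def splitLayerProg (code : ℕ) : Cmd (Option Stk) :=
  .seq (nodesProg true (pairProg splitNodeProg splitNodeProg))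
  (.seq (emit .out [.num 1, .num code, .num 0, .num 0, .num 1])
  (block [.drop .inp, .drop .wid, .copy .rs .wid, .drop .rs]))

/-- The last node of the layer sums over all inputs, but these can be counted only when the centre
is read, after the network. So the node is begun here, with activation and bias, and its list of
terms stays open. -/
theorem exec_splitLayerProg {B code w : ℕ} (hc : code < 2 ^ B) (s : St) (l : List RawNode)
    (r : List ℕ) (hl : Small B (rawLayer l)) (hi : s.inp = rawLayer l ++ r) (hb : s.buf = [])
    (hu : s.una = []) (hr : s.rs = []) (hw : s.wid = [w]) :
    Exec B (splitLayerProg code) s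
      { s with
        inp := r
        out := ((2 * l.length + 1) :: ((l.flatMap fun v => pairData v.split v.split) ++
          [1, code, 0, 0, 1])).reverse ++ s.out
        una := List.replicate l.length 1
        wid := [l.length] } (100 * (rawLayer l).length) := by
  have h2 : 1 < 2 ^ B := lt_of_le_of_lt (by norm_num) (two_le_of_small hl)
  have hsm : ∀ v ∈ l, Small B v.data := fun v hv x hx => hl x (by
    simp only [rawLayer, listData_eq, List.mem_cons, List.mem_append, List.mem_flatMap]
    exact .inr (.inl ⟨v, hv, .inr hx⟩))
  refine (Exec.seq (exec_nodesProg (K := 48) true (pairProg splitNodeProg splitNodeProg)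
    (fun v => pairData v.split v.split) l hl
    (fun v hv s r hi hb => exec_pairProg
      (fun s r hi => exec_splitNodeProg s v r hi (hsm v hv))
      (fun s r hi => exec_splitNodeProg s v r hi (hsm v hv)) s r hi hb (hsm v hv)) s r hi hb hu)
    (Exec.seq (exec_emit_eq (t := 6) ?_ rfl le_rfl) (Exec.block_eq _ ?_ ?_))).cast rfl ?_
  · simp [Item.Ok, hc, h2]
  · simp [OkOps, Op.Ok, Op.run, St.get, St.set, hw]
  · simp [runOps, Op.run, Item.value, St.get, St.set, hw, hr]
  · simp [rawLayer]
    omega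

/-- The radius of the ball in the new instance. -/
def newEps (ε : WithTop NNRat) (cs : List ℚ) : WithTop NNRat :=
  if cs = [] ∨ ε = ((0 : NNRat) : WithTop NNRat) then ((1 : NNRat) : WithTop NNRat) else ε

/-- The centre of the ball in the new instance. -/
def newCenter (cs : List ℚ) : List ℚ := if cs = [] then [0] else cs

/-- Whether the network is evaluated at the centre only. -/
def newMode (ε : WithTop NNRat) (cs : List ℚ) : Bool :=
  decide (cs = []) || decide (ε = ((0 : NNRat) : WithTop NNRat))

/-- Replace the bound on `et`, `en`, `ed` by `1`. -/
def unitEps : Cmd (Option Stk) :=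
  .seq (clearAll [.et, .en, .ed]) (block [.push .et 1, .push .en 1, .push .ed 1])

theorem exec_unitEps {B : ℕ} (h1 : 1 < 2 ^ B) (s : St) (ε : WithTop NNRat)
    (h₁ : s.et = boundTag ε) (h₂ : s.en = boundNum ε) (h₃ : s.ed = boundDen ε) :
    Exec B unitEps s { s with
      et := boundTag ((1 : NNRat) : WithTop NNRat)
      en := boundNum ((1 : NNRat) : WithTop NNRat)
      ed := boundDen ((1 : NNRat) : WithTop NNRat) } 20 := by
  refine (Exec.seq (exec_clearAll _ _ ?_) (Exec.block_eq _ ?_ ?_)).cast rfl ?_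
  · simp [St.get, h₁, h₂, h₃, length_boundTag, length_boundNum, length_boundDen]
  · simp [OkOps, Op.Ok, h1]
  · simp [runOps, Op.run, St.get, St.set, boundTag, boundNum, boundDen]
  · simp

/-- Find out whether the network is to be evaluated at the centre only, and put the answer on
`flag`; adapt the bound and the centre. -/
def modeProg : Cmd (Option Stk) :=
  ifz .inp
    (.seq (block [.push .flag 0, .push .inp 1, .push .inp 0, .push .inp 0, .push .inp 1]) unitEps)
    (ifz .et (block [.push .flag 1])
      (ifz .en (.seq (block [.push .flag 0]) unitEps) (block [.push .flag 1])))

/-- Both degenerate cases are visible on the tops of stacks: the centre has no coordinate if its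
list starts with the end mark, and ε is zero if it is finite with numerator zero. -/
theorem exec_modeProg {B : ℕ} (h1 : 1 < 2 ^ B) (s : St) (ε : WithTop NNRat) (cs : List ℚ)
    (r : List ℕ) (hi : s.inp = listData ratData cs ++ r) (hf : s.flag = [])
    (h₁ : s.et = boundTag ε) (h₂ : s.en = boundNum ε) (h₃ : s.ed = boundDen ε) :
    Exec B modeProg s { s with
      inp := listData ratData (newCenter cs) ++ r
      flag := [bif newMode ε cs then 0 else 1]
      et := boundTag (newEps ε cs)
      en := boundNum (newEps ε cs)
      ed := boundDen (newEps ε cs) } 40 := by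
  cases cs with
  | nil =>
    have hi' : s.get .inp = 0 :: r := hi
    -- The old end mark is reused: pushing denominator, numerator, sign and list mark turns the
    -- empty list into the list with the one coordinate 0.
    refine (Exec.ifz_zero hi' (Exec.seq (Exec.block_eq (s' := { s with
      inp := 1 :: 0 :: 0 :: 1 :: 0 :: r, flag := [0] }) _ ?_ ?_)
      (exec_unitEps h1 _ ε h₁ h₂ h₃))).cast ?_ (by simp)
    · simp [OkOps, Op.Ok, h1]
    · simp [runOps, Op.run, St.get, St.set, hi, hf, listData]
    · simp [newCenter, newMode, newEps, listData, ratData_zero]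
  | cons x cs =>
    have hi' : s.get .inp = 1 :: (ratData x ++ listData ratData cs ++ r) := by
      change s.inp = _
      simpa [listData] using hi
    cases ε with
    | top =>
      refine (Exec.ifz_ne hi' one_ne_zero (Exec.ifz_zero (a := .et) (l := []) h₁
        (Exec.block_eq _ ?_ ?_))).cast rfl (by simp)
      · simp [OkOps, Op.Ok, h1]
      · have e₁ : newMode ⊤ (x :: cs) = false := by simp [newMode]
        have e₂ : newEps ⊤ (x :: cs) = ⊤ := by simp [newEps]
        rw [e₁, e₂, ← h₁, ← h₂, ← h₃]
        simp [runOps, Op.run, St.get, St.set, hf, newCenter, ← hi]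
    | coe q =>
      by_cases hq : q = 0
      · subst hq
        have h₂' : s.get .en = 0 :: [] := h₂
        refine (Exec.ifz_ne hi' one_ne_zero (Exec.ifz_ne (a := .et) (n := 1) (l := []) h₁ one_ne_zero
          (Exec.ifz_zero h₂' (Exec.seq (Exec.block_eq (s' := { s with flag := [0] }) _ ?_ ?_)
          (exec_unitEps h1 _ ((0 : NNRat) : WithTop NNRat) h₁ h₂ h₃))))).cast ?_ (by simp)
        · simp [OkOps, Op.Ok]
        · simp [runOps, Op.run, St.get, St.set, hf]
        · simp [newCenter, newMode, newEps, hi]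
      · have hq' : q.num ≠ 0 := fun h => hq (by
          have : (q : ℚ).num = 0 := Int.natAbs_eq_zero.1 h
          exact_mod_cast Rat.num_eq_zero.1 this)
        have e₀ : ((q : NNRat) : WithTop NNRat) ≠ ((0 : NNRat) : WithTop NNRat) :=
          fun h => hq (WithTop.coe_injective h)
        refine (Exec.ifz_ne hi' one_ne_zero (Exec.ifz_ne (a := .et) (n := 1) (l := []) h₁ one_ne_zero
          (Exec.ifz_ne (a := .en) (n := q.num) (l := []) h₂ hq'
          (Exec.block_eq _ ?_ ?_)))).cast rfl (by simp)
        · simp [OkOps, Op.Ok, h1]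
        · have e₁ : newMode q (x :: cs) = false := by simp [newMode, hq]
          have e₂ : newEps q (x :: cs) = q := by simp [newEps, hq]
          rw [e₁, e₂, ← h₁, ← h₂, ← h₃]
          simp [runOps, Op.run, St.get, St.set, hf, newCenter, ← hi]

/-- The terms of the sum of the distances from the centre. -/
def sumData (i : ℕ) : List ℕ := [1, 4 * i + 2, 0, 1, 1, 1, 4 * i + 3, 0, 1, 1]

/-- Copy one coordinate of the centre to `buf`, emit the nodes for it on the stack `pre`, and the
terms of the sum of the distances on the stack `con`. -/
def partsProg (code : ℕ) : Cmd (Option Stk) :=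
  .seq (emit .con [.num 1, .top .cnt [true, false], .num 0, .num 1, .num 1, .num 1,
    .top .cnt [true, true], .num 0, .num 1, .num 1])
  (.seq (emit .buf [.num 1, .top .rs [], .top .rn [], .top .rd []])
  (.seq (ifz .flag
    (.seq (emit .pre [.num 1, .num code, .top .rs [], .top .rn [], .top .rd [], .num 0, .num 1,
      .num code]) (.seq (negSign .pre) (emit .pre [.top .rn [], .top .rd [], .num 0])))
    (emit .pre [.num 1, .num code, .num 0, .num 0, .num 1, .num 1, .top .cnt [], .num 0, .num 1,
      .num 1, .num 0, .num 1, .num code, .num 0, .num 0, .num 1, .num 1, .top .cnt [], .num 1,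
      .num 1, .num 1, .num 0]))
  (.seq (emit .pre [.num 1, .num code]) (.seq (negSign .pre)
    (emit .pre [.top .rn [], .top .rd [], .num 1, .top .cnt [], .num 0, .num 1, .num 1, .num 0,
      .num 1, .num code, .top .rs [], .top .rn [], .top .rd [], .num 1, .top .cnt [], .num 1,
      .num 1, .num 1, .num 0])))))

/-- One pass over the coordinate serves three places of the new description: the nodes for the
positive and negative parts (`pre`), the terms of `w` (`con`), and the centre itself (`buf`). -/
theorem exec_partsProg {B i code : ℕ} (hB : 4 * i + 3 < 2 ^ B) (hc : code < 2 ^ B) (s : St)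
    (b : Bool) (x : ℚ) (hx : RatOk B x) (h₀ : s.cnt = [i]) (hf : s.flag = [bif b then 0 else 1])
    (h₁ : s.rs = [sgn x]) (h₂ : s.rn = [x.num.natAbs]) (h₃ : s.rd = [x.den]) :
    Exec B (partsProg code) s { s with
      con := (sumData i).reverse ++ s.con
      buf := (1 :: ratData x).reverse ++ s.buf
      pre := (partsData code b i x).reverse ++ s.pre } 120 := by
  have e₀ : sgn x < 2 ^ B := hx _ (by simp [ratData_eq])
  have e₁ : x.num.natAbs < 2 ^ B := hx _ (by simp [ratData_eq])
  have e₂ : x.den < 2 ^ B := hx _ (by simp [ratData_eq])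
  have e₃ : i < 2 ^ B := by omega
  have e₄ : 1 < 2 ^ B := by omega
  have e₅ : 2 * (2 * i + 1) < 2 ^ B := by omega
  have e₆ : 2 * (2 * i + 1) + 1 < 2 ^ B := by omega
  set P₁ : List ℕ := bif b then 1 :: code :: (ratData x ++ [0]) ++ 1 :: code :: (ratData (-x) ++ [0])
    else [1, code, 0, 0, 1, 1, i, 0, 1, 1, 0, 1, code, 0, 0, 1, 1, i, 1, 1, 1, 0] with hP₁
  have A₁ : Exec B (emit .con [.num 1, .top .cnt [true, false], .num 0, .num 1, .num 1, .num 1,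
      .top .cnt [true, true], .num 0, .num 1, .num 1]) s
      { s with con := (sumData i).reverse ++ s.con } 20 := by
    refine exec_emit_eq ?_ ?_ ?_
    · simp [Item.Ok, Item.value, St.get, h₀, e₄, e₅, e₆]
    · have e₇ : 2 * (2 * i + 1) = 4 * i + 2 := by ring
      simp [Item.value, St.get, St.set, h₀, sumData, e₇]
    · simp [Item.ops]
  have A₂ : Exec B (emit .buf [.num 1, .top .rs [], .top .rn [], .top .rd []])
      { s with con := (sumData i).reverse ++ s.con }
      { s with
        con := (sumData i).reverse ++ s.con, buf := (1 :: ratData x).reverse ++ s.buf } 5 := by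
    refine exec_emit_eq ?_ ?_ le_rfl
    · simp [Item.Ok, Item.value, St.get, h₁, h₂, h₃, e₀, e₁, e₂, e₄]
    · simp [Item.value, St.get, St.set, h₁, h₂, h₃, ratData_eq]
  have A₃ : Exec B (ifz .flag
    (.seq (emit .pre [.num 1, .num code, .top .rs [], .top .rn [], .top .rd [], .num 0, .num 1,
      .num code]) (.seq (negSign .pre) (emit .pre [.top .rn [], .top .rd [], .num 0])))
    (emit .pre [.num 1, .num code, .num 0, .num 0, .num 1, .num 1, .top .cnt [], .num 0, .num 1,
      .num 1, .num 0, .num 1, .num code, .num 0, .num 0, .num 1, .num 1, .top .cnt [], .num 1,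
      .num 1, .num 1, .num 0]))
      { s with con := (sumData i).reverse ++ s.con, buf := (1 :: ratData x).reverse ++ s.buf }
      { s with
        con := (sumData i).reverse ++ s.con, buf := (1 :: ratData x).reverse ++ s.buf
        pre := P₁.reverse ++ s.pre } 30 := by
    cases b with
    | true =>
      refine Exec.cast (Exec.ifz_zero (a := .flag) (l := []) hf
        (Exec.seq (exec_emit_eq (t := 9) ?_ rfl le_rfl)
        (Exec.seq (exec_negSign e₄ .pre _ x (u := []) (v := []) ?_ ?_)
        (exec_emit_eq (t := 4) ?_ rfl le_rfl)))) ?_ (by norm_num)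
      · simp [Item.Ok, Item.value, St.get, h₁, h₂, h₃, e₀, e₁, e₂, e₄, hc]
      · simp [St.set, h₁]
      · simp [St.set, h₂]
      · simp [Item.Ok, Item.value, St.get, St.set, h₂, h₃, e₁, e₂]
      · simp [Item.value, St.get, St.set, h₁, h₂, h₃, ratData_neg, ratData_eq x, hP₁]
    | false =>
      refine Exec.cast (Exec.ifz_ne (a := .flag) (n := 1) (l := []) hf one_ne_zero
        (exec_emit_eq (t := 23) ?_ rfl le_rfl)) ?_ (by norm_num)
      · simp [Item.Ok, Item.value, St.get, h₀, e₃, e₄, hc]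
      · simp [Item.value, St.get, St.set, h₀, hP₁]
  refine (A₁.seq (A₂.seq (A₃.seq (Exec.seq (exec_emit_eq (t := 3) ?_ rfl le_rfl)
    (Exec.seq (exec_negSign e₄ .pre _ x (u := []) (v := []) ?_ ?_)
    (exec_emit_eq (t := 20) ?_ rfl le_rfl)))))).cast ?_ (by norm_num)
  · simp [Item.Ok, hc, e₄]
  · simp [St.set, h₁]
  · simp [St.set, h₂]
  · simp [Item.Ok, Item.value, St.get, St.set, h₀, h₁, h₂, h₃, e₀, e₁, e₂, e₃, e₄, hc]
  · cases b <;> simp [Item.value, St.get, St.set, h₀, h₁, h₂, h₃, ratData_neg, ratData_eq x, hP₁,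
      partsData]

/-- Emit the nodes that compare two output nodes, with `j` on `dn`. -/
def compareProg (code : ℕ) : Cmd (Option Stk) :=
  emit .out [.num 1, .num code, .num 0, .num 0, .num 1, .num 1, .top .cnt [false], .num 0, .num 1,
    .num 1, .num 1, .top .dn [true], .num 1, .num 1, .num 1, .num 0,
    .num 1, .num code, .num 0, .num 0, .num 1, .num 1, .top .cnt [false], .num 0, .num 1,
    .num 1, .num 1, .top .dn [true], .num 1, .num 1, .num 1, .num 1, .top .wid [false], .num 1,
    .num 1, .num 1, .num 0]

theorem exec_compareProg {B i j m code : ℕ} (hi : 4 * i + 3 < 2 ^ B) (hj : 4 * j + 3 < 2 ^ B)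
    (hm : 4 * m + 3 < 2 ^ B) (hc : code < 2 ^ B) (s : St)
    (h₁ : s.cnt = [i]) (h₂ : s.dn = [j]) (h₃ : s.wid = [m]) :
    Exec B (compareProg code) s
      { s with out := (compareData code m j i).reverse ++ s.out } 45 := by
  refine exec_emit_eq ?_ ?_ ?_
  · have e₁ : 2 * i < 2 ^ B := by omega
    have e₂ : 2 * j + 1 < 2 ^ B := by omega
    have e₃ : 2 * m < 2 ^ B := by omega
    have e₄ : 1 < 2 ^ B := by omega
    simp [Item.Ok, Item.value, St.get, h₁, h₂, h₃, e₁, e₂, e₃, e₄, hc]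
  · simp [Item.value, St.get, St.set, h₁, h₂, h₃, compareData]
  · simp [Item.ops]

/-- The first part of the program for the reduction from classification to standard robustness:
the first layer. -/
def crToSRFirst (code : ℕ) : Cmd (Option Stk) :=
  .seq (.seq (block (mv .inp .wid)) (.seq (markProg 1) (splitLayerProg code))) (flush .out .fst)

/-- The second part: the other layers, and the additional layers. -/
def crToSRLayers (code : ℕ) : Cmd (Option Stk) :=
  .seq (layersProg 1 (carryLayerProg code)) (.seq readEps (.seq modeProg
  (.seq (block [.push .cnt 0]) (.seq (forRats (partsProg code))
  (.seq (block (.drop .inp :: (mv .inp .dn ++ mv .cnt .dd ++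
    [.push .cnt 0, .push .buf 0, .push .con 0, .push .con 0, .push .pre 0])))
  (.seq (emit .out [.num 0, .top .wid [false]]) (.seq (forUna (compareProg code))
  (.seq (block [.push .out 0]) (.seq emitEps (emit .out [.num 1, .num 0, .num 1]))))))))))

/-- The program for the reduction from classification to standard robustness. -/
def crToSRProg (code : ℕ) : Cmd (Option Stk) :=
  .seq (.seq (.seq (.seq (.seq (.seq (.seq (.seq (crToSRFirst code) (crToSRLayers code))
    (flush .buf .inp)) (flush .out .inp)) (flush .con .inp)) (flush .fst .out)) (flush .out .inp))
    (flush .pre .inp)) (.seq (emit .inp [.top .dd [false, false], .num 1, .top .dd []])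
    (clearAll [.wid, .cnt, .et, .en, .ed, .flag, .dn, .dd]))

theorem exec_crToSRFirst {B n code : ℕ} (hc : code < 2 ^ B) (h1 : 1 < 2 ^ B) (l : List RawNode)
    (ls : List (List RawNode)) (r : List ℕ) (hB : Small B (rawLayers 0 (l :: ls))) :
    Exec B (crToSRFirst code) { inp := n :: (rawLayers 0 (l :: ls) ++ r) }
      { inp := rawLayers 0 ls ++ r
        fst := 1 :: (2 * l.length + 1) :: ((l.flatMap fun v => pairData v.split v.split) ++
          [1, code, 0, 0, 1])
        una := List.replicate l.length 1
        wid := [l.length]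
        flag := [mark 0 ls] } (600 * (rawLayers 0 (l :: ls)).length) := by
  rw [rawLayers_cons] at hB ⊢
  have hl : Small B (rawLayer l) := fun x hx => hB x (by simp [hx])
  have A₁ : Exec B (block (mv .inp .wid))
      { inp := n :: (mark 0 ls :: (rawLayer l ++ rawLayers 0 ls) ++ r) }
      { inp := mark 0 ls :: (rawLayer l ++ (rawLayers 0 ls ++ r)), wid := [n] } 3 :=
    Exec.block_eq _ (by simp [OkOps, Op.Ok, Op.run, St.get, St.set])
      (by simp [runOps, Op.run, St.get, St.set])
  have A₂ := (exec_markProg (e := 1) h1 h1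
    { inp := mark 0 ls :: (rawLayer l ++ (rawLayers 0 ls ++ r)), wid := [n] } ls _ rfl rfl).cast
    (s'' := {
      inp := rawLayer l ++ (rawLayers 0 ls ++ r), wid := [n], flag := [mark 0 ls], out := [1] }) (by simp [mark]) le_rfl
  have A₃ := exec_splitLayerProg hc
    { inp := rawLayer l ++ (rawLayers 0 ls ++ r), wid := [n], flag := [mark 0 ls],
      out := [1] } l _ hl rfl rfl rfl rfl rfl
  refine ((A₁.seq (A₂.seq A₃)).seq_flush (a := .out) (b := .fst) (by decide) rfl).cast ?_ ?_
  · simp [St.get, St.set]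
  · simp only [List.length_cons, List.length_append]
    omega

theorem length_newCenter (cs : List ℚ) :
    (listData ratData (newCenter cs)).length ≤ (listData ratData cs).length + 4 := by
  rw [newCenter]
  split_ifs with h
  · subst h
    simp [listData, ratData_zero]
  · omega

theorem exec_crToSRLayers {B k j code : ℕ} (hc : code < 2 ^ B) (h7 : 7 < 2 ^ B)
    (ls : List (List RawNode)) (ε : WithTop NNRat) (cs : List ℚ) (f : List ℕ)
    (hk : 4 * k + 3 < 2 ^ B) (hn : 4 * cs.length + 3 < 2 ^ B)
    (hB : Small B (rawLayers 0 ls ++ (boundData ε ++ (listData ratData cs ++ [j])))) :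
    Exec B (crToSRLayers code)
      { inp := rawLayers 0 ls ++ (boundData ε ++ (listData ratData cs ++ [j])), fst := f,
        una := List.replicate k 1, wid := [k], flag := [mark 0 ls] }
      { fst := f
        pre := 0 :: ((newCenter cs).zipIdx.flatMap fun x =>
          partsData code (newMode ε cs) x.2 x.1).reverse
        con := 0 :: 0 :: ((List.range (newCenter cs).length).flatMap sumData).reverse
        buf := (listData ratData (newCenter cs)).reverse
        out := (rawLayers 1 (mapLayers (fun w l => rawPairs 0 1 l ++ [rawCarry code w]) k ls) ++
          0 :: (2 * lastWidth k ls) ::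
          ((List.range (lastWidth k ls)).flatMap (compareData code (lastWidth k ls) j) ++
          0 :: (boundData (newEps ε cs) ++ [1, 0, 1]))).reverse
        wid := [lastWidth k ls]
        flag := [bif newMode ε cs then 0 else 1]
        et := boundTag (newEps ε cs)
        en := boundNum (newEps ε cs)
        ed := boundDen (newEps ε cs)
        cnt := [lastWidth k ls]
        dn := [j]
        dd := [(newCenter cs).length] }
      (200 * (rawLayers 0 ls).length + 200 * (listData ratData cs).length + 4 * k +
        50 * lastWidth k ls + 1000) := by
  have h1 : 1 < 2 ^ B := by omega
  set m := lastWidth k ls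
  set cs' := newCenter cs with hcs'
  set b := newMode ε cs
  set ε' := newEps ε cs with hε'
  have b2 := small_left hB
  have hB := small_right hB
  have b3 := (small_left hB).lt
  have hB := small_right hB
  have b5 := small_left hB
  have bj : 4 * j + 3 < 2 ^ B := small_right hB j (by simp)
  have bm : 4 * m + 3 < 2 ^ B := lastWidth_lt _ b2 hk
  have b5' : Small B (listData ratData cs') := by
    rw [hcs', newCenter]
    split_ifs
    · intro x hx
      simp [listData, ratData_zero] at hx
      omega
    · exact b5
  -- The new centre may have one coordinate although the old one has none; `h7` is the bound `4 * 1
  -- + 3` for this case.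
  have bn' : 4 * cs'.length + 3 < 2 ^ B := by
    rw [hcs', newCenter]
    split_ifs
    · simpa using h7
    · exact hn
  have b3' : BoundOk B ε' := by
    rw [hε', newEps]
    split_ifs
    · intro x hx
      simp [boundData] at hx
      omega
    · exact b3
  set D := boundData ε ++ (listData ratData cs ++ [j])
  set X := rawLayers 1 (mapLayers (fun w l => rawPairs 0 1 l ++ [rawCarry code w]) k ls)
  set Y := fun u : List ℚ => u.zipIdx.flatMap fun x => partsData code b x.2 x.1 with hY
  set Z := fun u : List ℚ => u.flatMap fun x => 1 :: ratData x with hZ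
  set W := fun i => (List.range i).flatMap (compareData code m j) with hW
  have A₁ := exec_layersProg (e := 1) (layerSpec_carryLayerProg hc) h1 h1 ls k
    { inp := rawLayers 0 ls ++ D, fst := f, una := List.replicate k 1, wid := [k],
      flag := [mark 0 ls] } D b2 hk rfl rfl rfl rfl rfl rfl
  have A₂ := exec_readEps (B := B)
    { inp := D, fst := f, out := X.reverse ++ [], una := List.replicate m 1, wid := [m] } ε _
    rfl rfl rfl rfl
  have A₃ := exec_modeProg h1
    { inp := listData ratData cs ++ [j], fst := f, out := X.reverse ++ [],
      una := List.replicate m 1, wid := [m],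
      et := boundTag ε, en := boundNum ε, ed := boundDen ε } ε cs [j] rfl rfl rfl rfl rfl
  have A₄ : Exec B (block [.push .cnt 0])
    { inp := listData ratData cs' ++ [j], fst := f, out := X.reverse ++ [],
      una := List.replicate m 1, wid := [m], flag := [bif b then 0 else 1],
      et := boundTag ε', en := boundNum ε', ed := boundDen ε' }
    { inp := listData ratData cs' ++ [j], fst := f, out := X.reverse ++ [],
      una := List.replicate m 1, wid := [m], flag := [bif b then 0 else 1],
      et := boundTag ε', en := boundNum ε', ed := boundDen ε', cnt := [0] } 2 :=
    Exec.block_eq _ (by simp [OkOps, Op.Ok]) (by simp [runOps, Op.run, St.get, St.set])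
  have A₅ := exec_forRats (B := B) (t := 120) (body := partsProg code) (fun u => {
      con := ((List.range u.length).flatMap sumData).reverse, pre := (Y u).reverse,
      buf := (Z u).reverse, fst := f, out := X.reverse ++ [],
      una := List.replicate m 1, wid := [m], flag := [bif b then 0 else 1],
      et := boundTag ε', en := boundNum ε', ed := boundDen ε' }) cs' [j] bn' (by
    intro u x v huv r
    refine (exec_partsProg (i := u.length) ?_ hc _ b x (ratOk_of_small b5' (by simp [huv]))
      rfl rfl rfl rfl rfl).cast ?_ le_rfl
    · have : u.length ≤ cs'.length := by rw [huv]; simp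
      omega
    · simp [hY, hZ, List.zipIdx_append, List.range_succ])
  have A₆ : Exec B (block (.drop .inp :: (mv .inp .dn ++ mv .cnt .dd ++
      [.push .cnt 0, .push .buf 0, .push .con 0, .push .con 0, .push .pre 0])))
      { inp := [0, j], con := ((List.range cs'.length).flatMap sumData).reverse,
        pre := (Y cs').reverse, buf := (Z cs').reverse, fst := f, out := X.reverse ++ [],
        una := List.replicate m 1, wid := [m], flag := [bif b then 0 else 1],
        et := boundTag ε', en := boundNum ε', ed := boundDen ε', cnt := [cs'.length] }
      { con := 0 :: 0 :: ((List.range cs'.length).flatMap sumData).reverse,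
        pre := 0 :: (Y cs').reverse, buf := 0 :: (Z cs').reverse, fst := f, out := X.reverse ++ [],
        una := List.replicate m 1, wid := [m], flag := [bif b then 0 else 1],
        et := boundTag ε', en := boundNum ε', ed := boundDen ε', cnt := [0],
        dn := [j], dd := [cs'.length] } 11 :=
    Exec.block_eq _ (by simp [OkOps, Op.Ok, Op.run, St.get, St.set])
      (by simp [runOps, Op.run, St.get, St.set])
  have A₇ : Exec B (emit .out [.num 0, .top .wid [false]])
      { con := 0 :: 0 :: ((List.range cs'.length).flatMap sumData).reverse,
        pre := 0 :: (Y cs').reverse, buf := 0 :: (Z cs').reverse, fst := f, out := X.reverse ++ [],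
        una := List.replicate m 1, wid := [m], flag := [bif b then 0 else 1],
        et := boundTag ε', en := boundNum ε', ed := boundDen ε', cnt := [0],
        dn := [j], dd := [cs'.length] }
      { con := 0 :: 0 :: ((List.range cs'.length).flatMap sumData).reverse,
        pre := 0 :: (Y cs').reverse, buf := 0 :: (Z cs').reverse, fst := f,
        out := (2 * m) :: 0 :: X.reverse,
        una := List.replicate m 1, wid := [m], flag := [bif b then 0 else 1],
        et := boundTag ε', en := boundNum ε', ed := boundDen ε', cnt := [0],
        dn := [j], dd := [cs'.length] } 4 := by
    refine exec_emit_eq ?_ ?_ le_rfl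
    · simp [Item.Ok, Item.value, St.get]
      omega
    · simp [Item.value, St.get, St.set]
  have A₈ := exec_forUna (B := B) (t := 45) (body := compareProg code) (fun i => {
      con := 0 :: 0 :: ((List.range cs'.length).flatMap sumData).reverse,
      pre := 0 :: (Y cs').reverse, buf := 0 :: (Z cs').reverse, fst := f,
      out := (W i).reverse ++ (2 * m) :: 0 :: X.reverse, wid := [m],
      flag := [bif b then 0 else 1],
      et := boundTag ε', en := boundNum ε', ed := boundDen ε', dn := [j],
      dd := [cs'.length] }) m bm (by
    intro i hi r
    refine (exec_compareProg (i := i) (by omega) bj bm hc _ rfl rfl rfl).cast ?_ le_rfl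
    simp [hW, List.range_succ])
  have A₉ : Exec B (block [.push .out 0])
      { con := 0 :: 0 :: ((List.range cs'.length).flatMap sumData).reverse,
        pre := 0 :: (Y cs').reverse, buf := 0 :: (Z cs').reverse, fst := f,
        out := (W m).reverse ++ (2 * m) :: 0 :: X.reverse, wid := [m],
        flag := [bif b then 0 else 1],
        et := boundTag ε', en := boundNum ε', ed := boundDen ε', cnt := [m], dn := [j],
        dd := [cs'.length] }
      { con := 0 :: 0 :: ((List.range cs'.length).flatMap sumData).reverse,
        pre := 0 :: (Y cs').reverse, buf := 0 :: (Z cs').reverse, fst := f,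
        out := 0 :: ((W m).reverse ++ (2 * m) :: 0 :: X.reverse), wid := [m],
        flag := [bif b then 0 else 1],
        et := boundTag ε', en := boundNum ε', ed := boundDen ε', cnt := [m], dn := [j],
        dd := [cs'.length] } 2 :=
    Exec.block_eq _ (by simp [OkOps, Op.Ok]) (by simp [runOps, Op.run, St.get, St.set])
  have A₁₀ := exec_emitEps h1
      { con := 0 :: 0 :: ((List.range cs'.length).flatMap sumData).reverse,
        pre := 0 :: (Y cs').reverse, buf := 0 :: (Z cs').reverse, fst := f,
        out := 0 :: ((W m).reverse ++ (2 * m) :: 0 :: X.reverse), wid := [m],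
        flag := [bif b then 0 else 1],
        et := boundTag ε', en := boundNum ε', ed := boundDen ε', cnt := [m], dn := [j],
        dd := [cs'.length] } ε' b3' rfl rfl rfl
  have A₁₁ := exec_emit (B := B) .out [.num 1, .num 0, .num 1]
      { con := 0 :: 0 :: ((List.range cs'.length).flatMap sumData).reverse,
        pre := 0 :: (Y cs').reverse, buf := 0 :: (Z cs').reverse, fst := f,
        out := (boundData ε').reverse ++ 0 :: ((W m).reverse ++ (2 * m) :: 0 :: X.reverse),
        wid := [m], flag := [bif b then 0 else 1],
        et := boundTag ε', en := boundNum ε', ed := boundDen ε', cnt := [m], dn := [j],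
        dd := [cs'.length] } (by simp [Item.Ok, h1])
  refine (A₁.seq (A₂.seq (A₃.seq (A₄.seq (A₅.seq (A₆.seq (A₇.seq (A₈.seq (A₉.seq
    (A₁₀.seq A₁₁)))))))))).cast ?_ ?_
  · simp [Item.value, St.get, St.set, hW, hY, hZ, listData_eq]
  · have := length_newCenter cs
    rw [← hcs'] at this
    simp [Item.ops]
    omega

/-- The pieces are put on `inp` from the last to the first: centre, upper layers with the bounds,
terms of `w`, first layer of `N`, layer of parts, header. All of them are stored in reverse except
the one on `fst`, which goes by way of `out` to be reversed twice. -/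
theorem exec_crToSRProg {B n j code : ℕ} (hc : code < 2 ^ B) (h7 : 7 < 2 ^ B) (l : List RawNode)
    (ls : List (List RawNode)) (ε : WithTop NNRat) (cs : List ℚ) (hn : cs.length = n)
    (s : List ℕ)
    (hs : s = n :: (rawLayers 0 (l :: ls) ++ (boundData ε ++ (listData ratData cs ++ [j]))))
    (hB : Small B s) :
    Exec B (crToSRProg code) { inp := s }
      { inp := (newCenter cs).length :: 1 :: (4 * (newCenter cs).length) ::
        (((newCenter cs).zipIdx.flatMap fun x => partsData code (newMode ε cs) x.2 x.1) ++
        0 :: 1 :: (2 * l.length + 1) :: ((l.flatMap fun v => pairData v.split v.split) ++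
        ([1, code, 0, 0, 1] ++ ((List.range (newCenter cs).length).flatMap sumData ++
        0 :: 0 ::
        (rawLayers 1 (mapLayers (fun w l => rawPairs 0 1 l ++ [rawCarry code w]) l.length ls) ++
          0 :: (2 * lastWidth n (l :: ls)) ::
          ((List.range (lastWidth n (l :: ls))).flatMap
            (compareData code (lastWidth n (l :: ls)) j) ++
          0 :: (boundData (newEps ε cs) ++ ([1, 0, 1] ++
          listData ratData (newCenter cs))))))))) }
      (100000000 * s.length) := by
  subst hs
  have b1 : 4 * n + 3 < 2 ^ B := hB n (by simp)
  have hB := small_right (l := [n]) hB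
  have b2 := small_left hB
  have hB' := small_right hB
  have b6 : Small B (rawLayers 0 ls) := fun x hx => b2 x (by rw [rawLayers_cons]; simp [hx])
  have bk : 4 * l.length + 3 < 2 ^ B := b2 _ (by rw [rawLayers_cons]; simp [rawLayer])
  have hm : lastWidth l.length ls ≤ (rawLayers 0 (l :: ls)).length := lastWidth_le l ls n
  have hk := length_le_rawLayer l
  have hle : (rawLayers 0 (l :: ls)).length =
      (rawLayer l).length + (rawLayers 0 ls).length + 1 := by
    rw [rawLayers_cons]; simp
  have A₁ := exec_crToSRFirst (n := n) hc (by omega) l ls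
    (boundData ε ++ (listData ratData cs ++ [j])) b2
  have A₂ := exec_crToSRLayers (j := j) hc h7 ls ε cs (1 :: (2 * l.length + 1) ::
    ((l.flatMap fun v => pairData v.split v.split) ++ [1, code, 0, 0, 1])) bk (hn ▸ b1)
    (fun x hx => by
      rcases List.mem_append.1 hx with h | h
      · exact b6 x h
      · exact hB' x h)
  -- Each of the six flushes multiplies the bound by 5, whence the large constant.
  have A₃ := ((((((A₁.seq A₂).seq_flush (a := .buf) (b := .inp) (by decide) rfl).seq_flush
    (a := .out) (b := .inp) (by decide) rfl).seq_flush
    (a := .con) (b := .inp) (by decide) rfl).seq_flush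
    (a := .fst) (b := .out) (by decide) rfl).seq_flush
    (a := .out) (b := .inp) (by decide) rfl).seq_flush
    (a := .pre) (b := .inp) (by decide) rfl
  refine (A₃.seq (Exec.seq (exec_emit .inp _ _ ?_)
    (exec_clearAll [.wid, .cnt, .et, .en, .ed, .flag, .dn, .dd] _ ?_))).cast ?_ ?_
  · have e₁ : 4 * (newCenter cs).length + 3 < 2 ^ B := by
      rw [newCenter]
      split_ifs
      · simpa using h7
      · exact hn ▸ b1
    have e₂ : 2 * (2 * (newCenter cs).length) < 2 ^ B := by omega
    have e₃ : (newCenter cs).length < 2 ^ B := by omega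
    have e₄ : 1 < 2 ^ B := by omega
    simp [Item.Ok, Item.value, St.get, St.set, e₂, e₃, e₄]
  · simp [St.get, St.set, length_boundTag, length_boundNum, length_boundDen]
  · have e : 2 * (2 * (newCenter cs).length) = 4 * (newCenter cs).length := by ring
    simp [Item.value, St.get, St.set, e, lastWidth]
  · simp only [List.length_append, List.length_cons, List.length_nil, Item.ops,
      List.flatMap_cons, List.flatMap_nil, List.map_cons, List.map_nil]
    omega

/-! ### The linear-time reduction from classification to standard robustness -/

section Standard

variable {F : Set (ℝ → ℝ)} (code : F ↪ ℕ)

theorem rawLayer_guard (c n' : ℕ) (l : List RawNode) :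
    rawLayer (l.flatMap (fun v => [v.split, v.split]) ++ [rawSum c n']) =
      (2 * l.length + 1) :: ((l.flatMap fun v => pairData v.split v.split) ++
        ([1, c, 0, 0, 1] ++ ((List.range n').flatMap sumData ++ [0, 0]))) := by
  simp [rawLayer, listData_eq, List.flatMap_assoc, pairData, rawSum, RawNode.data, rawTerm,
    ratData_one, ratData_zero]
  exact ⟨mul_comm _ _, rfl⟩

/-- Only the values of `e` as natural numbers enter, so the three cases of `CRInst.toSR`, including
the embedding of the empty set of inputs, need just one computation. -/
theorem data_compare {m n n' : ℕ} (r : F) (b : Bool) (c : Fin n' → ℚ) (e : Fin n → Fin n')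
    (he : Function.Injective e) (hv : ∀ i, (e i : ℕ) = i) (j : Fin m) (N : Net F m n)
    {l : List RawNode} {ls : List (List RawNode)} (h : N.raw code = l :: ls)
    (ε : WithTop NNRat) :
    SRInst.data code ⟨n', m * 2, N.compare r b c e he j, ε, ((0 : NNRat) : WithTop NNRat), c⟩ =
      n' :: 1 :: (4 * n') ::
        (((List.ofFn c).zipIdx.flatMap fun x => partsData (code r) b x.2 x.1) ++
        0 :: 1 :: (2 * l.length + 1) :: ((l.flatMap fun v => pairData v.split v.split) ++
        ([1, code r, 0, 0, 1] ++ ((List.range n').flatMap sumData ++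
        0 :: 0 ::
        (rawLayers 1 (mapLayers (fun w l => rawPairs 0 1 l ++ [rawCarry (code r) w]) l.length ls) ++
          0 :: (2 * m) :: ((List.range m).flatMap (compareData (code r) m j) ++
          0 :: (boundData ε ++ ([1, 0, 1] ++ listData ratData (List.ofFn c))))))))) := by
  simp only [SRInst.data, Net.data, Net.compare, Net.layersData]
  rw [← rawLayer_rawOf, rawLayer_partsLayer, Net.layersData_eq, Net.raw_guardFirst code r e he hv,
    rawLayers_append_one, rawLayer_compareLayer, h, guardLayers, rawLayers_cons, rawLayer_guard]
  have hz : boundData ((0 : NNRat) : WithTop NNRat) = [1, 0, 1] := by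
    simp [boundData]
  have hm : mark 1 (mapLayers (fun w l => rawPairs 0 1 l ++ [rawCarry (code r) w]) l.length ls) =
    1 := by simp [mark]
  rw [hz, hm]
  simp [pointData]

theorem cr_reducible_sr (hr : ReLU ∈ F) {d : ∀ n : ℕ, MetricSpace (Fin n → ℝ)}
    (hd : NoIsolatedPoints d) : LinearTimeReducible (CR F code d) (SR F code d) := by
  -- Three additional digits instead of two make room for 7, the bound required by the dummy input;
  -- the others are for the number of ReLU.
  refine ⟨CRInst.toSR ⟨ReLU, hr⟩, .of_exec (crToSRProg (code ⟨ReLU, hr⟩)) (3 + code ⟨ReLU, hr⟩)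
    100000000 fun I => ?_, fun I => (I.toSR_holds hd rfl).symm⟩
  change Exec (maxBits (I.data code) + (3 + code ⟨ReLU, hr⟩)) _ { inp := I.data code }
    { inp := (I.toSR ⟨ReLU, hr⟩).data code } (100000000 * (I.data code).length)
  obtain ⟨l, ls, h⟩ := List.exists_cons_of_ne_nil (I.net.raw_ne_nil code)
  have hc : code ⟨ReLU, hr⟩ < 2 ^ (maxBits (I.data code) + (3 + code ⟨ReLU, hr⟩)) :=
    Nat.lt_two_pow_self.trans_le (Nat.pow_le_pow_right two_pos (by omega))
  have h7 : 7 < 2 ^ (maxBits (I.data code) + (3 + code ⟨ReLU, hr⟩)) :=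
    lt_of_lt_of_le (by norm_num : 7 < 2 ^ 3) (Nat.pow_le_pow_right two_pos (by omega))
  refine (exec_crToSRProg (n := I.n) hc h7 l ls I.ε (List.ofFn I.center) (by simp) _
    (by rw [I.data_eq, h]) (small_maxBits _ (by omega))).cast ?_ le_rfl
  rw [← h, Net.lastWidth_raw]
  refine congrArg (fun s => ({ inp := s } : St)) ?_
  obtain ⟨n, m, N, ε, c, j⟩ := I
  simp only [CRInst.toSR]
  split_ifs with h₁ h₂
  · dsimp only at h₁ h
    subst h₁
    refine Eq.trans ?_ (data_compare code _ _ _ _ _ (fun i => i.elim0) j N h _).symm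
    simp [newCenter, newMode, newEps]
  · dsimp only at h₁ h₂ h
    refine Eq.trans ?_ (data_compare code _ _ _ _ _ (fun i => rfl) j N h _).symm
    simp [newCenter, newMode, newEps, h₁, h₂]
  · dsimp only at h₁ h₂ h
    refine Eq.trans ?_ (data_compare code _ _ _ _ _ (fun i => rfl) j N h _).symm
    have h₃ : ε ≠ 0 := h₂
    simp [newCenter, newMode, newEps, h₁, h₃]

end Standard

end NNVerif

theorem mainTheorem5 (F : Set (ℝ → ℝ)) (code : F ↪ ℕ) :
    NNVerif.LinearTimeReducible (NNVerif.SR F code NNVerif.dInf) (NNVerif.VIP F code) ∧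
    NNVerif.LinearTimeReducible (NNVerif.CR F code NNVerif.dInf) (NNVerif.VIP F code) ∧
    ((id : ℝ → ℝ) ∈ F →
      NNVerif.LinearTimeReducible (NNVerif.SR F code NNVerif.dInf)
        (NNVerif.CR F code NNVerif.dInf)) ∧
    (NNVerif.ReLU ∈ F → ∀ d : ∀ n : ℕ, MetricSpace (Fin n → ℝ), NNVerif.NoIsolatedPoints d →
      NNVerif.LinearTimeReducible (NNVerif.CR F code d) (NNVerif.SR F code d)) :=
  ⟨NNVerif.sr_reducible_vip code, NNVerif.cr_reducible_vip code,
    fun hid => NNVerif.sr_reducible_cr code hid,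
    fun hr _ hd => NNVerif.cr_reducible_sr code hr hd⟩
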